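/- Let either $Y=\mathbb{Z}$, $d=1$ and $L=1$, or $Y=\mathbb{Z}\times\{0,\dots,L-1\}$ with $L\ge 2$ and $d=2$, where addition in the second coordinate of the strip is modulo $L$. Let $e_1$ be the first standard unit vector and $\kappa\in(0,1/(2d)]$. An environment is a family $\omega=(\omega(x,e,i))$, $x\in Y$, $e\in\mathbb{Z}^d$ with $|e|=1$, $i\ge 1$, of numbers in $[\kappa,1-\kappa]$ with $\sum_{|e|=1}\omega(x,e,i)=1$ and $\sum_{|e|=1}\omega(x,e,i)\,e\cdot e_1\ge 0$ for all $x\in Y$ and $i\ge 1$; let $\Omega$ be the space of all environments, with the product $\sigma$-algebra. For $\omega\in\Omega$ let $P_{0,\omega}$ be the law of the excited random walk $(X_n)_{n\ge 0}$ in $\omega$ started at $0$: $X_0=0$, and given $X_0,\dots,X_n$ the walk jumps from $X_n$ to $X_n+e$ with probability $\omega(X_n,e,i)$, where $i=\#\{m\le n : X_m=X_n\}$ (if several unit vectors $e$ lead to the same site, their probabilities are added). Let $\mathbb{P}$ be a probability measure on $\Omega$ under which the family $(\omega(x,\cdot,\cdot))_{x\in Y}$ is i.i.d., with expectation $\mathbb{E}$,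 and let $\delta^0(\omega)=\sum_{i\ge 1}\sum_{|e|=1}\omega(0,e,i)\,e\cdot e_1\in[0,\infty]$ be the total drift of the cookies at $0$. If $\mathbb{E}[\delta^0]>1/L$, then for $\mathbb{P}$-almost all $\omega$ the walk is transient in direction $e_1$, i.e. $P_{0,\omega}$-a.s. $X_n\cdot e_1\to\infty$ as $n\to\infty$. If $\mathbb{E}[\delta^0]\le 1/L$, then for $\mathbb{P}$-almost all $\omega$ the walk is recurrent, i.e. $P_{0,\omega}$-a.s. it returns to its starting point infinitely often, and moreover $P_{0,\omega}$-a.s. $\limsup_{n\to\infty}X_n\cdot e_1=+\infty$ and $\liminf_{n\to\infty}X_n\cdot e_1=-\infty$. -/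

import Mathlib

open MeasureTheory ProbabilityTheory Filter

namespace ERW

/-- The `2d` unit vectors of `ℤ^d`: the pair `(j, s)` is the vector `s • e_{j+1}`, `s = ±1`. -/
abbrev Dir (d : ℕ) : Type := Fin d × ℤˣ

/-- The scalar product `e · e₁` of a unit vector with the first standard unit vector. -/
def Dir.dotE₁ {d : ℕ} (e : Dir d) : ℤ := if (e.1 : ℕ) = 0 then (e.2 : ℤ) else 0

/-- The drift in direction `e₁` of a cookie (a transition vector to the neighbours). -/
noncomputable def cookieDrift {d : ℕ} (p : Dir d → ℝ) : ℝ := ∑ e, p e * (e.dotE₁ : ℝ)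

/-- The space of environments with ellipticity constant `κ` on the set of sites `Y`.
`ω.1 x i e` is the probability to jump from `x` to `x + e` upon the `(i+1)`-st visit to `x`,
i.e. the cookies at each site are numbered from `0`. The space carries the trace of the product σ-algebra. -/
abbrev Env (d : ℕ) (κ : NNReal) (Y : Type) : Type :=
  {ω : Y → ℕ → Dir d → ℝ //
    (∀ x i e, ω x i e ∈ Set.Icc (κ : ℝ) (1 - κ)) ∧
    (∀ x i, ∑ e, ω x i e = 1) ∧
    (∀ x i, 0 ≤ cookieDrift (ω x i))}

/-- The family of cookie sequences `(ω(x,·,·))_{x ∈ Y}` is i.i.d. under `P`. -/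
def IIDSites {d : ℕ} {κ : NNReal} {Y : Type} [Zero Y] (P : Measure (Env d κ Y)) : Prop :=
  iIndepFun (fun (x : Y) (ω : Env d κ Y) => ω.1 x) P ∧
  ∀ x : Y, IdentDistrib (fun ω : Env d κ Y => ω.1 x) (fun ω : Env d κ Y => ω.1 0) P P

/-- The total drift `δ^x` of all the cookies at `x`, a sum of non-negative terms in `[0,∞]`. -/
noncomputable def totalDrift {d : ℕ} {κ : NNReal} {Y : Type} (x : Y) (ω : Env d κ Y) : ENNReal :=
  ∑' i, ENNReal.ofReal (cookieDrift (ω.1 x i))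

section Walk

variable {d : ℕ} {κ : NNReal} {Y : Type} [AddCommGroup Y]

/-- The displacement in `Y` which corresponds to a unit vector, when the `j`-th standard unit
vector of `ℤ^d` corresponds to `b j`. -/
def move (b : Fin d → Y) (e : Dir d) : Y := (e.2 : ℤ) • b e.1

/-- The number of `m < n` with `X_m = X_n`, for a history `(X_0, …, X_n)`. -/
noncomputable def priorVisits {n : ℕ} (h : Finset.Iic n → Y) : ℕ :=
  Set.ncard {m : Finset.Iic n | (m : ℕ) < n ∧ h m = h ⟨n, Finset.mem_Iic.2 le_rfl⟩}

/-- The law of `X_{n+1}` given the history `(X_0, …, X_n) = h`: the next cookie `e ↦ ω(X_n,e,i)` at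
`X_n`, where the present visit to `X_n` is the `i`-th one, is used to pick the step `e`. -/
noncomputable def nextLaw [MeasurableSpace Y] (b : Fin d → Y) (ω : Env d κ Y) (n : ℕ)
    (h : Finset.Iic n → Y) : Measure Y :=
  ∑ e : Dir d,
    ENNReal.ofReal (ω.1 (h ⟨n, Finset.mem_Iic.2 le_rfl⟩) (priorVisits h) e) •
      Measure.dirac (h ⟨n, Finset.mem_Iic.2 le_rfl⟩ + move b e)

/-- `nextLaw` as a kernel. -/
noncomputable def nextKernel [Countable Y] [MeasurableSpace Y] [MeasurableSingletonClass Y]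
    (b : Fin d → Y) (ω : Env d κ Y) (n : ℕ) : Kernel (Finset.Iic n → Y) Y :=
  Kernel.ofFunOfCountable (nextLaw b ω n)

instance [Countable Y] [MeasurableSpace Y] [MeasurableSingletonClass Y]
    (b : Fin d → Y) (ω : Env d κ Y) (n : ℕ) : IsMarkovKernel (nextKernel b ω n) := by
  refine ⟨fun h => ⟨?_⟩⟩
  change nextLaw b ω n h Set.univ = 1
  simp only [nextLaw, Measure.coe_finsetSum, Finset.sum_apply, Measure.smul_apply,
    measure_univ, smul_eq_mul, mul_one]
  rw [← ENNReal.ofReal_sum_of_nonneg, ω.2.2.1, ENNReal.ofReal_one]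
  exact fun e _ => κ.2.trans (ω.2.1 _ _ e).1

/-- The quenched law `P_{x,ω}` of the excited random walk `(X_n)_{n ≥ 0}` which starts at `x` in the
environment `ω`, as a measure on the space of all paths in `Y`. -/
noncomputable def walkLaw [Countable Y] [MeasurableSpace Y] [MeasurableSingletonClass Y]
    (b : Fin d → Y) (ω : Env d κ Y) (x : Y) : Measure (ℕ → Y) :=
  Kernel.traj (X := fun _ => Y) (nextKernel b ω) 0 (fun _ => x)

end Walk

/-- The path returns to its starting point infinitely often. -/
def ReturnsInfinitelyOften {Y : Type} (X : ℕ → Y) : Prop := ∃ᶠ n in atTop, X n = X 0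

/-- The integer sequence `u` has limit superior `+∞` and limit inferior `-∞`. -/
def Oscillates (u : ℕ → ℤ) : Prop :=
  limsup (fun n => ((u n : ℝ) : EReal)) atTop = ⊤ ∧
  liminf (fun n => ((u n : ℝ) : EReal)) atTop = ⊥

/-- The unit vector `e₁` of the line `ℤ`. -/
def lineBasis : Fin 1 → ℤ := ![1]

/-- The strip `ℤ × {0, …, L-1}`, with addition modulo `L` in the second coordinate. -/
abbrev Strip (L : ℕ) : Type := ℤ × ZMod L

/-- The unit vectors `e₁, e₂` of the strip. -/
def stripBasis (L : ℕ) : Fin 2 → Strip L := ![(1, 0), (0, 1)]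

end ERW

/-!
The line and the strips are treated at once, as sets of sites with a height function `ht` whose
levels have `L` elements (`StripData`). Put `D = L * 𝔼[δ⁰]` for the expected drift of the cookies
of one level, and call `p` (`escapeProb`) the annealed probability that the walk never goes below
its starting height. The proof shows that the walk is transient if `p > 0`, that it is recurrent if
`p = 0`, and that `p > 0` if and only if `D > 1`.

Everything is computed with the Markov chain of pairs (environment of the cookies not yet eaten,
position): after one step the walk starts afresh in the environment without the cookie just used
(`walkLaw_eq_sum`). Probabilities and expectations up to exit times are then finite recursions
(`hitExp`, `costExp`), and the strong Markov property is induction on the number of steps.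

*Quenched facts.* In every environment the height is a submartingale, so that by ellipticity the
walk reaches every height (`prob_stay_below`), and either its height tends to infinity or all the
sites are visited infinitely often (`ae_frequently_visit`). By path surgery, a walk which may be
transient may also stay above its starting height forever, and this event does not depend on the
environment below that height (`ae_frequently_ht_le`). So `p = 0` gives recurrence.

*If `p > 0`, the walk is transient* (`prob_negOften_eq_zero`). When a new height is reached for the
first time, the environment ahead is fresh (`lintegral_hitExp`), and the walk escapes with
probability `p`. Thus, if it is below `0` at a late time, there is an independent chance `p` that
it is not below `0` infinitely often; letting the time tend to infinity gives `ρ * p ≤ 0` for the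
probability `ρ` of being below `0` infinitely often.

*If `p = 0`, then `D ≤ 1`* (`lintegral_levelDrift_le_one`). The walk eats all the cookies at a
level, whatever the environment behind is; since environments form a compact space, it does so at a
uniform speed, by Dini's theorem. Hence before it reaches a large height `k` it consumes about `k *
D` of drift. But the drift of the positive part of the height is at least the drift consumed at
non-negative heights, so that no more than `k` can be consumed.

*If `D ≤ 1`, then `p = 0`* (`escapeProb_eq_zero`). Suppose `p > 0`. Then the walk is transient, and
the number of down-crossings from `0` to `-1` before the height `k` is reached is `o(k)` in
expectation (`costExp_down_le`). Thus the height `k` has to be provided by the drift consumed. Of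
the expected drift `k * D` available, each level retains a part: at the first visit the walk eats
one cookie, then steps forward and escapes with probability at least `κ * p`, whatever the other
cookies at the level are (`leftBehind`). So `D` is at least one plus the part retained (`balance`),
whence `D = 1`, nothing is retained, and all the drift at a level is in the first cookie that is
eaten there. But the drift of a single cookie is at most `1 - 2 * κ < 1`.
-/

set_option linter.unusedSectionVars false

namespace ERW

/-! ### The first-step decomposition of the walk -/

section FirstStep

variable {d : ℕ} {κ : NNReal} {Y : Type}

open Classical in
/-- The environment which is left when the first cookie at `x` has been eaten. -/
noncomputable def eat (ω : Env d κ Y) (x : Y) : Env d κ Y :=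
  ⟨fun y i => if y = x then ω.1 y (i + 1) else ω.1 y i, by
    refine ⟨fun y i e => ?_, fun y i => ?_, fun y i => ?_⟩ <;> beta_reduce
    · split_ifs
      exacts [ω.2.1 _ _ _, ω.2.1 _ _ _]
    · split_ifs
      exacts [ω.2.2.1 _ _, ω.2.2.1 _ _]
    · split_ifs
      exacts [ω.2.2.2 _ _, ω.2.2.2 _ _]⟩

lemma eat_self (ω : Env d κ Y) (x : Y) (i : ℕ) : (eat ω x).1 x i = ω.1 x (i + 1) := by
  simp [eat]

lemma eat_of_ne (ω : Env d κ Y) {x y : Y} (h : y ≠ x) : (eat ω x).1 y = ω.1 y := by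
  ext i; simp [eat, h]

lemma env_nonneg (ω : Env d κ Y) (x : Y) (i : ℕ) (e : Dir d) : 0 ≤ ω.1 x i e :=
  κ.2.trans (ω.2.1 x i e).1

lemma measurable_env_apply (y : Y) (i : ℕ) (e : Dir d) :
    Measurable fun ω : Env d κ Y => ω.1 y i e :=
  (measurable_pi_apply e).comp <| (measurable_pi_apply i).comp <|
    (measurable_pi_apply y).comp measurable_subtype_coe

lemma measurable_eat (x : Y) : Measurable fun ω : Env d κ Y => eat ω x := by
  classical
  refine Measurable.subtype_mk ?_
  refine measurable_pi_iff.2 fun y => measurable_pi_iff.2 fun i =>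
    measurable_pi_iff.2 fun e => ?_
  by_cases h : y = x
  · simp only [h, if_true]
    exact measurable_env_apply _ _ _
  · simp only [h, if_false]
    exact measurable_env_apply _ _ _

/-- The path which starts at `x` and continues with `X`. -/
def pathCons (x : Y) (X : ℕ → Y) : ℕ → Y
  | 0 => x
  | n + 1 => X n

@[simp] lemma pathCons_zero (x : Y) (X : ℕ → Y) : pathCons x X 0 = x := rfl

@[simp] lemma pathCons_succ (x : Y) (X : ℕ → Y) (n : ℕ) : pathCons x X (n + 1) = X n := rfl

lemma pathCons_head_tail (X : ℕ → Y) : pathCons (X 0) (fun n => X (n + 1)) = X := by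
  ext n; cases n <;> rfl

/-- The set of all paths which agree with `p` up to time `n`. -/
def pathCylinder (p : ℕ → Y) (n : ℕ) : Set (ℕ → Y) := {X | ∀ i ≤ n, X i = p i}

lemma pathCylinder_eq (p : ℕ → Y) (n : ℕ) :
    pathCylinder p n = Preorder.frestrictLe (π := fun _ => Y) n ⁻¹'
      {Preorder.frestrictLe (π := fun _ => Y) n p} := by
  ext X
  simp only [pathCylinder, Set.mem_ofPred_eq, Set.mem_preimage, Set.mem_singleton_iff, funext_iff,
    Preorder.frestrictLe_apply, Subtype.forall, Finset.mem_Iic]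

variable [MeasurableSpace Y]

@[fun_prop]
lemma measurable_pathCons (x : Y) : Measurable (pathCons x) := by
  refine measurable_pi_iff.2 fun n => ?_
  cases n with
  | zero => exact measurable_const
  | succ n => exact measurable_pi_apply n

variable [Countable Y] [MeasurableSingletonClass Y]

lemma measurableSet_pathCylinder (p : ℕ → Y) (n : ℕ) : MeasurableSet (pathCylinder p n) := by
  rw [pathCylinder_eq]
  exact (Preorder.measurable_frestrictLe n) (measurableSet_singleton _)

lemma isPiSystem_pathCylinder :
    IsPiSystem {s : Set (ℕ → Y) | ∃ p n, s = pathCylinder p n} := by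
  rintro _ ⟨p, n, rfl⟩ _ ⟨q, m, rfl⟩ ⟨X, hp, hq⟩
  refine ⟨X, max n m, ?_⟩
  ext Z
  constructor
  · rintro ⟨h1, h2⟩ i hi
    rcases le_total n m with h | h
    · rw [max_eq_right h] at hi
      rw [h2 i hi, hq i hi]
    · rw [max_eq_left h] at hi
      rw [h1 i hi, hp i hi]
  · intro h
    exact ⟨fun i hi => (h i (hi.trans (le_max_left _ _))).trans (hp i hi),
      fun i hi => (h i (hi.trans (le_max_right _ _))).trans (hq i hi)⟩

lemma generateFrom_pathCylinder :
    (inferInstance : MeasurableSpace (ℕ → Y)) =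
      MeasurableSpace.generateFrom {s : Set (ℕ → Y) | ∃ p n, s = pathCylinder p n} := by
  apply le_antisymm
  · refine iSup_le fun i => ?_
    rintro _ ⟨s, -, rfl⟩
    have : (fun X : ℕ → Y => X i) ⁻¹' s =
        ⋃ h : {h : Finset.Iic i → Y // h ⟨i, Finset.mem_Iic.2 le_rfl⟩ ∈ s},
          {X | Preorder.frestrictLe (π := fun _ => Y) i X = h.1} := by
      ext X
      simp only [Set.mem_preimage, Set.mem_iUnion, Set.mem_ofPred_eq]
      constructor
      · intro h
        exact ⟨⟨Preorder.frestrictLe (π := fun _ => Y) i X, h⟩, rfl⟩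
      · rintro ⟨⟨h, hh⟩, rfl⟩
        exact hh
    change MeasurableSet[MeasurableSpace.generateFrom _] ((fun X : ℕ → Y => X i) ⁻¹' s)
    rw [this]
    refine MeasurableSet.iUnion fun h => ?_
    by_cases hne : ({X | Preorder.frestrictLe (π := fun _ => Y) i X = h.1} : Set (ℕ → Y)).Nonempty
    · obtain ⟨p, hp⟩ := hne
      refine MeasurableSpace.measurableSet_generateFrom ⟨p, i, ?_⟩
      rw [pathCylinder_eq, hp]
      rfl
    · rw [Set.not_nonempty_iff_eq_empty.1 hne]
      exact @MeasurableSet.empty _ (_)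
  · refine MeasurableSpace.generateFrom_le ?_
    rintro _ ⟨p, n, rfl⟩
    exact measurableSet_pathCylinder p n

variable [AddCommGroup Y] (b : Fin d → Y)

instance (ω : Env d κ Y) (x : Y) : IsProbabilityMeasure (walkLaw b ω x) := by
  unfold walkLaw; infer_instance

/-- Prepending `x` raises the number of prior visits by one at `x` and nowhere else: this is what
`eat` does to the numbering of the cookies. -/
lemma priorVisits_pathCons (x : Y) (p : ℕ → Y) (n : ℕ) :
    priorVisits (Preorder.frestrictLe (π := fun _ => Y) (n + 1) (pathCons x p)) =
      priorVisits (Preorder.frestrictLe (π := fun _ => Y) n p) +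
        (open Classical in if p n = x then 1 else 0) := by
  classical
  have key : ∀ (m : ℕ) (q : ℕ → Y),
      priorVisits (Preorder.frestrictLe (π := fun _ => Y) m q) =
        ((Finset.range m).filter fun i => q i = q m).card := by
    intro m q
    rw [priorVisits, ← Set.ncard_coe_finset]
    refine Set.ncard_congr (fun i _ => (i : ℕ)) ?_ ?_ ?_
    · rintro ⟨i, hi⟩ ⟨h1, h2⟩
      simpa using ⟨h1, h2⟩
    · intro i j _ _ h
      exact Subtype.ext h
    · intro i hi
      simp only [Finset.coe_filter, Finset.mem_range, Set.mem_ofPred_eq] at hi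
      exact ⟨⟨i, Finset.mem_Iic.2 hi.1.le⟩, ⟨hi.1, hi.2⟩, rfl⟩
  rw [key, key]
  rw [Finset.card_filter, Finset.card_filter, Finset.sum_range_succ']
  simp only [pathCons_succ, pathCons_zero, eq_comm (a := x)]
  congr

lemma nextLaw_pathCons (ω : Env d κ Y) (x : Y) (p : ℕ → Y) (n : ℕ) :
    nextLaw b ω (n + 1) (Preorder.frestrictLe (π := fun _ => Y) (n + 1) (pathCons x p)) =
      nextLaw b (eat ω x) n (Preorder.frestrictLe (π := fun _ => Y) n p) := by
  unfold nextLaw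
  rw [priorVisits_pathCons]
  refine Finset.sum_congr rfl fun e _ => ?_
  simp only [Preorder.frestrictLe_apply, pathCons_succ]
  by_cases h : p n = x
  · rw [if_pos h, h, eat_self]
  · rw [if_neg h, eat_of_ne _ h, add_zero]

lemma walkLaw_pathCylinder_succ (ω : Env d κ Y) (x : Y) (p : ℕ → Y) (n : ℕ) :
    walkLaw b ω x (pathCylinder p (n + 1)) = walkLaw b ω x (pathCylinder p n) *
      nextLaw b ω n (Preorder.frestrictLe (π := fun _ => Y) n p) {p (n + 1)} := by
  have h := Kernel.partialTraj_compProd_eq_map_traj (X := fun _ => Y) (κ := nextKernel b ω)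
    (Nat.zero_le n) (x₀ := fun _ => x)
  have hset : pathCylinder p (n + 1) =
      (fun X : ℕ → Y => (Preorder.frestrictLe (π := fun _ => Y) n X, X (n + 1))) ⁻¹'
        ({Preorder.frestrictLe (π := fun _ => Y) n p} ×ˢ {p (n + 1)}) := by
    ext X
    have := pathCylinder_eq p n
    rw [Set.ext_iff] at this
    have := this X
    simp only [Set.mem_preimage, Set.mem_singleton_iff] at this
    simp only [Set.mem_preimage, Set.mem_prod, Set.mem_singleton_iff, ← this, pathCylinder,
      Set.mem_ofPred_eq]
    constructor
    · intro h
      exact ⟨fun i hi => h i (by omega), h _ le_rfl⟩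
    · rintro ⟨h1, h2⟩ i hi
      rcases Nat.lt_or_ge n i with h | h
      · obtain rfl : i = n + 1 := by omega
        exact h2
      · exact h1 i h
  have hm : Measurable fun X : ℕ → Y =>
      (Preorder.frestrictLe (π := fun _ => Y) n X, X (n + 1)) := by fun_prop
  rw [hset, walkLaw, ← Measure.map_apply hm
    ((measurableSet_singleton _).prod (measurableSet_singleton _)), ← h,
    Measure.compProd_apply_prod (measurableSet_singleton _) (measurableSet_singleton _),
    Measure.restrict_singleton, lintegral_smul_measure, lintegral_dirac,
    ← Kernel.traj_map_frestrictLe_apply, Measure.map_apply (Preorder.measurable_frestrictLe n)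
      (measurableSet_singleton _), ← pathCylinder_eq]
  rfl

open Classical in
lemma walkLaw_pathCylinder_zero (ω : Env d κ Y) (x : Y) (p : ℕ → Y) :
    walkLaw b ω x (pathCylinder p 0) = if p 0 = x then 1 else 0 := by
  rw [pathCylinder_eq, walkLaw, ← Measure.map_apply (Preorder.measurable_frestrictLe 0)
    (measurableSet_singleton _), Kernel.traj_map_frestrictLe_apply, Kernel.partialTraj_self,
    Kernel.id_apply, Measure.dirac_apply' _ (measurableSet_singleton _)]
  have : (fun _ => x : Finset.Iic 0 → Y) ∈
      ({Preorder.frestrictLe (π := fun _ => Y) 0 p} : Set (Finset.Iic 0 → Y)) ↔ p 0 = x := by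
    rw [Set.mem_singleton_iff]
    constructor
    · intro h
      exact (congrFun h ⟨0, Finset.mem_Iic.2 le_rfl⟩).symm
    · intro h
      ext ⟨i, hi⟩
      obtain rfl : i = 0 := by simpa using hi
      exact h.symm
  rw [Set.indicator_apply]
  simp only [this, Pi.one_apply]

/-- The law of the walk as a mixture over the first step: after it, the walk starts afresh in the
environment in which the first cookie at the starting point has been eaten. -/
theorem walkLaw_eq_sum (ω : Env d κ Y) (x : Y) :
    walkLaw b ω x = ∑ e : Dir d, ENNReal.ofReal (ω.1 x 0 e) •
      (walkLaw b (eat ω x) (x + move b e)).map (pathCons x) := by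
  classical
  have hsum : ∑ e : Dir d, ENNReal.ofReal (ω.1 x 0 e) = 1 := by
    rw [← ENNReal.ofReal_sum_of_nonneg fun e _ => env_nonneg ω x 0 e, ω.2.2.1, ENNReal.ofReal_one]
  refine ext_of_generate_finite _ generateFrom_pathCylinder isPiSystem_pathCylinder ?_ ?_
  · rintro _ ⟨q, n, rfl⟩
    simp only [Measure.coe_finsetSum, Finset.sum_apply, Measure.smul_apply, smul_eq_mul,
      Measure.map_apply (measurable_pathCons x) (measurableSet_pathCylinder _ _)]
    by_cases hq : q 0 = x
    · obtain ⟨p, rfl⟩ : ∃ p, q = pathCons x p :=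
        ⟨fun n => q (n + 1), by rw [← hq, pathCons_head_tail]⟩
      have hpre : ∀ n, pathCons x ⁻¹' pathCylinder (pathCons x p) (n + 1) = pathCylinder p n := by
        intro n
        ext X
        constructor
        · intro h i hi
          exact h (i + 1) (by omega)
        · intro h i hi
          cases i with
          | zero => rfl
          | succ i => exact h i (by omega)
      rcases n with _ | n
      · have : pathCons x ⁻¹' pathCylinder (pathCons x p) 0 = Set.univ := by
          ext X
          simp [pathCylinder]
        simp [this, walkLaw_pathCylinder_zero, hsum]
      · rw [hpre]
        induction n with
        | zero =>
          rw [walkLaw_pathCylinder_succ, walkLaw_pathCylinder_zero, if_pos hq, one_mul, nextLaw]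
          simp only [Measure.coe_finsetSum, Finset.sum_apply, Measure.smul_apply, smul_eq_mul,
            Measure.dirac_apply' _ (measurableSet_singleton _), walkLaw_pathCylinder_zero]
          have h0 : priorVisits (Preorder.frestrictLe (π := fun _ => Y) 0 (pathCons x p)) = 0 := by
            rw [priorVisits]; simp
          rw [h0]
          refine Finset.sum_congr rfl fun e _ => ?_
          simp [Set.indicator_apply, eq_comm]
        | succ n ih =>
          rw [walkLaw_pathCylinder_succ, ih, nextLaw_pathCons, Finset.sum_mul]
          refine Finset.sum_congr rfl fun e _ => ?_
          rw [walkLaw_pathCylinder_succ, mul_assoc]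
          rfl
    · have h1 : walkLaw b ω x (pathCylinder q n) = 0 := by
        refine measure_mono_null (t := pathCylinder q 0) (fun X h i hi => h i (by omega)) ?_
        rw [walkLaw_pathCylinder_zero, if_neg hq]
      have h2 : pathCons x ⁻¹' pathCylinder q n = ∅ := by
        ext X
        simp only [Set.mem_preimage, Set.mem_empty_iff_false, iff_false]
        intro h
        exact hq (h 0 (by omega)).symm
      simp [h1, h2]
  · simp only [Measure.coe_finsetSum, Finset.sum_apply, Measure.smul_apply, smul_eq_mul,
      Measure.map_apply (measurable_pathCons x) MeasurableSet.univ, Set.preimage_univ,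
      measure_univ, mul_one, hsum]

/-- The expectation of `u` after one step of the pair (environment which is left, position). -/
noncomputable def avg (u : Env d κ Y → Y → ℝ) (ω : Env d κ Y) (x : Y) : ℝ :=
  ∑ e, ω.1 x 0 e * u (eat ω x) (x + move b e)

/-- The quenched probability of a set of paths. -/
noncomputable def prob (B : Set (ℕ → Y)) (ω : Env d κ Y) (x : Y) : ℝ := (walkLaw b ω x).real B

lemma prob_nonneg (B : Set (ℕ → Y)) (ω : Env d κ Y) (x : Y) : 0 ≤ prob b B ω x :=
  measureReal_nonneg

lemma prob_le_one (B : Set (ℕ → Y)) (ω : Env d κ Y) (x : Y) : prob b B ω x ≤ 1 :=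
  measureReal_le_one

/-- The first-step decomposition for probabilities; every quenched recursion rests on it. -/
theorem prob_eq_avg {B : Set (ℕ → Y)} (hB : MeasurableSet B) (ω : Env d κ Y) (x : Y) :
    prob b B ω x = avg b (prob b (pathCons x ⁻¹' B)) ω x := by
  have h := congrArg (fun μ => (μ B).toReal) (walkLaw_eq_sum b ω x)
  simp only [Measure.coe_finsetSum, Finset.sum_apply, Measure.smul_apply, smul_eq_mul,
      Measure.map_apply (measurable_pathCons x) hB] at h
  rw [ENNReal.toReal_sum (fun e _ => ENNReal.mul_ne_top ENNReal.ofReal_ne_top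
    (measure_ne_top _ _))] at h
  simp only [ENNReal.toReal_mul, ENNReal.toReal_ofReal (env_nonneg ω x 0 _)] at h
  exact h

lemma measurable_avg {u : Env d κ Y → Y → ℝ} (hu : ∀ x, Measurable fun ω => u ω x) (x : Y) :
    Measurable fun ω => avg b u ω x := by
  unfold avg
  refine Finset.measurable_sum _ fun e _ => (measurable_env_apply _ _ _).mul ?_
  exact (hu _).comp (measurable_eat x)

lemma measurable_prob {B : Set (ℕ → Y)} (hB : MeasurableSet B) (x : Y) :
    Measurable fun ω : Env d κ Y => prob b B ω x := by
  have key : ∀ n (p : ℕ → Y) (x : Y), Measurable fun ω : Env d κ Y =>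
      prob b (pathCylinder p n) ω x := by
    intro n
    induction n with
    | zero =>
      intro p x
      simp only [prob, Measure.real, walkLaw_pathCylinder_zero]
      exact measurable_const
    | succ n ih =>
      intro p x
      simp only [prob_eq_avg b (measurableSet_pathCylinder p (n + 1))]
      by_cases hp : p 0 = x
      · have : pathCons x ⁻¹' pathCylinder p (n + 1) = pathCylinder (fun i => p (i + 1)) n := by
          ext X
          constructor
          · intro h i hi
            exact h (i + 1) (by omega)
          · intro h i hi
            cases i with
            | zero => exact hp.symm
            | succ i => exact h i (by omega)
        simp only [this]
        exact measurable_avg b (ih _) x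
      · have : pathCons x ⁻¹' pathCylinder p (n + 1) = ∅ := by
          ext X
          simp only [Set.mem_preimage, Set.mem_empty_iff_false, iff_false]
          intro h
          exact hp (h 0 (by omega)).symm
        simp [this, prob, avg]
  have hm : Measurable fun ω : Env d κ Y => walkLaw b ω x := by
    refine Measurable.measure_of_isPiSystem_of_isProbabilityMeasure generateFrom_pathCylinder
      isPiSystem_pathCylinder ?_
    rintro _ ⟨p, n, rfl⟩
    simpa [prob, Measure.real] using (key n p x).ennreal_ofReal
  exact ((Measure.measurable_coe hB).comp hm).ennreal_toReal

/-- Almost surely the walk starts at its starting point. -/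
lemma walkLaw_ae_zero (ω : Env d κ Y) (x : Y) : ∀ᵐ X ∂walkLaw b ω x, X 0 = x := by
  have : walkLaw b ω x (pathCylinder (fun _ => x) 0)ᶜ = 0 := by
    rw [prob_compl_eq_zero_iff (measurableSet_pathCylinder _ _), walkLaw_pathCylinder_zero]
    simp
  rw [ae_iff]
  refine measure_mono_null (fun X hX => ?_) this
  simp only [pathCylinder, Set.mem_compl_iff, Set.mem_ofPred_eq] at hX ⊢
  exact fun h => hX (h 0 le_rfl)

end FirstStep

/-! ### Strips, and expectations up to an exit time -/

/-- What is used of the geometry of the line and of the strips: a height function `ht` which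
changes by `e · e₁` when the walk makes the step `e`, all of whose level sets have exactly `L`
elements and are connected through steps orthogonal to `e₁`. -/
structure StripData {d : ℕ} {Y : Type} [AddCommGroup Y] (b : Fin d → Y) (L : ℕ) where
  ht : Y →+ ℤ
  ht_move : ∀ e : Dir d, ht (move b e) = e.dotE₁
  level : ℤ → Finset Y
  mem_level : ∀ j y, y ∈ level j ↔ ht y = j
  card_level : ∀ j, (level j).card = L
  conn : ∀ x y, ht x = ht y →
    Relation.ReflTransGen (fun x y => ∃ e : Dir d, e.dotE₁ = 0 ∧ y = x + move b e) x y

/-- The direction `e₁`. -/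
def fwd (d : ℕ) [NeZero d] : Dir d := (0, 1)

/-- The direction `-e₁`. -/
def bwd (d : ℕ) [NeZero d] : Dir d := (0, -1)

lemma dotE₁_fwd (d : ℕ) [NeZero d] : (fwd d).dotE₁ = 1 := by simp [fwd, Dir.dotE₁]

lemma dotE₁_bwd (d : ℕ) [NeZero d] : (bwd d).dotE₁ = -1 := by simp [bwd, Dir.dotE₁]

lemma dotE₁_eq_neg_one_iff {d : ℕ} [NeZero d] (e : Dir d) : e.dotE₁ = -1 ↔ e = bwd d := by
  constructor
  · intro h
    obtain ⟨j, s⟩ := e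
    simp only [Dir.dotE₁] at h
    split_ifs at h with h0
    refine Prod.ext (Fin.ext (by simpa [bwd] using h0)) (Units.ext (by simpa [bwd] using h))
  · rintro rfl
    exact dotE₁_bwd d

lemma dotE₁_cases {d : ℕ} (e : Dir d) : e.dotE₁ = 1 ∨ e.dotE₁ = 0 ∨ e.dotE₁ = -1 := by
  simp only [Dir.dotE₁]
  split_ifs
  · rcases Int.units_eq_one_or e.2 with h | h <;> simp [h]
  · simp

section Operators

variable {d : ℕ} {κ : NNReal} {Y : Type} [AddCommGroup Y] (b : Fin d → Y)

section Avg

variable {b} {u v : Env d κ Y → Y → ℝ} {ω : Env d κ Y} {x : Y}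

lemma avg_mono (h : ∀ e, u (eat ω x) (x + move b e) ≤ v (eat ω x) (x + move b e)) :
    avg b u ω x ≤ avg b v ω x :=
  Finset.sum_le_sum fun e _ => mul_le_mul_of_nonneg_left (h e) (env_nonneg ω x 0 e)

lemma avg_congr (h : ∀ e, u (eat ω x) (x + move b e) = v (eat ω x) (x + move b e)) :
    avg b u ω x = avg b v ω x :=
  Finset.sum_congr rfl fun e _ => by rw [h e]

lemma avg_const (c : ℝ) : avg b (fun _ _ => c) ω x = c := by
  simp only [avg, ← Finset.sum_mul, ω.2.2.1, one_mul]

lemma avg_eq_const {c : ℝ} (h : ∀ e, u (eat ω x) (x + move b e) = c) : avg b u ω x = c := by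
  rw [← avg_const (b := b) (ω := ω) (x := x) c]; exact avg_congr h

lemma avg_le_const {c : ℝ} (h : ∀ e, u (eat ω x) (x + move b e) ≤ c) : avg b u ω x ≤ c := by
  rw [← avg_const (b := b) (ω := ω) (x := x) c]; exact avg_mono h

lemma const_le_avg {c : ℝ} (h : ∀ e, c ≤ u (eat ω x) (x + move b e)) : c ≤ avg b u ω x := by
  rw [← avg_const (b := b) (ω := ω) (x := x) c]; exact avg_mono h

lemma avg_add : avg b (fun η y => u η y + v η y) ω x = avg b u ω x + avg b v ω x := by
  simp only [avg, mul_add, Finset.sum_add_distrib]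

lemma avg_sub : avg b (fun η y => u η y - v η y) ω x = avg b u ω x - avg b v ω x := by
  simp only [avg, mul_sub, Finset.sum_sub_distrib]

lemma avg_mul_const (c : ℝ) : avg b (fun η y => u η y * c) ω x = avg b u ω x * c := by
  simp only [avg, Finset.sum_mul, mul_assoc]

lemma avg_sum {ι : Type*} (s : Finset ι) (w : ι → Env d κ Y → Y → ℝ) :
    avg b (fun η y => ∑ i ∈ s, w i η y) ω x = ∑ i ∈ s, avg b (w i) ω x := by
  simp only [avg, Finset.mul_sum]
  exact Finset.sum_comm

/-- Ellipticity: if `u` is smaller by `ε` after one particular step, then the average is smaller by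
at least `κ * ε`. -/
lemma avg_le_sub {c ε : ℝ} (e₀ : Dir d) (h : ∀ e, u (eat ω x) (x + move b e) ≤ c)
    (h₀ : u (eat ω x) (x + move b e₀) ≤ c - ε) (hε : 0 ≤ ε) : avg b u ω x ≤ c - κ * ε := by
  classical
  have h1 : avg b u ω x ≤ ∑ e, ω.1 x 0 e * (c - if e = e₀ then ε else 0) := by
    refine Finset.sum_le_sum fun e _ => mul_le_mul_of_nonneg_left ?_ (env_nonneg ω x 0 e)
    split_ifs with he
    · rw [he]; exact h₀
    · simpa using h e
  refine h1.trans ?_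
  have h2 : ∑ e, ω.1 x 0 e * (c - if e = e₀ then ε else 0) = c - ω.1 x 0 e₀ * ε := by
    simp only [mul_sub, Finset.sum_sub_distrib, ← Finset.sum_mul, ω.2.2.1, one_mul, mul_ite,
      mul_zero, Finset.sum_ite_eq', Finset.mem_univ, if_true]
  rw [h2]
  have := mul_le_mul_of_nonneg_right (ω.2.1 x 0 e₀).1 hε
  linarith

end Avg

open Classical in
/-- The expectation of `v` at the exit time from `A`, on the event that this time is at
most `n`. The function `v` is evaluated at the pair (environment which is left, position), so it may
look at the cookies not yet eaten; outside of `A` the exit time is `0`. -/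
noncomputable def hitExp (A : Set Y) (v : Env d κ Y → Y → ℝ) : ℕ → Env d κ Y → Y → ℝ
  | 0 => fun ω x => if x ∈ A then 0 else v ω x
  | n + 1 => fun ω x => if x ∈ A then avg b (hitExp A v n) ω x else v ω x

open Classical in
/-- The expected sum of the costs `c` over the first `n` steps, stopped at the exit from `A`. The
cost `c` is a function of the environment which is left and of the position before the step. -/
noncomputable def costExp (A : Set Y) (c : Env d κ Y → Y → ℝ) : ℕ → Env d κ Y → Y → ℝ
  | 0 => fun _ _ => 0
  | n + 1 => fun ω x => if x ∈ A then c ω x + avg b (costExp A c n) ω x else 0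

variable {b} {A : Set Y} {u v c c' : Env d κ Y → Y → ℝ} {ω : Env d κ Y} {x : Y}

lemma hitExp_of_notMem (hx : x ∉ A) (n : ℕ) : hitExp b A v n ω x = v ω x := by
  cases n <;> simp [hitExp, hx]

lemma hitExp_zero_of_mem (hx : x ∈ A) : hitExp b A v 0 ω x = 0 := by simp [hitExp, hx]

lemma hitExp_succ_of_mem (hx : x ∈ A) (n : ℕ) :
    hitExp b A v (n + 1) ω x = avg b (hitExp b A v n) ω x := by simp [hitExp, hx]

lemma costExp_of_notMem (hx : x ∉ A) (n : ℕ) : costExp b A c n ω x = 0 := by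
  cases n <;> simp [costExp, hx]

lemma costExp_succ_of_mem (hx : x ∈ A) (n : ℕ) :
    costExp b A c (n + 1) ω x = c ω x + avg b (costExp b A c n) ω x := by simp [costExp, hx]

lemma hitExp_nonneg (hv : ∀ ω x, x ∉ A → 0 ≤ v ω x) (n : ℕ) (ω : Env d κ Y) (x : Y) :
    0 ≤ hitExp b A v n ω x := by
  by_cases hx : x ∈ A
  · induction n generalizing ω x with
    | zero => rw [hitExp_zero_of_mem hx]
    | succ n ih =>
      rw [hitExp_succ_of_mem hx]
      refine const_le_avg fun e => ?_
      by_cases h : x + move b e ∈ A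
      · exact ih _ _ h
      · rw [hitExp_of_notMem h]; exact hv _ _ h
  · rw [hitExp_of_notMem hx]; exact hv _ _ hx

lemma hitExp_mono (h : ∀ ω x, x ∉ A → u ω x ≤ v ω x) (n : ℕ) (ω : Env d κ Y) (x : Y) :
    hitExp b A u n ω x ≤ hitExp b A v n ω x := by
  by_cases hx : x ∈ A
  · induction n generalizing ω x with
    | zero => rw [hitExp_zero_of_mem hx, hitExp_zero_of_mem hx]
    | succ n ih =>
      rw [hitExp_succ_of_mem hx, hitExp_succ_of_mem hx]
      refine avg_mono fun e => ?_
      by_cases hy : x + move b e ∈ A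
      · exact ih _ _ hy
      · rw [hitExp_of_notMem hy, hitExp_of_notMem hy]; exact h _ _ hy
  · rw [hitExp_of_notMem hx, hitExp_of_notMem hx]; exact h _ _ hx

lemma hitExp_le_succ (hv : ∀ ω x, x ∉ A → 0 ≤ v ω x) (n : ℕ) (ω : Env d κ Y) (x : Y) :
    hitExp b A v n ω x ≤ hitExp b A v (n + 1) ω x := by
  by_cases hx : x ∈ A
  · induction n generalizing ω x with
    | zero => rw [hitExp_zero_of_mem hx]; exact hitExp_nonneg hv _ _ _
    | succ n ih =>
      rw [hitExp_succ_of_mem hx, hitExp_succ_of_mem hx]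
      refine avg_mono fun e => ?_
      by_cases hy : x + move b e ∈ A
      · exact ih _ _ hy
      · rw [hitExp_of_notMem hy, hitExp_of_notMem hy]
  · rw [hitExp_of_notMem hx, hitExp_of_notMem hx]

lemma monotone_hitExp (hv : ∀ ω x, x ∉ A → 0 ≤ v ω x) (ω : Env d κ Y) (x : Y) :
    Monotone fun n => hitExp b A v n ω x :=
  monotone_nat_of_le_succ fun n => hitExp_le_succ hv n ω x

lemma costExp_nonneg (hc : ∀ ω x, x ∈ A → 0 ≤ c ω x) (n : ℕ) (ω : Env d κ Y) (x : Y) :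
    0 ≤ costExp b A c n ω x := by
  induction n generalizing ω x with
  | zero => exact le_rfl
  | succ n ih =>
    by_cases hx : x ∈ A
    · rw [costExp_succ_of_mem hx]
      exact add_nonneg (hc _ _ hx) (const_le_avg fun e => ih _ _)
    · rw [costExp_of_notMem hx]

lemma costExp_mono (h : ∀ ω x, x ∈ A → c ω x ≤ c' ω x) (n : ℕ) (ω : Env d κ Y) (x : Y) :
    costExp b A c n ω x ≤ costExp b A c' n ω x := by
  induction n generalizing ω x with
  | zero => exact le_rfl
  | succ n ih =>
    by_cases hx : x ∈ A
    · rw [costExp_succ_of_mem hx, costExp_succ_of_mem hx]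
      exact add_le_add (h _ _ hx) (avg_mono fun e => ih _ _)
    · rw [costExp_of_notMem hx, costExp_of_notMem hx]

lemma costExp_le_succ (hc : ∀ ω x, x ∈ A → 0 ≤ c ω x) (n : ℕ) (ω : Env d κ Y) (x : Y) :
    costExp b A c n ω x ≤ costExp b A c (n + 1) ω x := by
  by_cases hx : x ∈ A
  · induction n generalizing ω x with
    | zero => exact costExp_nonneg hc _ _ _
    | succ n ih =>
      rw [costExp_succ_of_mem hx, costExp_succ_of_mem hx]
      refine add_le_add le_rfl (avg_mono fun e => ?_)
      by_cases hy : x + move b e ∈ A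
      · exact ih _ _ hy
      · rw [costExp_of_notMem hy, costExp_of_notMem hy]
  · rw [costExp_of_notMem hx, costExp_of_notMem hx]

lemma monotone_costExp (hc : ∀ ω x, x ∈ A → 0 ≤ c ω x) (ω : Env d κ Y) (x : Y) :
    Monotone fun n => costExp b A c n ω x :=
  monotone_nat_of_le_succ fun n => costExp_le_succ hc n ω x

lemma costExp_sum {ι : Type*} (s : Finset ι) (w : ι → Env d κ Y → Y → ℝ) (n : ℕ)
    (ω : Env d κ Y) (x : Y) :
    costExp b A (fun η y => ∑ i ∈ s, w i η y) n ω x = ∑ i ∈ s, costExp b A (w i) n ω x := by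
  induction n generalizing ω x with
  | zero => simp [costExp]
  | succ n ih =>
    by_cases hx : x ∈ A
    · simp only [costExp_succ_of_mem hx, Finset.sum_add_distrib]
      rw [← avg_sum]
      exact congrArg _ (avg_congr fun e => ih _ _)
    · simp [costExp_of_notMem hx]

variable [MeasurableSpace Y] [Countable Y] [MeasurableSingletonClass Y]

lemma measurable_hitExp (hv : ∀ x, Measurable fun ω => v ω x) (n : ℕ) (x : Y) :
    Measurable fun ω => hitExp b A v n ω x := by
  by_cases hx : x ∈ A
  · induction n generalizing x with
    | zero => simp only [hitExp_zero_of_mem hx]; exact measurable_const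
    | succ n ih =>
      simp only [hitExp_succ_of_mem hx]
      refine measurable_avg b (fun y => ?_) x
      by_cases hy : y ∈ A
      · exact ih _ hy
      · simp only [hitExp_of_notMem hy]; exact hv y
  · simp only [hitExp_of_notMem hx]; exact hv x

end Operators

section Prob

variable {d : ℕ} {κ : NNReal} {Y : Type} [AddCommGroup Y] {b : Fin d → Y}
  [MeasurableSpace Y] [Countable Y] [MeasurableSingletonClass Y] {A : Set Y}

lemma prob_mono {B C : Set (ℕ → Y)} (h : B ⊆ C) (ω : Env d κ Y) (x : Y) :
    prob b B ω x ≤ prob b C ω x := measureReal_mono h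

lemma prob_congr_ae {B C : Set (ℕ → Y)} {ω : Env d κ Y} {x : Y}
    (h : ∀ X : ℕ → Y, X 0 = x → (X ∈ B ↔ X ∈ C)) : prob b B ω x = prob b C ω x := by
  refine measureReal_congr ?_
  filter_upwards [walkLaw_ae_zero b ω x] with X hX
  exact propext (h X hX)

lemma prob_mono_ae {B C : Set (ℕ → Y)} {ω : Env d κ Y} {x : Y}
    (h : ∀ X : ℕ → Y, X 0 = x → X ∈ B → X ∈ C) : prob b B ω x ≤ prob b C ω x := by
  rw [prob_congr_ae (C := B ∩ {X | X 0 = x}) (fun X hX => by simp [hX])]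
  exact prob_mono (fun X hX => h X hX.2 hX.1) ω x

lemma prob_empty (ω : Env d κ Y) (x : Y) : prob b ∅ ω x = 0 := by simp [prob]

lemma prob_univ (ω : Env d κ Y) (x : Y) : prob b Set.univ ω x = 1 := by simp [prob]

lemma prob_eq_one_of_start {B : Set (ℕ → Y)} {ω : Env d κ Y} {x : Y}
    (h : ∀ X : ℕ → Y, X 0 = x → X ∈ B) : prob b B ω x = 1 := by
  rw [prob_congr_ae (C := Set.univ) (fun X hX => by simp [h X hX]), prob_univ]

lemma prob_eq_zero_of_start {B : Set (ℕ → Y)} {ω : Env d κ Y} {x : Y}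
    (h : ∀ X : ℕ → Y, X 0 = x → X ∉ B) : prob b B ω x = 0 := by
  rw [prob_congr_ae (C := ∅) (fun X hX => by simp [h X hX]), prob_empty]

lemma prob_compl {B : Set (ℕ → Y)} (hB : MeasurableSet B) (ω : Env d κ Y) (x : Y) :
    prob b Bᶜ ω x = 1 - prob b B ω x := by
  rw [prob, prob, probReal_compl_eq_one_sub hB]

lemma prob_eq_zero_iff {p : (ℕ → Y) → Prop} {ω : Env d κ Y} {x : Y} :
    prob b {X | ¬ p X} ω x = 0 ↔ ∀ᵐ X ∂walkLaw b ω x, p X := by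
  rw [prob, measureReal_eq_zero_iff, ae_iff]

lemma tendsto_prob_iUnion {B : ℕ → Set (ℕ → Y)} (hB : Monotone B) (ω : Env d κ Y) (x : Y) :
    Tendsto (fun n => prob b (B n) ω x) atTop (nhds (prob b (⋃ n, B n) ω x)) :=
  (ENNReal.tendsto_toReal (measure_ne_top _ _)).comp (tendsto_measure_iUnion_atTop hB)

lemma tendsto_prob_iInter {B : ℕ → Set (ℕ → Y)} (hm : ∀ n, MeasurableSet (B n))
    (hB : Antitone B) (ω : Env d κ Y) (x : Y) :
    Tendsto (fun n => prob b (B n) ω x) atTop (nhds (prob b (⋂ n, B n) ω x)) :=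
  (ENNReal.tendsto_toReal (measure_ne_top _ _)).comp
    (tendsto_measure_iInter_atTop (fun n => (hm n).nullMeasurableSet) hB ⟨0, measure_ne_top _ _⟩)

lemma measurableSet_coord (n : ℕ) (s : Set Y) : MeasurableSet {X : ℕ → Y | X n ∈ s} :=
  measurable_pi_apply n (s.to_countable.measurableSet)

lemma measurableSet_frequently {p : ℕ → (ℕ → Y) → Prop} (hp : ∀ n, MeasurableSet {X | p n X}) :
    MeasurableSet {X | ∃ᶠ n in atTop, p n X} := by
  simp only [frequently_atTop]
  have : {X | ∀ a, ∃ n, n ≥ a ∧ p n X} = ⋂ a, ⋃ n, ⋃ (_ : n ≥ a), {X | p n X} := by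
    ext X; simp
  rw [this]
  exact MeasurableSet.iInter fun a => MeasurableSet.iUnion fun n =>
    MeasurableSet.iUnion fun _ => hp n

lemma measurableSet_forall_coord (s : Set Y) : MeasurableSet {X : ℕ → Y | ∀ n, X n ∈ s} := by
  simp only [Set.ofPred_forall]
  exact MeasurableSet.iInter fun n => measurableSet_coord n s

lemma prob_shift {B : Set (ℕ → Y)} (hB : MeasurableSet B) (ω : Env d κ Y) (x : Y) :
    prob b {X | (fun n => X (n + 1)) ∈ B} ω x = avg b (prob b B) ω x := by
  have hm : Measurable fun (X : ℕ → Y) (n : ℕ) => X (n + 1) :=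
    measurable_pi_iff.2 fun n => measurable_pi_apply (n + 1)
  exact prob_eq_avg b (hm hB) ω x

/-- A property of paths which has probability one from every starting state also holds almost
surely for all the time shifts of the walk. -/
lemma ae_forall_shift {p : (ℕ → Y) → Prop} (hp : MeasurableSet {X | p X})
    (h : ∀ (ω : Env d κ Y) x, ∀ᵐ X ∂walkLaw b ω x, p X) (ω : Env d κ Y) (x : Y) :
    ∀ᵐ X ∂walkLaw b ω x, ∀ N, p fun n => X (n + N) := by
  rw [ae_all_iff]
  intro N
  have hm : ∀ N, Measurable fun (X : ℕ → Y) (n : ℕ) => X (n + N) := fun N =>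
    measurable_pi_iff.2 fun n => measurable_pi_apply (n + N)
  induction N generalizing ω x with
  | zero => exact h ω x
  | succ N ih =>
    rw [← prob_eq_zero_iff]
    have h1 := prob_shift (b := b) (hm N hp.compl) ω x
    have h2 : {X : ℕ → Y | (fun n => X (n + 1)) ∈ (fun (X : ℕ → Y) (n : ℕ) => X (n + N)) ⁻¹'
        {X | p X}ᶜ} = {X | ¬ p fun n => X (n + (N + 1))} := by
      ext X
      simp only [Set.mem_preimage, Set.mem_compl_iff, Set.mem_ofPred_eq]
      rw [show (fun n => X (n + N + 1)) = fun n => X (n + (N + 1)) from rfl]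
    rw [h2] at h1
    rw [h1]
    exact avg_eq_const fun e => prob_eq_zero_iff.2 (ih _ _)

lemma prob_exists_le_notMem (n : ℕ) (ω : Env d κ Y) (x : Y) :
    prob b {X | ∃ i ≤ n, X i ∉ A} ω x = hitExp b A (fun _ _ => 1) n ω x := by
  by_cases hx : x ∈ A
  · induction n generalizing ω x with
    | zero =>
      rw [hitExp_zero_of_mem hx]
      refine prob_eq_zero_of_start fun X hX => ?_
      simp [hX, hx]
    | succ n ih =>
      have hm : ∀ n, MeasurableSet {X : ℕ → Y | ∃ i ≤ n, X i ∉ A} := fun n => by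
        have : {X : ℕ → Y | ∃ i ≤ n, X i ∉ A} = ⋃ i, ⋃ (_ : i ≤ n), {X | X i ∈ Aᶜ} := by
          ext X; simp
        rw [this]
        exact MeasurableSet.iUnion fun i => MeasurableSet.iUnion fun _ => measurableSet_coord i _
      rw [hitExp_succ_of_mem hx]
      have : prob b {X | ∃ i ≤ n + 1, X i ∉ A} ω x =
          prob b {X | (fun n => X (n + 1)) ∈ {X : ℕ → Y | ∃ i ≤ n, X i ∉ A}} ω x := by
        refine prob_congr_ae fun X hX => ?_
        simp only [Set.mem_ofPred_eq]
        constructor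
        · rintro ⟨i, hi, h⟩
          cases i with
          | zero => exact absurd (hX ▸ hx) h
          | succ i => exact ⟨i, by omega, h⟩
        · rintro ⟨i, hi, h⟩
          exact ⟨i + 1, by omega, h⟩
      rw [this, prob_shift (hm n)]
      refine avg_congr fun e => ?_
      by_cases hy : x + move b e ∈ A
      · exact ih _ _ hy
      · rw [hitExp_of_notMem hy]
        exact prob_eq_one_of_start fun X hX => ⟨0, Nat.zero_le _, by rwa [hX]⟩
  · rw [hitExp_of_notMem hx]
    exact prob_eq_one_of_start fun X hX => ⟨0, Nat.zero_le _, by rwa [hX]⟩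

/-- The probability never to leave `A` is the limit of the probabilities of not leaving `A`
within `n` steps. -/
lemma tendsto_hitExp_one (A : Set Y) (ω : Env d κ Y) (x : Y) :
    Tendsto (fun n => hitExp b A (fun _ _ => 1) n ω x) atTop
      (nhds (1 - prob b {X | ∀ n, X n ∈ A} ω x)) := by
  simp only [← prob_exists_le_notMem]
  have h := tendsto_prob_iUnion (b := b) (B := fun n => {X : ℕ → Y | ∃ i ≤ n, X i ∉ A})
    (fun n m hnm X ⟨i, hi, hX⟩ => ⟨i, hi.trans hnm, hX⟩) ω x
  have h2 : (⋃ n, {X : ℕ → Y | ∃ i ≤ n, X i ∉ A}) = {X | ∀ n, X n ∈ A}ᶜ := by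
    ext X
    simp only [Set.mem_iUnion, Set.mem_ofPred_eq, Set.mem_compl_iff, not_forall]
    exact ⟨fun ⟨_, i, _, h⟩ => ⟨i, h⟩, fun ⟨i, h⟩ => ⟨i, i, le_rfl, h⟩⟩
  rwa [h2, prob_compl (measurableSet_forall_coord A)] at h

lemma hitExp_one_le_prob (A : Set Y) (n : ℕ) (ω : Env d κ Y) (x : Y) :
    hitExp b A (fun _ _ => 1) n ω x ≤ 1 - prob b {X | ∀ n, X n ∈ A} ω x :=
  (monotone_hitExp (fun _ _ _ => zero_le_one) ω x).ge_of_tendsto (tendsto_hitExp_one A ω x) n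

/-- If an everywhere bound `u ≤ s` always improves to `u ≤ q * s` with a fixed `q < 1`,
then `u = 0`. -/
lemma eq_zero_of_contraction {u : Env d κ Y → Y → ℝ} (h0 : ∀ ω x, 0 ≤ u ω x)
    (h1 : ∀ ω x, u ω x ≤ 1) {q : ℝ} (hq0 : 0 ≤ q) (hq1 : q < 1)
    (h : ∀ s, 0 ≤ s → (∀ ω x, u ω x ≤ s) → ∀ ω x, u ω x ≤ q * s) (ω : Env d κ Y) (x : Y) :
    u ω x = 0 := by
  have key : ∀ n : ℕ, ∀ ω x, u ω x ≤ q ^ n := by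
    intro n
    induction n with
    | zero => simpa using h1
    | succ n ih =>
      intro ω x
      rw [pow_succ']
      exact h _ (pow_nonneg hq0 n) ih ω x
  exact le_antisymm (ge_of_tendsto' (tendsto_pow_atTop_nhds_zero_of_lt_one hq0 hq1)
    fun n => key n ω x) (h0 ω x)

end Prob

/-! ### Quenched behaviour: every height is reached -/

section Quenched

variable {d : ℕ} [NeZero d] {κ : NNReal} {Y : Type} [AddCommGroup Y] {b : Fin d → Y} {L : ℕ}

lemma StripData.ht_add_move (S : StripData b L) (x : Y) (e : Dir d) :
    S.ht (x + move b e) = S.ht x + e.dotE₁ := by rw [map_add, S.ht_move]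

lemma StripData.exists_ht (S : StripData b L) (x : Y) (e : Dir d) :
    S.ht x - 1 ≤ S.ht (x + move b e) ∧ S.ht (x + move b e) ≤ S.ht x + 1 := by
  rw [S.ht_add_move]
  rcases dotE₁_cases e with h | h | h <;> rw [h] <;> constructor <;> omega

variable [MeasurableSpace Y] [Countable Y] [MeasurableSingletonClass Y] (S : StripData b L)

lemma sum_dotE₁_nonneg (ω : Env d κ Y) (x : Y) : 0 ≤ ∑ e, ω.1 x 0 e * (e.dotE₁ : ℝ) :=
  ω.2.2.2 x 0

/-- The height has non-negative drift. -/
lemma ht_le_avg (ω : Env d κ Y) (x : Y) : (S.ht x : ℝ) ≤ avg b (fun _ y => (S.ht y : ℝ)) ω x := by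
  have : avg b (fun _ y => (S.ht y : ℝ)) ω x =
      avg b (fun _ _ => (S.ht x : ℝ)) ω x + ∑ e, ω.1 x 0 e * (e.dotE₁ : ℝ) := by
    simp only [avg, ← Finset.sum_add_distrib, ← mul_add]
    refine Finset.sum_congr rfl fun e _ => ?_
    rw [S.ht_add_move]; push_cast; ring
  rw [this, avg_const]
  linarith [sum_dotE₁_nonneg ω x]

lemma κ_le_one (ω : Env d κ Y) : (κ : ℝ) ≤ 1 := by
  have h := ω.2.1 0 0 (fwd d)
  have : (0 : ℝ) ≤ κ := κ.2
  linarith [h.1, h.2]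

/-- By ellipticity the walk cannot stay in a slab forever. -/
lemma prob_stay_slab (hκ : 0 < κ) (a k : ℤ) (ω : Env d κ Y) (x : Y) :
    prob b {X | ∀ n, X n ∈ {y | a < S.ht y ∧ S.ht y < k}} ω x = 0 := by
  set A : Set Y := {y | a < S.ht y ∧ S.ht y < k} with hA
  have hκ0 : (0 : ℝ) < κ := hκ
  have hκ1 : (κ : ℝ) ≤ 1 := κ_le_one ω
  have hpow : (0 : ℝ) < (κ : ℝ) ^ (k - a).toNat := pow_pos hκ0 _
  refine eq_zero_of_contraction (q := 1 - (κ : ℝ) ^ (k - a).toNat)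
    (prob_nonneg b _) (prob_le_one b _) (by linarith [pow_le_one₀ hκ0.le hκ1 (n := (k - a).toNat)])
    (by linarith) (fun s hs h => ?_) ω x
  have hout : ∀ (η : Env d κ Y) (y : Y), y ∉ A → prob b {X | ∀ n, X n ∈ A} η y = 0 := by
    intro η y hy
    refine prob_eq_zero_of_start fun X hX hX' => hy ?_
    rw [← hX]; exact hX' 0
  -- with probability at least `κ ^ m` the next `m` steps are all in direction `e₁`
  have key : ∀ (m : ℕ) (η : Env d κ Y) (y : Y), k - S.ht y ≤ m →
      prob b {X | ∀ n, X n ∈ A} η y ≤ (1 - (κ : ℝ) ^ m) * s := by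
    intro m
    induction m with
    | zero =>
      intro η y hy
      rw [hout η y (by simp only [hA, Set.mem_ofPred_eq]; push_cast at hy; omega)]
      simp
    | succ m ih =>
      intro η y hy
      by_cases hyA : y ∈ A
      · have h1 : prob b {X | ∀ n, X n ∈ A} η y = avg b (prob b {X | ∀ n, X n ∈ A}) η y := by
          rw [← prob_shift (measurableSet_forall_coord A)]
          refine prob_congr_ae fun X hX => ?_
          simp only [Set.mem_ofPred_eq]
          constructor
          · exact fun h n => h (n + 1)
          · intro h n
            cases n with
            | zero => rw [hX]; exact hyA
            | succ n => exact h n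
        rw [h1]
        have h2 := avg_le_sub (b := b) (ω := η) (x := y) (c := s) (ε := (κ : ℝ) ^ m * s)
          (u := prob b {X | ∀ n, X n ∈ A}) (fwd d) (fun e => h _ _) (by
            have := ih (eat η y) (y + move b (fwd d)) (by
              rw [S.ht_add_move, dotE₁_fwd]; push_cast at hy; omega)
            linarith) (by positivity)
        rw [pow_succ']
        linarith
      · rw [hout η y hyA]
        exact mul_nonneg (by linarith [pow_le_one₀ hκ0.le hκ1 (n := m + 1)]) hs
  intro η y
  by_cases hyA : y ∈ A
  · exact key _ η y (by
      have : a < S.ht y := hyA.1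
      omega)
  · rw [hout η y hyA]
    exact mul_nonneg (by linarith [pow_le_one₀ hκ0.le hκ1 (n := (k - a).toNat)]) hs

/-- Gambler's ruin bound for the probability to leave a slab through its bottom: the height is a
submartingale. -/
lemma hitExp_bottom_le {a k : ℤ} (hak : a < k) (n : ℕ) (ω : Env d κ Y) (x : Y)
    (h1 : a ≤ S.ht x) (h2 : S.ht x ≤ k) :
    hitExp b {y | a < S.ht y ∧ S.ht y < k} (fun _ y => if S.ht y ≤ a then 1 else 0) n ω x ≤
      ((k : ℝ) - S.ht x) / (k - a) := by
  have hak' : (0 : ℝ) < (k : ℝ) - a := by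
    have : (a : ℝ) < k := by exact_mod_cast hak
    linarith
  have hout : ∀ (n : ℕ) (η : Env d κ Y) (y : Y), a ≤ S.ht y → S.ht y ≤ k →
      y ∉ {y | a < S.ht y ∧ S.ht y < k} →
      hitExp b {y | a < S.ht y ∧ S.ht y < k} (fun _ y => if S.ht y ≤ a then 1 else 0) n η y ≤
        ((k : ℝ) - S.ht y) / (k - a) := by
    intro n η y hy1 hy2 hy
    rw [hitExp_of_notMem hy]
    rcases hy1.eq_or_lt with h | h
    · rw [if_pos h.ge, ← h, div_self hak'.ne']
    · rw [if_neg (by omega)]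
      have : (S.ht y : ℝ) ≤ k := by exact_mod_cast hy2
      exact div_nonneg (by linarith) hak'.le
  by_cases hx : x ∈ {y | a < S.ht y ∧ S.ht y < k}
  · induction n generalizing ω x with
    | zero =>
      rw [hitExp_zero_of_mem hx]
      have : (S.ht x : ℝ) ≤ k := by exact_mod_cast h2
      exact div_nonneg (by linarith) hak'.le
    | succ n ih =>
      rw [hitExp_succ_of_mem hx]
      have h3 : avg b (hitExp b {y | a < S.ht y ∧ S.ht y < k}
          (fun _ y => if S.ht y ≤ a then 1 else 0) n) ω x ≤
          avg b (fun _ y => ((k : ℝ) - S.ht y) * (1 / (k - a))) ω x := by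
        refine avg_mono fun e => ?_
        have he := S.exists_ht x e
        have hx' : a < S.ht x ∧ S.ht x < k := hx
        rw [mul_one_div]
        by_cases hy : x + move b e ∈ {y | a < S.ht y ∧ S.ht y < k}
        · exact ih _ _ (by omega) (by omega) hy
        · exact hout _ _ _ (by omega) (by omega) hy
      refine h3.trans ?_
      rw [avg_mul_const, avg_sub, avg_const, div_eq_mul_one_div ((k : ℝ) - S.ht x)]
      exact mul_le_mul_of_nonneg_right (by linarith [ht_le_avg S ω x])
        (one_div_nonneg.2 hak'.le)
  · exact hout n ω x h1 h2 hx

/-- The walk exceeds every height: it leaves a wide slab, and rarely through the bottom. -/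
theorem prob_stay_below (hκ : 0 < κ) (k : ℤ) (ω : Env d κ Y) (x : Y) :
    prob b {X | ∀ n, X n ∈ {y | S.ht y < k}} ω x = 0 := by
  by_cases hxk : S.ht x < k
  swap
  · refine prob_eq_zero_of_start fun X hX h => hxk ?_
    rw [← hX]; exact h 0
  have key : ∀ a : ℤ, a < S.ht x →
      prob b {X | ∀ n, X n ∈ {y | S.ht y < k}} ω x ≤ ((k : ℝ) - S.ht x) / (k - a) := by
    intro a ha
    have hak : a < k := ha.trans hxk
    -- the slab is left either through the bottom, or after the height `k` has been reached
    have hcmp : ∀ (n : ℕ) (η : Env d κ Y) (y : Y),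
        hitExp b {y | a < S.ht y ∧ S.ht y < k} (fun _ _ => 1) n η y ≤
        hitExp b {y | S.ht y < k} (fun _ _ => 1) n η y +
        hitExp b {y | a < S.ht y ∧ S.ht y < k} (fun _ y => if S.ht y ≤ a then 1 else 0) n η y := by
      intro n
      have hout : ∀ (n : ℕ) (η : Env d κ Y) (y : Y), y ∉ {y | a < S.ht y ∧ S.ht y < k} →
        hitExp b {y | a < S.ht y ∧ S.ht y < k} (fun _ _ => 1) n η y ≤
        hitExp b {y | S.ht y < k} (fun _ _ => 1) n η y +
        hitExp b {y | a < S.ht y ∧ S.ht y < k}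
          (fun _ y => if S.ht y ≤ a then 1 else 0) n η y := by
        intro n η y hy
        rw [hitExp_of_notMem hy, hitExp_of_notMem hy]
        by_cases h : S.ht y ≤ a
        · rw [if_pos h]
          linarith [hitExp_nonneg (b := b) (A := {y | S.ht y < k}) (v := fun _ _ => 1)
            (fun _ _ _ => zero_le_one) n η y]
        · rw [hitExp_of_notMem (A := {y | S.ht y < k}), if_neg h]
          · linarith
          · simp only [Set.mem_ofPred_eq] at hy ⊢
            omega
      induction n with
      | zero =>
        intro η y
        by_cases hy : y ∈ {y | a < S.ht y ∧ S.ht y < k}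
        · have hy' : y ∈ {y | S.ht y < k} := hy.2
          rw [hitExp_zero_of_mem hy, hitExp_zero_of_mem hy, hitExp_zero_of_mem hy', add_zero]
        · exact hout 0 η y hy
      | succ n ih =>
        intro η y
        by_cases hy : y ∈ {y | a < S.ht y ∧ S.ht y < k}
        · rw [hitExp_succ_of_mem hy, hitExp_succ_of_mem hy,
            hitExp_succ_of_mem (A := {y | S.ht y < k}) hy.2, ← avg_add]
          exact avg_mono fun e => ih _ _
        · exact hout _ η y hy
    have h1 := tendsto_hitExp_one (b := b) {y | a < S.ht y ∧ S.ht y < k} ω x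
    rw [prob_stay_slab S hκ] at h1
    have h2 := (tendsto_hitExp_one (b := b) {y | S.ht y < k} ω x).add_const
      (((k : ℝ) - S.ht x) / (k - a))
    have := le_of_tendsto_of_tendsto' h1 h2 fun n =>
      (hcmp n ω x).trans (add_le_add le_rfl (hitExp_bottom_le S hak n ω x ha.le hxk.le))
    linarith
  -- the bottom `a = k - N` of the slab tends to `-∞`
  have hlim : Tendsto (fun N : ℕ => ((k : ℝ) - S.ht x) / (N : ℝ)) atTop (nhds 0) :=
    tendsto_const_div_atTop_nhds_zero_nat _
  refine le_antisymm (ge_of_tendsto hlim ?_) (prob_nonneg b _ ω x)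
  filter_upwards [eventually_gt_atTop (k - S.ht x).toNat] with N hN
  have := key (k - N) (by omega)
  simpa using this

lemma tendsto_hitExp_below (hκ : 0 < κ) (k : ℤ) (ω : Env d κ Y) (x : Y) :
    Tendsto (fun n => hitExp b {y | S.ht y < k} (fun _ _ => 1) n ω x) atTop (nhds 1) := by
  have h := tendsto_hitExp_one (b := b) {y | S.ht y < k} ω x
  rwa [prob_stay_below S hκ, sub_zero] at h

lemma ae_exists_le_ht (hκ : 0 < κ) (ω : Env d κ Y) (x : Y) :
    ∀ᵐ X ∂walkLaw b ω x, ∀ k : ℤ, ∃ n, k ≤ S.ht (X n) := by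
  rw [ae_all_iff]
  intro k
  rw [← prob_eq_zero_iff]
  convert prob_stay_below S hκ k ω x using 3
  simp

lemma ae_frequently_le_ht (hκ : 0 < κ) (ω : Env d κ Y) (x : Y) :
    ∀ᵐ X ∂walkLaw b ω x, ∀ k : ℤ, ∃ᶠ n in atTop, k ≤ S.ht (X n) := by
  have hm : MeasurableSet {X : ℕ → Y | ∀ k : ℤ, ∃ n, k ≤ S.ht (X n)} := by
    simp only [Set.ofPred_forall, Set.ofPred_exists]
    exact MeasurableSet.iInter fun k => MeasurableSet.iUnion fun n =>
      measurableSet_coord n {y | k ≤ S.ht y}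
  filter_upwards [ae_forall_shift hm (ae_exists_le_ht S hκ) ω x] with X hX k
  rw [frequently_atTop]
  intro N
  obtain ⟨n, hn⟩ := hX N k
  exact ⟨n + N, by omega, hn⟩

/-- Each step of the walk is one of the moves. -/
lemma ae_forall_step (ω : Env d κ Y) (x : Y) :
    ∀ᵐ X ∂walkLaw b ω x, ∀ n, ∃ e, X (n + 1) = X n + move b e := by
  have hm : MeasurableSet {X : ℕ → Y | ∃ e, X 1 = X 0 + move b e} := by
    have : {X : ℕ → Y | ∃ e, X 1 = X 0 + move b e} =
        (fun X : ℕ → Y => (X 0, X 1)) ⁻¹' {p | ∃ e, p.2 = p.1 + move b e} := rfl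
    rw [this]
    exact ((measurable_pi_apply 0).prodMk (measurable_pi_apply 1))
      (Set.to_countable _).measurableSet
  have h : ∀ (ω : Env d κ Y) x, ∀ᵐ X ∂walkLaw b ω x, ∃ e, X 1 = X 0 + move b e := by
    intro ω x
    rw [← prob_eq_zero_iff]
    refine (prob_eq_avg b hm.compl ω x).trans ?_
    refine avg_eq_const fun e => prob_eq_zero_of_start fun X hX h => h ⟨e, ?_⟩
    simpa using hX
  filter_upwards [ae_forall_shift hm h ω x] with X hX n
  simpa [add_comm] using hX n

/-- By ellipticity, a walk which visits `z` infinitely often visits each neighbour of `z`. -/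
lemma ae_exists_visit_neighbour (hκ : 0 < κ) (z : Y) (e : Dir d) (ω : Env d κ Y) (x : Y) :
    ∀ᵐ X ∂walkLaw b ω x, (∃ᶠ n in atTop, X n = z) → ∃ n, X n = z + move b e := by
  set E : Set (ℕ → Y) := {X | (∃ᶠ n in atTop, X n = z) ∧ ∀ n, X n ≠ z + move b e} with hE
  have hκ0 : (0 : ℝ) < κ := hκ
  have hκ1 : (κ : ℝ) ≤ 1 := κ_le_one ω
  have hEm : MeasurableSet E :=
    (measurableSet_frequently fun n => measurableSet_coord n {z}).inter
      (measurableSet_forall_coord {z + move b e}ᶜ)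
  have hcons : ∀ y, pathCons y ⁻¹' E ⊆ E := by
    rintro y X ⟨h1, h2⟩
    refine ⟨?_, fun n => h2 (n + 1)⟩
    rw [frequently_atTop] at h1 ⊢
    intro N
    obtain ⟨n, hn, h⟩ := h1 (N + 1)
    obtain ⟨m, rfl⟩ : ∃ m, n = m + 1 := ⟨n - 1, by omega⟩
    exact ⟨m, by omega, h⟩
  have hzero : ∀ (ω : Env d κ Y) x, prob b E ω x = 0 := by
    refine eq_zero_of_contraction (q := 1 - (κ : ℝ)) (prob_nonneg b _) (prob_le_one b _)
      (by linarith) (by linarith) fun s hs h => ?_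
    -- at each visit to `z`, the step `e` is made with probability at least `κ`
    have hz : ∀ η : Env d κ Y, prob b E η z ≤ (1 - (κ : ℝ)) * s := by
      intro η
      rw [prob_eq_avg b hEm]
      have := avg_le_sub (b := b) (ω := η) (x := z) (c := s) (ε := s)
        (u := prob b (pathCons z ⁻¹' E)) e (fun e' => (prob_mono (hcons z) _ _).trans (h _ _)) (by
          rw [prob_eq_zero_of_start, sub_self]
          intro X hX hX'
          exact hX'.2 1 hX) hs
      linarith
    -- on `E` the walk visits `z`, hence the same bound holds from every starting point
    have hn : ∀ (n : ℕ) (η : Env d κ Y) (y : Y),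
        prob b (E ∩ {X | ∃ i ≤ n, X i = z}) η y ≤ (1 - (κ : ℝ)) * s := by
      have hm : ∀ n, MeasurableSet (E ∩ {X | ∃ i ≤ n, X i = z}) := fun n => by
        refine hEm.inter ?_
        have : {X : ℕ → Y | ∃ i ≤ n, X i = z} = ⋃ i, ⋃ (_ : i ≤ n), {X | X i ∈ ({z} : Set Y)} := by
          ext X; simp
        rw [this]
        exact MeasurableSet.iUnion fun i => MeasurableSet.iUnion fun _ => measurableSet_coord i _
      intro n
      induction n with
      | zero =>
        intro η y
        by_cases hy : y = z
        · rw [hy]; exact (prob_mono Set.inter_subset_left _ _).trans (hz η)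
        · rw [prob_eq_zero_of_start]
          · exact mul_nonneg (by linarith) hs
          · rintro X hX ⟨-, i, hi, h⟩
            obtain rfl : i = 0 := by omega
            exact hy (hX ▸ h)
      | succ n ih =>
        intro η y
        by_cases hy : y = z
        · rw [hy]; exact (prob_mono Set.inter_subset_left _ _).trans (hz η)
        · rw [prob_eq_avg b (hm _)]
          refine avg_le_const fun e' => (prob_mono ?_ _ _).trans (ih _ _)
          rintro X ⟨h1, i, hi, h⟩
          refine ⟨hcons y h1, ?_⟩
          cases i with
          | zero => exact absurd h hy
          | succ i => exact ⟨i, by omega, h⟩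
    intro η y
    have hlim := tendsto_prob_iUnion (b := b) (B := fun n => E ∩ {X | ∃ i ≤ n, X i = z})
      (fun n m hnm X ⟨h, i, hi, hX⟩ => ⟨h, i, hi.trans hnm, hX⟩) η y
    have hU : (⋃ n, E ∩ {X | ∃ i ≤ n, X i = z}) = E := by
      rw [← Set.inter_iUnion]
      refine Set.inter_eq_left.2 fun X hX => ?_
      obtain ⟨n, hn⟩ := hX.1.exists
      exact Set.mem_iUnion.2 ⟨n, n, le_rfl, hn⟩
    rw [hU] at hlim
    exact le_of_tendsto' hlim fun n => hn n η y
  rw [← prob_eq_zero_iff]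
  convert hzero ω x using 3
  simp

lemma ae_frequently_visit_neighbour (hκ : 0 < κ) (ω : Env d κ Y) (x : Y) :
    ∀ᵐ X ∂walkLaw b ω x, ∀ z (e : Dir d),
      (∃ᶠ n in atTop, X n = z) → ∃ᶠ n in atTop, X n = z + move b e := by
  rw [ae_all_iff]
  intro z
  rw [ae_all_iff]
  intro e
  have hm : MeasurableSet {X : ℕ → Y | (∃ᶠ n in atTop, X n = z) → ∃ n, X n = z + move b e} := by
    refine MeasurableSet.imp (measurableSet_frequently fun n => measurableSet_coord n {z}) ?_
    simp only [Set.ofPred_exists]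
    exact MeasurableSet.iUnion fun n => measurableSet_coord n {z + move b e}
  filter_upwards [ae_forall_shift hm (ae_exists_visit_neighbour hκ z e) ω x] with X hX h
  rw [frequently_atTop]
  intro N
  obtain ⟨n, hn⟩ := hX N (by
    rw [frequently_atTop] at h ⊢
    intro M
    obtain ⟨n, hn, h⟩ := h (M + N)
    exact ⟨n - N, by omega, by rwa [Nat.sub_add_cancel (by omega)]⟩)
  exact ⟨n + N, by omega, hn⟩

/-- A set of sites which is closed under all moves is everything. -/
lemma StripData.forall_of_move (S : StripData b L) {p : Y → Prop}
    (hp : ∀ x e, p x → p (x + move b e)) {x : Y} (hx : p x) (y : Y) : p y := by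
  have h1 : ∀ n : ℕ, p (x + n • move b (fwd d)) ∧ p (x + n • move b (bwd d)) := by
    intro n
    induction n with
    | zero => simpa using hx
    | succ n ih =>
      simp only [succ_nsmul, ← add_assoc]
      exact ⟨hp _ _ ih.1, hp _ _ ih.2⟩
  have h2 : ∃ z, p z ∧ S.ht z = S.ht y := by
    rcases le_total (S.ht x) (S.ht y) with h | h
    · refine ⟨_, (h1 (S.ht y - S.ht x).toNat).1, ?_⟩
      rw [map_add, map_nsmul, S.ht_move, dotE₁_fwd]
      simp only [nsmul_eq_mul, mul_one]; omega
    · refine ⟨_, (h1 (S.ht x - S.ht y).toNat).2, ?_⟩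
      rw [map_add, map_nsmul, S.ht_move, dotE₁_bwd]
      simp only [nsmul_eq_mul, mul_neg, mul_one]; omega
  obtain ⟨z, hz, hzy⟩ := h2
  have h3 := S.conn z y hzy
  clear hzy
  induction h3 with
  | refl => exact hz
  | tail _ h ih =>
    obtain ⟨e, -, rfl⟩ := h
    exact hp _ _ ih

/-- A nearest-neighbour path which is infinitely often above and infinitely often below a height
visits it infinitely often. -/
lemma StripData.frequently_ht_eq (S : StripData b L) {X : ℕ → Y}
    (hX : ∀ n, ∃ e, X (n + 1) = X n + move b e) {k : ℤ}
    (h1 : ∃ᶠ n in atTop, k ≤ S.ht (X n)) (h2 : ∃ᶠ n in atTop, S.ht (X n) ≤ k) :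
    ∃ᶠ n in atTop, S.ht (X n) = k := by
  have key : ∀ (m n : ℕ), S.ht (X n) ≤ k → k ≤ S.ht (X (n + m)) →
      ∃ i, n ≤ i ∧ S.ht (X i) = k := by
    intro m
    induction m with
    | zero => intro n h h'; exact ⟨n, le_rfl, le_antisymm h h'⟩
    | succ m ih =>
      intro n h h'
      rcases h.eq_or_lt with h0 | h0
      · exact ⟨n, le_rfl, h0⟩
      · obtain ⟨e, he⟩ := hX n
        obtain ⟨i, hi, h⟩ := ih (n + 1) (by
          rw [he]; have := (S.exists_ht (X n) e).2; omega) (by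
          rwa [show n + 1 + m = n + (m + 1) by ring])
        exact ⟨i, by omega, h⟩
  rw [frequently_atTop] at h1 h2 ⊢
  intro N
  obtain ⟨n, hn, hn'⟩ := h2 N
  obtain ⟨m, hm, hm'⟩ := h1 n
  obtain ⟨i, hi, h⟩ := key (m - n) n hn' (by rwa [Nat.add_sub_cancel' hm])
  exact ⟨i, by omega, h⟩

/-- In every environment, either the height tends to infinity or all the sites are visited
infinitely often. -/
theorem ae_frequently_visit (hκ : 0 < κ) (ω : Env d κ Y) (x : Y) :
    ∀ᵐ X ∂walkLaw b ω x, ∀ k : ℤ, (∃ᶠ n in atTop, S.ht (X n) ≤ k) →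
      ∀ y, ∃ᶠ n in atTop, X n = y := by
  filter_upwards [ae_frequently_visit_neighbour (b := b) hκ ω x, ae_frequently_le_ht S hκ ω x,
    ae_forall_step (b := b) ω x] with X h1 h2 h3 k h4 y
  have h5 := S.frequently_ht_eq h3 (h2 k) h4
  obtain ⟨z, hz⟩ : ∃ z, ∃ᶠ n in atTop, X n = z := by
    by_contra hne
    push Not at hne
    refine h5 ?_
    have : ∀ᶠ n in atTop, ∀ z ∈ S.level k, X n ≠ z := by
      rw [eventually_all_finset]
      exact fun z _ => hne z
    filter_upwards [this] with n hn h
    exact hn _ ((S.mem_level k _).2 h) rfl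
  exact S.forall_of_move (p := fun z => ∃ᶠ n in atTop, X n = z) (fun z e h => h1 z e h) hz y

end Quenched

/-! ### Escape to the right is decided by the environment on a half strip -/

section HalfStrip

variable {d : ℕ} [NeZero d] {κ : NNReal} {Y : Type} [AddCommGroup Y] {b : Fin d → Y} {L : ℕ}

/-- Two environments agree at all sites of height at least `c`. -/
def AgreeAbove (S : StripData b L) (c : ℤ) (ω η : Env d κ Y) : Prop :=
  ∀ y, c ≤ S.ht y → ω.1 y = η.1 y

/-- Two environments agree at all sites of height less than `c`. -/
def AgreeBelow (S : StripData b L) (c : ℤ) (ω η : Env d κ Y) : Prop :=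
  ∀ y, S.ht y < c → ω.1 y = η.1 y

lemma eat_congr_site {ω η : Env d κ Y} (x : Y) {y : Y} (h : ω.1 y = η.1 y) :
    (eat ω x).1 y = (eat η x).1 y := by
  by_cases hy : y = x
  · subst hy; ext i; rw [eat_self, eat_self, h]
  · rw [eat_of_ne _ hy, eat_of_ne _ hy, h]

variable {S : StripData b L}

lemma AgreeAbove.eat {c : ℤ} {ω η : Env d κ Y} (h : AgreeAbove S c ω η) (x : Y) :
    AgreeAbove S c (eat ω x) (eat η x) := fun y hy => eat_congr_site x (h y hy)

lemma AgreeBelow.eat {c : ℤ} {ω η : Env d κ Y} (h : AgreeBelow S c ω η) (x : Y) :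
    AgreeBelow S c (eat ω x) (eat η x) := fun y hy => eat_congr_site x (h y hy)

lemma AgreeAbove.trans {c : ℤ} {ω η ζ : Env d κ Y} (h : AgreeAbove S c ω η)
    (h' : AgreeAbove S c η ζ) : AgreeAbove S c ω ζ := fun y hy => (h y hy).trans (h' y hy)

lemma AgreeAbove.symm {c : ℤ} {ω η : Env d κ Y} (h : AgreeAbove S c ω η) :
    AgreeAbove S c η ω := fun y hy => (h y hy).symm

lemma agreeAbove_eat {c : ℤ} (ω : Env d κ Y) {x : Y} (hx : S.ht x < c) :
    AgreeAbove S c (eat ω x) ω := fun y hy => eat_of_ne ω (by rintro rfl; omega)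

variable [MeasurableSpace Y] [Countable Y] [MeasurableSingletonClass Y] (S)

/-- The paths which never go below the height `c`. -/
def stayAbove (c : ℤ) : Set (ℕ → Y) := {X | ∀ n, X n ∈ {y | c ≤ S.ht y}}

lemma measurableSet_stayAbove (c : ℤ) : MeasurableSet (stayAbove S c) :=
  measurableSet_forall_coord _

variable {S} in
/-- The probability to stay above a height does not feel the environment below it. -/
lemma prob_stayAbove_congr {c : ℤ} {ω η : Env d κ Y} (h : AgreeAbove S c ω η) (x : Y) :
    prob b (stayAbove S c) ω x = prob b (stayAbove S c) η x := by
  have key : ∀ n (ω η : Env d κ Y) x, AgreeAbove S c ω η →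
      hitExp b {y | c ≤ S.ht y} (fun _ _ => 1) n ω x =
        hitExp b {y | c ≤ S.ht y} (fun _ _ => 1) n η x := by
    intro n
    induction n with
    | zero =>
      intro ω η x _
      by_cases hx : x ∈ {y | c ≤ S.ht y}
      · rw [hitExp_zero_of_mem hx, hitExp_zero_of_mem hx]
      · rw [hitExp_of_notMem hx, hitExp_of_notMem hx]
    | succ n ih =>
      intro ω η x h
      by_cases hx : x ∈ {y | c ≤ S.ht y}
      · rw [hitExp_succ_of_mem hx, hitExp_succ_of_mem hx]
        refine Finset.sum_congr rfl fun e _ => ?_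
        rw [h x hx, ih _ _ _ (h.eat x)]
      · rw [hitExp_of_notMem hx, hitExp_of_notMem hx]
  have h1 := tendsto_hitExp_one (b := b) {y | c ≤ S.ht y} ω x
  simp only [key _ _ _ x h] at h1
  have := tendsto_nhds_unique h1 (tendsto_hitExp_one (b := b) {y | c ≤ S.ht y} η x)
  unfold stayAbove
  linarith

/-- The states which the walk can reach from `(ω, x)` along paths in `A`. -/
inductive Reach (b : Fin d → Y) (A : Set Y) (ω : Env d κ Y) (x : Y) : Env d κ Y → Y → Prop
  | refl : Reach b A ω x ω x
  | step {η : Env d κ Y} {y : Y} (e : Dir d) : Reach b A ω x η y → y + move b e ∈ A →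
      Reach b A ω x (eat η y) (y + move b e)

lemma Reach.trans {A : Set Y} {ω η ζ : Env d κ Y} {x y z : Y} (h : Reach b A ω x η y)
    (h' : Reach b A η y ζ z) : Reach b A ω x ζ z := by
  induction h' with
  | refl => exact h
  | step e _ hA ih => exact ih.step e hA

lemma prob_stayAbove_pos_of_reach {c : ℤ} (hκ : 0 < κ) {ω η : Env d κ Y} {x y : Y}
    (hx : c ≤ S.ht x) (h : Reach b {y | c ≤ S.ht y} ω x η y)
    (hp : 0 < prob b (stayAbove S c) η y) : 0 < prob b (stayAbove S c) ω x := by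
  have hmem : ∀ {η y}, Reach b {y | c ≤ S.ht y} ω x η y → c ≤ S.ht y := by
    intro η y h
    cases h with
    | refl => exact hx
    | step e _ hA => exact hA
  induction h with
  | refl => exact hp
  | @step η y e hr hA ih =>
    refine ih ?_
    have hκ0 : (0 : ℝ) < κ := hκ
    have h1 : prob b (stayAbove S c) η y = avg b (prob b (stayAbove S c)) η y := by
      rw [← prob_shift (measurableSet_stayAbove S c)]
      refine prob_congr_ae fun X hX => ?_
      constructor
      · exact fun h n => h (n + 1)
      · intro h n
        cases n with
        | zero => rw [hX]; exact hmem hr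
        | succ n => exact h n
    rw [h1]
    refine lt_of_lt_of_le (mul_pos (hκ0.trans_le (η.2.1 y 0 e).1) hp) ?_
    exact Finset.single_le_sum (f := fun e => η.1 y 0 e *
      prob b (stayAbove S c) (eat η y) (y + move b e))
      (fun e _ => mul_nonneg (env_nonneg _ _ _ _) (prob_nonneg _ _ _ _)) (Finset.mem_univ e)

/-- Path surgery: the excursions of a path below the height `j` of its starting point can be
replaced by paths along the level `j`. This changes neither the cookies left above the level `j`
nor the end point, if the latter is above that level. -/
lemma exists_reach_above {ω η : Env d κ Y} {x y : Y} (h : Reach b Set.univ ω x η y) :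
    ∃ η' y', Reach b {y | S.ht x ≤ S.ht y} ω x η' y' ∧ AgreeAbove S (S.ht x + 1) η η' ∧
      (S.ht x + 1 ≤ S.ht y → y' = y) ∧ (S.ht y ≤ S.ht x → S.ht y' = S.ht x) := by
  induction h with
  | refl => exact ⟨ω, x, .refl, fun _ _ => rfl, fun _ => rfl, fun _ => rfl⟩
  | @step η y e _ _ ih =>
    obtain ⟨η', y', hr, hag, h1, h2⟩ := ih
    have he := S.ht_add_move y e
    have he' := S.exists_ht y e
    rcases le_or_gt (S.ht x + 1) (S.ht y) with hy | hy
    · obtain rfl := h1 hy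
      have hmem : S.ht x ≤ S.ht (y' + move b e) := by omega
      exact ⟨_, _, hr.step e hmem, hag.eat _, fun _ => rfl, fun h => le_antisymm h hmem⟩
    · have hy' := h2 (by omega)
      rcases le_or_gt (S.ht (y + move b e)) (S.ht x) with hz | hz
      · exact ⟨η', y', hr, (agreeAbove_eat η hy).trans hag, fun h => by omega, fun _ => hy'⟩
      · have hyx : S.ht y = S.ht x := by omega
        -- the original path re-enters from the level of `x` at `y`, which the modified path
        -- reaches along the level
        have travel : ∀ z, Relation.ReflTransGen
            (fun x y => ∃ e : Dir d, e.dotE₁ = 0 ∧ y = x + move b e) y' z →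
            ∃ ζ, Reach b {y | S.ht x ≤ S.ht y} ω x ζ z ∧ AgreeAbove S (S.ht x + 1) η' ζ ∧
              S.ht z = S.ht x := by
          intro z hz
          induction hz with
          | refl => exact ⟨η', hr, fun _ _ => rfl, hy'⟩
          | @tail u z _ h ih =>
            obtain ⟨e, he, rfl⟩ := h
            obtain ⟨ζ, hζ, hag, hu⟩ := ih
            have h3 : S.ht (u + move b e) = S.ht x := by rw [S.ht_add_move, he, hu, add_zero]
            exact ⟨eat ζ u, hζ.step e h3.ge, hag.trans (agreeAbove_eat ζ (by omega)).symm, h3⟩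
        obtain ⟨ζ, hζ, hag', -⟩ := travel y (S.conn y' y (by omega))
        exact ⟨eat ζ y, y + move b e, hζ.step e hz.le,
          (agreeAbove_eat η hy).trans ((hag.trans hag').trans (agreeAbove_eat ζ hy).symm),
          fun _ => rfl, fun h => by omega⟩

/-- If the walk almost surely goes below its starting height, it does so (weakly) infinitely
often. Thus transience to the right, for a given environment, has positive probability only if
the walk may escape without ever going below the starting height. -/
theorem ae_frequently_ht_le (hκ : 0 < κ) {ω : Env d κ Y} {x : Y}
    (h : prob b (stayAbove S (S.ht x)) ω x = 0) :
    ∀ᵐ X ∂walkLaw b ω x, ∃ᶠ n in atTop, S.ht (X n) ≤ S.ht x := by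
  have hm : ∀ (c : ℤ) (N : ℕ), MeasurableSet {X : ℕ → Y | ∀ n, c ≤ S.ht (X (n + N))} := by
    intro c N
    simp only [Set.ofPred_forall]
    exact MeasurableSet.iInter fun n => measurableSet_coord (n + N) {y | c ≤ S.ht y}
  -- if the walk may stay above `c` after time `N`, then it may reach a state from which it may
  -- stay above `c` right away
  have reach : ∀ (c : ℤ) (N : ℕ) (ω : Env d κ Y) (x : Y),
      prob b {X | ∀ n, c ≤ S.ht (X (n + N))} ω x ≠ 0 →
      ∃ η y, Reach b Set.univ ω x η y ∧ prob b (stayAbove S c) η y ≠ 0 := by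
    intro c N
    induction N with
    | zero => exact fun ω x h => ⟨ω, x, .refl, h⟩
    | succ N ih =>
      intro ω x h
      have h1 := prob_shift (b := b) (hm c N) ω x
      change prob b {X | ∀ n, c ≤ S.ht (X (n + (N + 1)))} ω x = _ at h1
      rw [h1] at h
      obtain ⟨e, he⟩ : ∃ e,
          prob b {X | ∀ n, c ≤ S.ht (X (n + N))} (eat ω x) (x + move b e) ≠ 0 := by
        by_contra hne
        push Not at hne
        exact h (avg_eq_const hne)
      obtain ⟨η, y, hr, hy⟩ := ih _ _ he
      exact ⟨η, y, (Reach.refl.step e (Set.mem_univ _)).trans hr, hy⟩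
  have hN : ∀ N, prob b {X | ∀ n, S.ht x + 1 ≤ S.ht (X (n + N))} ω x = 0 := by
    intro N
    by_contra hne
    obtain ⟨η, y, hr, hy⟩ := reach _ N ω x hne
    -- after surgery the walk reaches this state without going below its starting height
    obtain ⟨η', y', hr', hag, h1, -⟩ := exists_reach_above S hr
    have hyx : S.ht x + 1 ≤ S.ht y := by
      by_contra hlt
      refine hy (prob_eq_zero_of_start fun X hX hX' => hlt ?_)
      rw [← hX]; exact hX' 0
    obtain rfl := h1 hyx
    rw [prob_stayAbove_congr hag] at hy
    have hpos : 0 < prob b (stayAbove S (S.ht x)) η' y' :=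
      ((prob_nonneg b _ _ _).lt_of_ne' hy).trans_le (prob_mono
        (B := stayAbove S (S.ht x + 1)) (fun X hX n =>
        (show S.ht x ≤ S.ht x + 1 by omega).trans (hX n)) _ _)
    exact (prob_stayAbove_pos_of_reach S hκ le_rfl hr' hpos).ne' h
  have hN' : ∀ N, ∀ᵐ X ∂walkLaw b ω x, ¬ ∀ n, S.ht x + 1 ≤ S.ht (X (n + N)) := fun N =>
    prob_eq_zero_iff.1 (by simpa using hN N)
  filter_upwards [ae_all_iff.2 hN'] with X hX
  rw [frequently_atTop]
  intro N
  have := hX N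
  push Not at this
  obtain ⟨n, hn⟩ := this
  exact ⟨n + N, by omega, by omega⟩

end HalfStrip

/-! ### The drift that the walk consumes before it reaches a given height -/

section OptionalStopping

variable {d : ℕ} [NeZero d] {κ : NNReal} {Y : Type} [AddCommGroup Y] {b : Fin d → Y} {L : ℕ}
  (S : StripData b L)

/-- The drift of the next cookie, if the walk is at a height in the set `J`. -/
noncomputable def driftOn (J : Set ℤ) (ω : Env d κ Y) (x : Y) : ℝ :=
  open Classical in if S.ht x ∈ J then cookieDrift (ω.1 x 0) else 0

/-- The probability to step from the level `0` to the level `-1`. -/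
noncomputable def downCrossing (ω : Env d κ Y) (x : Y) : ℝ :=
  if S.ht x = 0 then ω.1 x 0 (bwd d) else 0

lemma driftOn_nonneg (J : Set ℤ) (ω : Env d κ Y) (x : Y) : 0 ≤ driftOn S J ω x := by
  unfold driftOn
  split_ifs
  exacts [ω.2.2.2 x 0, le_rfl]

lemma downCrossing_nonneg (ω : Env d κ Y) (x : Y) : 0 ≤ downCrossing S ω x := by
  unfold downCrossing
  split_ifs
  exacts [env_nonneg _ _ _ _, le_rfl]

/-- The positive part of the height has as its drift the drift of the cookies at non-negative
heights plus the probability of a down-crossing from `0` to `-1`. -/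
lemma avg_posPart_ht (ω : Env d κ Y) (x : Y) :
    avg b (fun _ y => ((max (S.ht y) 0 : ℤ) : ℝ)) ω x =
      ((max (S.ht x) 0 : ℤ) : ℝ) + driftOn S (Set.Ici 0) ω x + downCrossing S ω x := by
  classical
  have key : ∀ e : Dir d, ((max (S.ht (x + move b e)) 0 : ℤ) : ℝ) =
      ((max (S.ht x) 0 : ℤ) : ℝ) + (if 0 ≤ S.ht x then (e.dotE₁ : ℝ) else 0) +
        (if e = bwd d then if S.ht x = 0 then 1 else 0 else 0) := by
    intro e
    have h1 := dotE₁_eq_neg_one_iff e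
    have h2 := S.ht_add_move x e
    have h3 := dotE₁_cases e
    have : max (S.ht (x + move b e)) 0 = max (S.ht x) 0 + (if 0 ≤ S.ht x then e.dotE₁ else 0) +
        (if e.dotE₁ = -1 then if S.ht x = 0 then 1 else 0 else 0) := by
      split_ifs <;> omega
    rw [this]
    simp only [← h1]
    push_cast
    rfl
  simp only [avg, key, mul_add, Finset.sum_add_distrib, ← Finset.sum_mul, ω.2.2.1, one_mul]
  congr 1
  · congr 1
    simp only [driftOn, Set.mem_Ici, cookieDrift]
    split_ifs <;> simp
  · simp only [mul_ite, mul_zero, mul_one, Finset.sum_ite_eq', Finset.mem_univ, if_true,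
      downCrossing]

/-- Optional stopping: until the height `k` is reached, the positive part of the height increases
by its total drift, and it never exceeds `k`. -/
lemma costExp_drift_add_down_le {k : ℤ} (hk : 0 ≤ k) (n : ℕ) (ω : Env d κ Y) (x : Y)
    (hx : S.ht x ≤ k) :
    costExp b {y | S.ht y < k} (driftOn S (Set.Ici 0)) n ω x +
      costExp b {y | S.ht y < k} (downCrossing S) n ω x ≤ k - ((max (S.ht x) 0 : ℤ) : ℝ) := by
  have hnn : ∀ x, S.ht x ≤ k → (0 : ℝ) ≤ k - ((max (S.ht x) 0 : ℤ) : ℝ) := by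
    intro x hx
    have : ((max (S.ht x) 0 : ℤ) : ℝ) ≤ k := by exact_mod_cast max_le hx hk
    linarith
  induction n generalizing ω x with
  | zero => simpa [costExp] using hnn x hx
  | succ n ih =>
    by_cases hA : x ∈ {y | S.ht y < k}
    · rw [costExp_succ_of_mem hA, costExp_succ_of_mem hA]
      have h1 : avg b (fun η y => costExp b {y | S.ht y < k} (driftOn S (Set.Ici 0)) n η y +
          costExp b {y | S.ht y < k} (downCrossing S) n η y) ω x ≤
          avg b (fun _ y => (k : ℝ) - ((max (S.ht y) 0 : ℤ) : ℝ)) ω x := by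
        refine avg_mono fun e => ih _ _ ?_
        have := S.exists_ht x e
        have hA' : S.ht x < k := hA
        omega
      rw [avg_add, avg_sub, avg_const, avg_posPart_ht S] at h1
      linarith
    · rw [costExp_of_notMem hA, costExp_of_notMem hA]
      simpa using hnn x hx

/-- Optional stopping in the opposite direction: when the height `k` has been reached, the drift
has provided it. -/
lemma le_costExp_drift_add_down (k : ℤ) (n : ℕ) (ω : Env d κ Y) (x : Y) :
    k * hitExp b {y | S.ht y < k} (fun _ _ => 1) n ω x ≤ ((max (S.ht x) 0 : ℤ) : ℝ) +
      costExp b {y | S.ht y < k} (driftOn S (Set.Ici 0)) n ω x +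
      costExp b {y | S.ht y < k} (downCrossing S) n ω x := by
  have hout : ∀ n (ω : Env d κ Y) x, x ∉ {y | S.ht y < k} →
      k * hitExp b {y | S.ht y < k} (fun _ _ => 1) n ω x ≤ ((max (S.ht x) 0 : ℤ) : ℝ) +
      costExp b {y | S.ht y < k} (driftOn S (Set.Ici 0)) n ω x +
      costExp b {y | S.ht y < k} (downCrossing S) n ω x := by
    intro n ω x hx
    rw [hitExp_of_notMem hx, costExp_of_notMem hx, costExp_of_notMem hx]
    have h : k ≤ max (S.ht x) 0 := (not_lt.1 hx).trans (le_max_left _ _)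
    have : (k : ℝ) ≤ ((max (S.ht x) 0 : ℤ) : ℝ) := by exact_mod_cast h
    linarith
  induction n generalizing ω x with
  | zero =>
    by_cases hA : x ∈ {y | S.ht y < k}
    · rw [hitExp_zero_of_mem hA]
      have : (0 : ℝ) ≤ ((max (S.ht x) 0 : ℤ) : ℝ) := by exact_mod_cast le_max_right _ _
      simpa only [costExp, mul_zero, add_zero] using this
    · exact hout _ _ _ hA
  | succ n ih =>
    by_cases hA : x ∈ {y | S.ht y < k}
    · rw [hitExp_succ_of_mem hA, costExp_succ_of_mem hA, costExp_succ_of_mem hA]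
      have h1 : avg b (fun η y => hitExp b {y | S.ht y < k} (fun _ _ => 1) n η y * (k : ℝ)) ω x ≤
          avg b (fun η y => (((max (S.ht y) 0 : ℤ) : ℝ) +
            costExp b {y | S.ht y < k} (driftOn S (Set.Ici 0)) n η y) +
            costExp b {y | S.ht y < k} (downCrossing S) n η y) ω x :=
        avg_mono fun e => by rw [mul_comm]; exact ih _ _
      rw [avg_mul_const, avg_add, avg_add, avg_posPart_ht S] at h1
      linarith
    · exact hout _ _ _ hA

variable [MeasurableSpace Y] [Countable Y] [MeasurableSingletonClass Y]

/-- The paths which are below height `0` at some time `n ≥ K`. -/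
def negAfter (K : ℕ) : Set (ℕ → Y) := {X | ∃ n ≥ K, S.ht (X n) < 0}

lemma measurableSet_negAfter (K : ℕ) : MeasurableSet (negAfter S K) := by
  have : negAfter S K = ⋃ n, ⋃ (_ : n ≥ K), {X | X n ∈ {y | S.ht y < 0}} := by
    ext X; simp [negAfter]
  rw [this]
  exact MeasurableSet.iUnion fun i => MeasurableSet.iUnion fun _ => measurableSet_coord i _

lemma prob_negAfter_succ (K : ℕ) (ω : Env d κ Y) (x : Y) :
    prob b (negAfter S (K + 1)) ω x = avg b (prob b (negAfter S K)) ω x := by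
  rw [← prob_shift (measurableSet_negAfter S K)]
  congr 1
  ext X
  simp only [negAfter, Set.mem_ofPred_eq]
  constructor
  · rintro ⟨n, hn, h⟩
    obtain ⟨m, rfl⟩ : ∃ m, n = m + 1 := ⟨n - 1, by omega⟩
    exact ⟨m, by omega, h⟩
  · rintro ⟨n, hn, h⟩
    exact ⟨n + 1, by omega, h⟩

lemma prob_negAfter_zero_of_neg (ω : Env d κ Y) {x : Y} (hx : S.ht x < 0) :
    prob b (negAfter S 0) ω x = 1 :=
  prob_eq_one_of_start fun X hX => ⟨0, le_rfl, by rwa [hX]⟩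

lemma prob_negAfter_zero_of_nonneg (ω : Env d κ Y) {x : Y} (hx : 0 ≤ S.ht x) :
    prob b (negAfter S 0) ω x = avg b (prob b (negAfter S 0)) ω x := by
  rw [← prob_negAfter_succ]
  refine prob_congr_ae fun X hX => ?_
  constructor
  · rintro ⟨n, -, h⟩
    cases n with
    | zero => rw [hX] at h; omega
    | succ n => exact ⟨n + 1, by omega, h⟩
  · rintro ⟨n, -, h⟩
    exact ⟨n, Nat.zero_le _, h⟩

/-- There are at most `K` down-crossings before time `K`. Afterwards there is one at all only on
`negAfter S K`, and after the first of them `k` more are expected at most. Hence their expected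
number is small compared with `k` unless the walk goes below `0` after a long time. -/
theorem costExp_down_le {k : ℤ} (hk : 0 ≤ k) (K n : ℕ) (ω : Env d κ Y) (x : Y)
    (hx : S.ht x ≤ k) :
    costExp b {y | S.ht y < k} (downCrossing S) n ω x ≤
      K + (k + 1) * prob b (negAfter S K) ω x := by
  have hk' : (0 : ℝ) ≤ k := by exact_mod_cast hk
  have hb : ∀ n (ω : Env d κ Y) x, S.ht x ≤ k →
      costExp b {y | S.ht y < k} (downCrossing S) n ω x ≤ k := by
    intro n ω x hx
    have h1 := costExp_drift_add_down_le S hk n ω x hx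
    have h2 := costExp_nonneg (b := b) (A := {y | S.ht y < k}) (c := driftOn S (Set.Ici 0))
      (fun ω x _ => driftOn_nonneg S _ ω x) n ω x
    have h3 : (0 : ℝ) ≤ ((max (S.ht x) 0 : ℤ) : ℝ) := by exact_mod_cast le_max_right _ _
    linarith
  have hnn : ∀ (K : ℕ) (ω : Env d κ Y) x, (0 : ℝ) ≤ K + (k + 1) * prob b (negAfter S K) ω x :=
    fun K ω x => add_nonneg (Nat.cast_nonneg _) (mul_nonneg (by linarith) (prob_nonneg b _ _ _))
  have hstep : ∀ (x : Y) (e : Dir d), x ∈ {y | S.ht y < k} → S.ht (x + move b e) ≤ k := by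
    intro x e h
    have h1 := S.exists_ht x e
    have h2 : S.ht x < k := h
    omega
  induction K generalizing n ω x with
  | zero =>
    induction n generalizing ω x with
    | zero => exact hnn 0 ω x
    | succ n ih =>
      by_cases hA : x ∈ {y | S.ht y < k}
      · rcases lt_or_ge (S.ht x) 0 with h0 | h0
        · rw [prob_negAfter_zero_of_neg S ω h0]
          have := hb (n + 1) ω x hx
          push_cast
          linarith
        · classical
          rw [costExp_succ_of_mem hA, prob_negAfter_zero_of_nonneg S ω h0]
          -- the inequality holds for each step separately: a down-crossing costs `1`, and leads to
          -- a state where `negAfter S 0` has probability one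
          have h1 : downCrossing S ω x + avg b (costExp b {y | S.ht y < k} (downCrossing S) n) ω x =
              ∑ e, ω.1 x 0 e * ((if e = bwd d then if S.ht x = 0 then 1 else 0 else 0) +
                costExp b {y | S.ht y < k} (downCrossing S) n (eat ω x) (x + move b e)) := by
            simp only [mul_add, Finset.sum_add_distrib, mul_ite, mul_zero, mul_one,
              Finset.sum_ite_eq', Finset.mem_univ, if_true, downCrossing, avg]
          have h2 : avg b (prob b (negAfter S 0)) ω x * (k + 1) =
              ∑ e, ω.1 x 0 e * (prob b (negAfter S 0) (eat ω x) (x + move b e) * (k + 1)) := by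
            rw [← avg_mul_const]; rfl
          rw [h1, Nat.cast_zero, zero_add, mul_comm, h2]
          refine Finset.sum_le_sum fun e _ => mul_le_mul_of_nonneg_left ?_ (env_nonneg _ _ _ _)
          split_ifs with he hx0
          · have hneg : S.ht (x + move b e) < 0 := by
              rw [S.ht_add_move, he, dotE₁_bwd, hx0]; omega
            rw [prob_negAfter_zero_of_neg S _ hneg]
            linarith [hb n (eat ω x) _ (hstep x e hA)]
          · have := ih (eat ω x) _ (hstep x e hA)
            push_cast at this
            linarith
          · have := ih (eat ω x) _ (hstep x e hA)
            push_cast at this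
            linarith
      · rw [costExp_of_notMem hA]
        exact hnn 0 ω x
  | succ K ih =>
    cases n with
    | zero => exact hnn _ ω x
    | succ n =>
      by_cases hA : x ∈ {y | S.ht y < k}
      · rw [costExp_succ_of_mem hA, prob_negAfter_succ]
        have h1 : avg b (costExp b {y | S.ht y < k} (downCrossing S) n) ω x ≤
            avg b (fun η y => (K : ℝ) + prob b (negAfter S K) η y * (k + 1)) ω x :=
          avg_mono fun e => by rw [mul_comm _ ((k : ℝ) + 1)]; exact ih n _ _ (hstep x e hA)
        rw [avg_add, avg_const, avg_mul_const] at h1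
        have h2 : downCrossing S ω x ≤ 1 := by
          unfold downCrossing
          split_ifs
          · have := (ω.2.1 x 0 (bwd d)).2
            have : (0 : ℝ) ≤ κ := κ.2
            linarith
          · exact zero_le_one
        push_cast
        linarith
      · rw [costExp_of_notMem hA]
        exact hnn _ ω x

end OptionalStopping

/-! ### Independence and stationarity of the environment -/

section Annealed

variable {d : ℕ} [NeZero d] {κ : NNReal} {Y : Type} [AddCommGroup Y] {b : Fin d → Y} {L : ℕ}

/-- The environment seen from `a`. -/
def shiftEnv (a : Y) (ω : Env d κ Y) : Env d κ Y :=
  ⟨fun x => ω.1 (x + a), fun x => ω.2.1 (x + a), fun x => ω.2.2.1 (x + a),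
    fun x => ω.2.2.2 (x + a)⟩

lemma eat_shiftEnv (a : Y) (ω : Env d κ Y) (x : Y) :
    eat (shiftEnv a ω) x = shiftEnv a (eat ω (x + a)) := by
  refine Subtype.ext (funext fun y => ?_)
  by_cases h : y = x
  · subst h
    funext i
    rw [eat_self]
    exact (eat_self ω (y + a) i).symm
  · rw [eat_of_ne _ h]
    exact (eat_of_ne ω (fun h' => h (add_right_cancel h'))).symm

lemma avg_shiftEnv {u w : Env d κ Y → Y → ℝ} (a : Y) {ω : Env d κ Y} {x : Y}
    (h : ∀ e, u (shiftEnv a (eat ω (x + a))) (x + move b e) =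
      w (eat ω (x + a)) (x + move b e + a)) :
    avg b u (shiftEnv a ω) x = avg b w ω (x + a) := by
  refine Finset.sum_congr rfl fun e _ => ?_
  rw [eat_shiftEnv, h e, add_right_comm]
  rfl

lemma hitExp_shiftEnv {A A' : Set Y} {v v' : Env d κ Y → Y → ℝ} (a : Y)
    (hA : ∀ x, x ∈ A ↔ x + a ∈ A') (hv : ∀ ω x, v (shiftEnv a ω) x = v' ω (x + a)) (n : ℕ)
    (ω : Env d κ Y) (x : Y) :
    hitExp b A v n (shiftEnv a ω) x = hitExp b A' v' n ω (x + a) := by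
  induction n generalizing ω x with
  | zero =>
    by_cases hx : x ∈ A
    · rw [hitExp_zero_of_mem hx, hitExp_zero_of_mem ((hA x).1 hx)]
    · rw [hitExp_of_notMem hx, hitExp_of_notMem (mt (hA x).2 hx), hv]
  | succ n ih =>
    by_cases hx : x ∈ A
    · rw [hitExp_succ_of_mem hx, hitExp_succ_of_mem ((hA x).1 hx)]
      exact avg_shiftEnv a fun e => ih _ _
    · rw [hitExp_of_notMem hx, hitExp_of_notMem (mt (hA x).2 hx), hv]

lemma costExp_shiftEnv {A A' : Set Y} {c c' : Env d κ Y → Y → ℝ} (a : Y)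
    (hA : ∀ x, x ∈ A ↔ x + a ∈ A') (hc : ∀ ω x, c (shiftEnv a ω) x = c' ω (x + a)) (n : ℕ)
    (ω : Env d κ Y) (x : Y) :
    costExp b A c n (shiftEnv a ω) x = costExp b A' c' n ω (x + a) := by
  induction n generalizing ω x with
  | zero => rfl
  | succ n ih =>
    by_cases hx : x ∈ A
    · rw [costExp_succ_of_mem hx, costExp_succ_of_mem ((hA x).1 hx), hc]
      exact congrArg _ (avg_shiftEnv a fun e => ih _ _)
    · rw [costExp_of_notMem hx, costExp_of_notMem (mt (hA x).2 hx)]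

lemma measurable_shiftEnv (a : Y) : Measurable (shiftEnv a : Env d κ Y → Env d κ Y) := by
  refine Measurable.subtype_mk (measurable_pi_iff.2 fun y => ?_)
  exact (measurable_pi_apply (y + a)).comp measurable_subtype_coe

/-- I.i.d. environments are stationary. -/
lemma IIDSites.map_shiftEnv {P : Measure (Env d κ Y)} [IsProbabilityMeasure P]
    (hP : IIDSites P) (a : Y) : P.map (shiftEnv a) = P := by
  have hm : ∀ x : Y, Measurable fun ω : Env d κ Y => ω.1 x := fun x =>
    (measurable_pi_apply x).comp measurable_subtype_coe
  have h1 : iIndepFun (fun (x : Y) (ω : Env d κ Y) => ω.1 (x + a)) P :=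
    hP.1.precomp (add_left_injective a)
  have h2 := h1.map_fun_eq_infinitePi_map fun x => hm (x + a)
  have h3 := hP.1.map_fun_eq_infinitePi_map hm
  have h4 : ∀ x, P.map (fun ω : Env d κ Y => ω.1 x) = P.map fun ω : Env d κ Y => ω.1 0 :=
    fun x => (hP.2 x).map_eq
  simp only [h4] at h2 h3
  have h5 : (P.map (shiftEnv a)).map Subtype.val = P.map Subtype.val := by
    rw [Measure.map_map measurable_subtype_coe (measurable_shiftEnv a)]
    exact h2.trans h3.symm
  ext s hs
  obtain ⟨t, ht, rfl⟩ := hs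
  rw [← Measure.map_apply measurable_subtype_coe ht, h5,
    Measure.map_apply measurable_subtype_coe ht]

lemma IIDSites.lintegral_shiftEnv {P : Measure (Env d κ Y)} [IsProbabilityMeasure P]
    (hP : IIDSites P) (a : Y) {f : Env d κ Y → ENNReal} (hf : Measurable f) :
    ∫⁻ ω, f (shiftEnv a ω) ∂P = ∫⁻ ω, f ω ∂P := by
  conv_rhs => rw [← hP.map_shiftEnv a, lintegral_map hf (measurable_shiftEnv a)]

/-- The environment which is `ω` at heights at least `c` and `ζ` below. -/
def glue (S : StripData b L) (c : ℤ) (ζ ω : Env d κ Y) : Env d κ Y :=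
  ⟨fun y => if c ≤ S.ht y then ω.1 y else ζ.1 y, by
    refine ⟨fun y i e => ?_, fun y i => ?_, fun y i => ?_⟩ <;> beta_reduce
    · split_ifs
      exacts [ω.2.1 _ _ _, ζ.2.1 _ _ _]
    · split_ifs
      exacts [ω.2.2.1 _ _, ζ.2.2.1 _ _]
    · split_ifs
      exacts [ω.2.2.2 _ _, ζ.2.2.2 _ _]⟩

lemma glue_of_le (S : StripData b L) {c : ℤ} (ζ ω : Env d κ Y) {y : Y} (h : c ≤ S.ht y) :
    (glue S c ζ ω).1 y = ω.1 y := by simp [glue, h]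

lemma glue_of_lt (S : StripData b L) {c : ℤ} (ζ ω : Env d κ Y) {y : Y} (h : S.ht y < c) :
    (glue S c ζ ω).1 y = ζ.1 y := by simp [glue, not_le.2 h]

lemma measurable_env_of {Ω : Type*} {mΩ : MeasurableSpace Ω} {f : Ω → Env d κ Y}
    (h : ∀ y, Measurable fun ω => (f ω).1 y) : Measurable f :=
  Measurable.subtype_mk (measurable_pi_iff.2 h)

/-- Functions of the environment below and above a height are independent. -/
lemma lintegral_mul_of_agree (S : StripData b L) {P : Measure (Env d κ Y)}
    [IsProbabilityMeasure P] (hP : IIDSites P) (k : ℤ) {W V : Env d κ Y → ENNReal}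
    (hW : Measurable W) (hV : Measurable V) (hWl : ∀ ω η, AgreeBelow S k ω η → W ω = W η)
    (hVl : ∀ ω η, AgreeAbove S k ω η → V ω = V η) :
    ∫⁻ ω, W ω * V ω ∂P = (∫⁻ ω, W ω ∂P) * ∫⁻ ω, V ω ∂P := by
  obtain ⟨ω₀⟩ : Nonempty (Env d κ Y) := Measure.nonempty_of_neZero P
  let m : Y → MeasurableSpace (Env d κ Y) := fun x =>
    MeasurableSpace.comap (fun ω => ω.1 x) (inferInstance : MeasurableSpace (ℕ → Dir d → ℝ))
  have hm : ∀ x, m x ≤ (inferInstance : MeasurableSpace (Env d κ Y)) :=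
    fun x => Measurable.comap_le
    ((measurable_pi_apply x).comp measurable_subtype_coe)
  have hind : Indep (⨆ x ∈ {x | S.ht x < k}, m x) (⨆ x ∈ {x | k ≤ S.ht x}, m x) P :=
    indep_iSup_of_disjoint hm hP.1 (by
      rw [Set.disjoint_left]
      intro x (h1 : S.ht x < k) (h2 : k ≤ S.ht x)
      omega)
  refine lintegral_mul_eq_lintegral_mul_lintegral_of_independent_measurableSpace
    (iSup₂_le fun x _ => hm x) (iSup₂_le fun x _ => hm x) hind ?_ ?_
  -- `W` is measurable with respect to the sites below `k`, since nothing changes when the rest of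
  -- the environment is replaced by the fixed `ω₀`; the same argument applies to `V`
  · have : W = W ∘ fun ω => glue S k ω ω₀ := by
      ext ω
      exact hWl _ _ fun y hy => (glue_of_lt S ω ω₀ hy).symm
    rw [this]
    refine hW.comp (measurable_env_of (mΩ := ⨆ x ∈ {x | S.ht x < k}, m x) fun y => ?_)
    simp only [glue]
    by_cases hy : k ≤ S.ht y
    · simp only [hy, if_true]; exact measurable_const
    · simp only [hy, if_false]
      refine Measurable.mono ?_ (le_iSup₂_of_le y (not_le.1 hy) le_rfl) le_rfl
      exact comap_measurable _
  · have : V = V ∘ fun ω => glue S k ω₀ ω := by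
      ext ω
      exact hVl _ _ fun y hy => (glue_of_le S ω₀ ω hy).symm
    rw [this]
    refine hV.comp (measurable_env_of (mΩ := ⨆ x ∈ {x | k ≤ S.ht x}, m x) fun y => ?_)
    simp only [glue]
    by_cases hy : k ≤ S.ht y
    · simp only [hy, if_true]
      refine Measurable.mono ?_ (le_iSup₂_of_le y hy le_rfl) le_rfl
      exact comap_measurable _
    · simp only [hy, if_false]; exact measurable_const

/-- Independence of the weights `W` (the environment below the height `k`) and of the values `v`
(the environment from the height `k` on), summed over the sites of height `k`. -/
lemma lintegral_sum_level_mul (S : StripData b L) {P : Measure (Env d κ Y)}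
    [IsProbabilityMeasure P] (hP : IIDSites P) (k : ℤ) {W v : Env d κ Y → Y → ℝ} {C : ENNReal}
    (hW0 : ∀ ω y, 0 ≤ W ω y) (hWm : ∀ y, Measurable fun ω => W ω y)
    (hWl : ∀ y ω η, AgreeBelow S k ω η → W ω y = W η y)
    (hv0 : ∀ ω y, S.ht y = k → 0 ≤ v ω y) (hvm : ∀ y, Measurable fun ω => v ω y)
    (hvl : ∀ y, S.ht y = k → ∀ ω η, AgreeAbove S k ω η → v ω y = v η y)
    (hvC : ∀ y, S.ht y = k → ∫⁻ ω, ENNReal.ofReal (v ω y) ∂P = C) :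
    ∫⁻ ω, ENNReal.ofReal (∑ y ∈ S.level k, W ω y * v ω y) ∂P =
      (∫⁻ ω, ENNReal.ofReal (∑ y ∈ S.level k, W ω y) ∂P) * C := by
  have h1 : ∀ ω, ENNReal.ofReal (∑ y ∈ S.level k, W ω y * v ω y) =
      ∑ y ∈ S.level k, ENNReal.ofReal (W ω y) * ENNReal.ofReal (v ω y) := by
    intro ω
    rw [ENNReal.ofReal_sum_of_nonneg fun y hy =>
      mul_nonneg (hW0 ω y) (hv0 ω y ((S.mem_level k y).1 hy))]
    exact Finset.sum_congr rfl fun y _ => ENNReal.ofReal_mul (hW0 ω y)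
  have h2 : ∀ ω, ENNReal.ofReal (∑ y ∈ S.level k, W ω y) =
      ∑ y ∈ S.level k, ENNReal.ofReal (W ω y) := fun ω =>
    ENNReal.ofReal_sum_of_nonneg fun y _ => hW0 ω y
  simp only [h1, h2]
  rw [lintegral_finsetSum (f := fun y ω => ENNReal.ofReal (W ω y) * ENNReal.ofReal (v ω y)) _
    fun y _ => ((hWm y).ennreal_ofReal.mul (hvm y).ennreal_ofReal),
    lintegral_finsetSum _ fun y _ => (hWm y).ennreal_ofReal, Finset.sum_mul]
  refine Finset.sum_congr rfl fun y hy => ?_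
  have hy' := (S.mem_level k y).1 hy
  rw [lintegral_mul_of_agree S hP k (hWm y).ennreal_ofReal (hvm y).ennreal_ofReal
    (fun ω η h => by rw [hWl y ω η h]) (fun ω η h => by rw [hvl y hy' ω η h]), hvC y hy']

open Classical in
/-- The indicator function of the position `y`. -/
noncomputable def atSite (y : Y) (_ : Env d κ Y) (z : Y) : ℝ := if z = y then 1 else 0

lemma atSite_nonneg (y : Y) (ω : Env d κ Y) (z : Y) : 0 ≤ atSite y ω z := by
  unfold atSite; split_ifs <;> norm_num

lemma sum_level_atSite (S : StripData b L) {k : ℤ} {z : Y} (hz : S.ht z = k) (ω : Env d κ Y)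
    (f : Y → ℝ) : ∑ y ∈ S.level k, atSite y ω z * f y = f z := by
  rw [Finset.sum_eq_single_of_mem z ((S.mem_level k z).2 hz)]
  · simp [atSite]
  · intro y _ hy
    simp [atSite, hy.symm]

variable (S : StripData b L)

/-- A function which depends only on the environment above the height `k` is not affected by
the walk before that height is reached. -/
lemma hitExp_eq_sum {k : ℤ} {v : Env d κ Y → Y → ℝ}
    (hvl : ∀ y, S.ht y = k → ∀ ω η, AgreeAbove S k ω η → v ω y = v η y) (n : ℕ)
    (ω : Env d κ Y) (x : Y) (hx : S.ht x ≤ k) :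
    hitExp b {y | S.ht y < k} v n ω x =
      ∑ y ∈ S.level k, hitExp b {y | S.ht y < k} (atSite y) n ω x * v ω y := by
  by_cases hA : x ∈ {y | S.ht y < k}
  · induction n generalizing ω x with
    | zero => simp [hitExp_zero_of_mem hA]
    | succ n ih =>
      simp only [hitExp_succ_of_mem hA]
      simp only [← avg_mul_const]
      rw [← avg_sum (S.level k) fun y η z =>
        hitExp b {y | S.ht y < k} (atSite y) n η z * v ω y]
      refine avg_congr fun e => ?_
      have hA' : S.ht x < k := hA
      have h1 := S.exists_ht x e
      have h2 : hitExp b {y | S.ht y < k} v n (eat ω x) (x + move b e) =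
          ∑ y ∈ S.level k, hitExp b {y | S.ht y < k} (atSite y) n (eat ω x) (x + move b e) *
            v (eat ω x) y := by
        by_cases hy : x + move b e ∈ {y | S.ht y < k}
        · exact ih _ _ (by omega) hy
        · have h3 : S.ht (x + move b e) = k := by
            simp only [Set.mem_ofPred_eq] at hy; omega
          simp only [hitExp_of_notMem hy]
          exact (sum_level_atSite S h3 _ _).symm
      rw [h2]
      refine Finset.sum_congr rfl fun y hy => ?_
      rw [hvl y ((S.mem_level k y).1 hy) _ _ (agreeAbove_eat ω hA')]
  · have h3 : S.ht x = k := by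
      simp only [Set.mem_ofPred_eq] at hA; omega
    simp only [hitExp_of_notMem hA]
    exact (sum_level_atSite S h3 _ _).symm

lemma hitExp_congr_below {k : ℤ} {v : Env d κ Y → Y → ℝ} (hv : ∀ ω η y, v ω y = v η y) (n : ℕ)
    {ω η : Env d κ Y} (h : AgreeBelow S k ω η) (x : Y) :
    hitExp b {y | S.ht y < k} v n ω x = hitExp b {y | S.ht y < k} v n η x := by
  induction n generalizing ω η x with
  | zero =>
    by_cases hA : x ∈ {y | S.ht y < k}
    · rw [hitExp_zero_of_mem hA, hitExp_zero_of_mem hA]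
    · rw [hitExp_of_notMem hA, hitExp_of_notMem hA, hv]
  | succ n ih =>
    by_cases hA : x ∈ {y | S.ht y < k}
    · rw [hitExp_succ_of_mem hA, hitExp_succ_of_mem hA]
      refine Finset.sum_congr rfl fun e _ => ?_
      rw [h x hA, ih (h.eat x)]
    · rw [hitExp_of_notMem hA, hitExp_of_notMem hA, hv]

variable [MeasurableSpace Y] [Countable Y] [MeasurableSingletonClass Y]

/-- When the walk reaches the height `k` for the first time, the environment from this height on is
fresh: it is independent of the hitting time and of the site where the height is reached. -/
theorem lintegral_hitExp {P : Measure (Env d κ Y)} [IsProbabilityMeasure P] (hP : IIDSites P)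
    {k : ℤ} {v : Env d κ Y → Y → ℝ} {C : ENNReal}
    (hv0 : ∀ ω y, S.ht y = k → 0 ≤ v ω y) (hvm : ∀ y, Measurable fun ω => v ω y)
    (hvl : ∀ y, S.ht y = k → ∀ ω η, AgreeAbove S k ω η → v ω y = v η y)
    (hvC : ∀ y, S.ht y = k → ∫⁻ ω, ENNReal.ofReal (v ω y) ∂P = C) (n : ℕ) (x : Y)
    (hx : S.ht x ≤ k) :
    ∫⁻ ω, ENNReal.ofReal (hitExp b {y | S.ht y < k} v n ω x) ∂P =
      (∫⁻ ω, ENNReal.ofReal (hitExp b {y | S.ht y < k} (fun _ _ => 1) n ω x) ∂P) * C := by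
  simp only [hitExp_eq_sum S hvl n _ x hx,
    hitExp_eq_sum S (v := fun _ _ => (1 : ℝ)) (fun _ _ _ _ _ => rfl) n _ x hx, mul_one]
  refine lintegral_sum_level_mul S hP k
    (W := fun ω y => hitExp b {y | S.ht y < k} (atSite y) n ω x)
    (fun ω y => hitExp_nonneg (fun _ _ _ => atSite_nonneg _ _ _) _ _ _)
    (fun y => measurable_hitExp (v := atSite y) (fun _ => measurable_const) _ _)
    (fun y ω η h => hitExp_congr_below S (fun _ _ _ => rfl) n h x) hv0 hvm hvl hvC

lemma prob_stayAbove_shiftEnv (c : ℤ) (a : Y) (ω : Env d κ Y) (x : Y) :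
    prob b (stayAbove S c) (shiftEnv a ω) x = prob b (stayAbove S (c + S.ht a)) ω (x + a) := by
  have h1 := tendsto_hitExp_one (b := b) {y | c ≤ S.ht y} (shiftEnv a ω) x
  have h2 := tendsto_hitExp_one (b := b) {y | c + S.ht a ≤ S.ht y} ω (x + a)
  have h3 : ∀ n, hitExp b {y | c ≤ S.ht y} (fun _ _ => 1) n (shiftEnv a ω) x =
      hitExp b {y | c + S.ht a ≤ S.ht y} (fun _ _ => 1) n ω (x + a) := fun n =>
    hitExp_shiftEnv a (fun y => by simp only [Set.mem_ofPred_eq, map_add]; omega)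
      (fun _ _ => rfl) n ω x
  simp only [h3] at h1
  have := tendsto_nhds_unique h1 h2
  unfold stayAbove
  linarith

/-- The annealed probability that the walk never goes below its starting height. -/
noncomputable def escapeProb (P : Measure (Env d κ Y)) : ENNReal :=
  ∫⁻ ω, ENNReal.ofReal (prob b (stayAbove S 0) ω 0) ∂P

lemma lintegral_prob_stayAbove {P : Measure (Env d κ Y)} [IsProbabilityMeasure P]
    (hP : IIDSites P) (y : Y) :
    ∫⁻ ω, ENNReal.ofReal (prob b (stayAbove S (S.ht y)) ω y) ∂P = escapeProb S P := by
  rw [escapeProb, ← hP.lintegral_shiftEnv y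
    (measurable_prob b (measurableSet_stayAbove S 0) 0).ennreal_ofReal]
  simp only [prob_stayAbove_shiftEnv, zero_add]

lemma escapeProb_le_one {P : Measure (Env d κ Y)} [IsProbabilityMeasure P] :
    escapeProb S P ≤ 1 := by
  calc escapeProb S P ≤ ∫⁻ _, 1 ∂P := lintegral_mono fun ω =>
        ENNReal.ofReal_le_one.2 (prob_le_one b _ _ _)
    _ = 1 := by simp

end Annealed

/-! ### If the walk may escape, then it is transient -/

section Escape

variable {d : ℕ} [NeZero d] {κ : NNReal} {Y : Type} [AddCommGroup Y] {b : Fin d → Y} {L : ℕ}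
  (S : StripData b L)

open Classical in
/-- The expectation of `v` at the time when the height `k` is reached, on the event that this
time is at most `n` and that the walk is below `0` at some earlier time `m ≥ K`. With each step the
remaining waiting time `K` decreases by one; once the walk is found below `0`, only the hitting time
of `k` is left to wait for. -/
noncomputable def negHitExp (k : ℤ) (v : Env d κ Y → Y → ℝ) : ℕ → ℕ → Env d κ Y → Y → ℝ
  | 0 => fun _ _ _ => 0
  | n + 1 => fun K ω x => if S.ht x < k then
      (if K = 0 ∧ S.ht x < 0 then hitExp b {y | S.ht y < k} v (n + 1) ω x
        else avg b (negHitExp k v n (K - 1)) ω x) else 0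

variable {S}

lemma negHitExp_of_le {k : ℤ} (v : Env d κ Y → Y → ℝ) (n K : ℕ) (ω : Env d κ Y) {x : Y}
    (hx : k ≤ S.ht x) : negHitExp S k v n K ω x = 0 := by
  cases n <;> simp [negHitExp, not_lt.2 hx]

lemma negHitExp_of_neg {k : ℤ} (hk : 0 ≤ k) (v : Env d κ Y → Y → ℝ) (n : ℕ) (ω : Env d κ Y)
    {x : Y} (hx : S.ht x < 0) :
    negHitExp S k v (n + 1) 0 ω x = hitExp b {y | S.ht y < k} v (n + 1) ω x := by
  have : S.ht x < k := by omega
  simp [negHitExp, this, hx]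

lemma negHitExp_of_not {k : ℤ} (v : Env d κ Y → Y → ℝ) (n : ℕ) {K : ℕ} (ω : Env d κ Y) {x : Y}
    (hx : S.ht x < k) (h : ¬ (K = 0 ∧ S.ht x < 0)) :
    negHitExp S k v (n + 1) K ω x = avg b (negHitExp S k v n (K - 1)) ω x := by
  simp only [negHitExp, if_pos hx, if_neg h]

variable (S)

lemma negHitExp_nonneg {k : ℤ} (hk : 0 ≤ k) {v : Env d κ Y → Y → ℝ} (hv : ∀ ω y, 0 ≤ v ω y)
    (n K : ℕ) (ω : Env d κ Y) (x : Y) : 0 ≤ negHitExp S k v n K ω x := by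
  induction n generalizing K ω x with
  | zero => exact le_rfl
  | succ n ih =>
    rcases le_or_gt k (S.ht x) with hx | hx
    · rw [negHitExp_of_le _ _ _ _ hx]
    · by_cases h : K = 0 ∧ S.ht x < 0
      · obtain ⟨rfl, h⟩ := h
        rw [negHitExp_of_neg hk _ _ _ h]
        exact hitExp_nonneg (fun ω y _ => hv ω y) _ _ _
      · rw [negHitExp_of_not _ _ _ hx h]
        exact const_le_avg fun e => ih _ _ _

lemma negHitExp_eq_sum {k : ℤ} (hk : 0 ≤ k) {v : Env d κ Y → Y → ℝ}
    (hvl : ∀ y, S.ht y = k → ∀ ω η, AgreeAbove S k ω η → v ω y = v η y) (n K : ℕ)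
    (ω : Env d κ Y) (x : Y) :
    negHitExp S k v n K ω x =
      ∑ y ∈ S.level k, negHitExp S k (atSite y) n K ω x * v ω y := by
  induction n generalizing K ω x with
  | zero => simp [negHitExp]
  | succ n ih =>
    rcases le_or_gt k (S.ht x) with hx | hx
    · simp [negHitExp_of_le _ _ _ _ hx]
    · by_cases h : K = 0 ∧ S.ht x < 0
      · obtain ⟨rfl, h⟩ := h
        simp only [negHitExp_of_neg hk _ _ _ h]
        exact hitExp_eq_sum S hvl _ _ _ hx.le
      · simp only [negHitExp_of_not _ _ _ hx h, ← avg_mul_const]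
        rw [← avg_sum (S.level k) fun y η z => negHitExp S k (atSite y) n (K - 1) η z * v ω y]
        refine avg_congr fun e => ?_
        rw [ih]
        refine Finset.sum_congr rfl fun y hy => ?_
        rw [hvl y ((S.mem_level k y).1 hy) _ _ (agreeAbove_eat ω hx)]

lemma negHitExp_congr_below {k : ℤ} (hk : 0 ≤ k) {v : Env d κ Y → Y → ℝ}
    (hv : ∀ ω η y, v ω y = v η y) (n K : ℕ)
    {ω η : Env d κ Y} (h : AgreeBelow S k ω η) (x : Y) :
    negHitExp S k v n K ω x = negHitExp S k v n K η x := by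
  induction n generalizing K ω η x with
  | zero => rfl
  | succ n ih =>
    rcases le_or_gt k (S.ht x) with hx | hx
    · rw [negHitExp_of_le _ _ _ _ hx, negHitExp_of_le _ _ _ _ hx]
    · by_cases h0 : K = 0 ∧ S.ht x < 0
      · obtain ⟨rfl, h0⟩ := h0
        rw [negHitExp_of_neg hk _ _ _ h0, negHitExp_of_neg hk _ _ _ h0]
        exact hitExp_congr_below S hv _ h _
      · rw [negHitExp_of_not _ _ _ hx h0, negHitExp_of_not _ _ _ hx h0]
        refine Finset.sum_congr rfl fun e _ => ?_
        rw [h x hx, ih _ (h.eat x)]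

variable [MeasurableSpace Y] [Countable Y] [MeasurableSingletonClass Y]

lemma measurable_negHitExp {k : ℤ} (hk : 0 ≤ k) {v : Env d κ Y → Y → ℝ}
    (hv : ∀ x, Measurable fun ω => v ω x) (n K : ℕ) (x : Y) :
    Measurable fun ω => negHitExp S k v n K ω x := by
  induction n generalizing K x with
  | zero => exact measurable_const
  | succ n ih =>
    rcases le_or_gt k (S.ht x) with hx | hx
    · simp only [negHitExp_of_le _ _ _ _ hx]; exact measurable_const
    · by_cases h0 : K = 0 ∧ S.ht x < 0
      · obtain ⟨rfl, h0⟩ := h0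
        simp only [negHitExp_of_neg hk _ _ _ h0]
        exact measurable_hitExp hv _ _
      · simp only [negHitExp_of_not _ _ _ hx h0]
        exact measurable_avg b (ih _) x

theorem lintegral_negHitExp {P : Measure (Env d κ Y)} [IsProbabilityMeasure P] (hP : IIDSites P)
    {k : ℤ} (hk : 0 ≤ k) {v : Env d κ Y → Y → ℝ} {C : ENNReal}
    (hv0 : ∀ ω y, S.ht y = k → 0 ≤ v ω y) (hvm : ∀ y, Measurable fun ω => v ω y)
    (hvl : ∀ y, S.ht y = k → ∀ ω η, AgreeAbove S k ω η → v ω y = v η y)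
    (hvC : ∀ y, S.ht y = k → ∫⁻ ω, ENNReal.ofReal (v ω y) ∂P = C) (n K : ℕ) (x : Y) :
    ∫⁻ ω, ENNReal.ofReal (negHitExp S k v n K ω x) ∂P =
      (∫⁻ ω, ENNReal.ofReal (negHitExp S k (fun _ _ => 1) n K ω x) ∂P) * C := by
  simp only [negHitExp_eq_sum S hk hvl n K _ x,
    negHitExp_eq_sum S hk (v := fun _ _ => (1 : ℝ)) (fun _ _ _ _ _ => rfl) n K _ x, mul_one]
  refine lintegral_sum_level_mul S hP k
    (W := fun ω y => negHitExp S k (atSite y) n K ω x)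
    (fun ω y => negHitExp_nonneg S hk (fun _ _ => atSite_nonneg _ _ _) _ _ _ _)
    (fun y => measurable_negHitExp S hk (v := atSite y) (fun _ => measurable_const) _ _ _)
    (fun y ω η h => negHitExp_congr_below S hk (fun _ _ _ => rfl) n K h x) hv0 hvm hvl hvC

/-- The paths which are below height `0` infinitely often. -/
def negOften : Set (ℕ → Y) := {X | ∃ᶠ n in atTop, S.ht (X n) < 0}

lemma iInter_negAfter : ⋂ K, negAfter S K = negOften S := by
  ext X
  simp only [Set.mem_iInter, negAfter, negOften, Set.mem_ofPred_eq, frequently_atTop]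

lemma measurableSet_negOften : MeasurableSet (negOften S) :=
  measurableSet_frequently fun n => measurableSet_coord n {y | S.ht y < 0}

lemma tendsto_prob_negAfter (ω : Env d κ Y) (x : Y) :
    Tendsto (fun K => prob b (negAfter S K) ω x) atTop (nhds (prob b (negOften S) ω x)) := by
  rw [← iInter_negAfter]
  exact tendsto_prob_iInter (measurableSet_negAfter S)
    (fun K M hKM X ⟨n, hn, h⟩ => ⟨n, hKM.trans hn, h⟩) ω x

lemma prob_negOften_le (K : ℕ) (ω : Env d κ Y) (x : Y) :
    prob b (negOften S) ω x ≤ prob b (negAfter S K) ω x := by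
  rw [← iInter_negAfter]
  exact prob_mono (Set.iInter_subset _ K) ω x

lemma prob_negOften_eq_avg (ω : Env d κ Y) (x : Y) :
    prob b (negOften S) ω x = avg b (prob b (negOften S)) ω x := by
  rw [← prob_shift (measurableSet_negOften S)]
  congr 1
  ext X
  simp only [negOften, Set.mem_ofPred_eq, frequently_atTop]
  constructor
  · intro h N
    obtain ⟨n, hn, h⟩ := h (N + 1)
    exact ⟨n - 1, by omega, by rwa [Nat.sub_add_cancel (by omega)]⟩
  · intro h N
    obtain ⟨n, hn, h⟩ := h N
    exact ⟨n + 1, by omega, h⟩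

/-- The probability of `negOften` along the walk is a martingale. -/
lemma hitExp_transient_le (k : ℤ) (n : ℕ) (ω : Env d κ Y) (x : Y) :
    hitExp b {y | S.ht y < k} (fun η y => 1 - prob b (negOften S) η y) n ω x ≤
      1 - prob b (negOften S) ω x := by
  induction n generalizing ω x with
  | zero =>
    by_cases hA : x ∈ {y | S.ht y < k}
    · rw [hitExp_zero_of_mem hA]
      linarith [prob_le_one b (negOften S) ω x]
    · rw [hitExp_of_notMem hA]
  | succ n ih =>
    by_cases hA : x ∈ {y | S.ht y < k}
    · rw [hitExp_succ_of_mem hA, prob_negOften_eq_avg]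
      refine (avg_mono (v := fun η y => 1 - prob b (negOften S) η y) fun e => ih _ _).trans_eq ?_
      rw [avg_sub, avg_const]
    · rw [hitExp_of_notMem hA]

/-- A walk which is below `0` after time `K`, then reaches the height `k` and stays above it, is
below `0` after time `K` but only finitely often. -/
lemma negHitExp_stayAbove_le {k : ℤ} (hk : 0 ≤ k) (n K : ℕ) (ω : Env d κ Y) (x : Y) :
    negHitExp S k (prob b (stayAbove S k)) n K ω x ≤
      prob b (negAfter S K) ω x - prob b (negOften S) ω x := by
  have h0 : ∀ (K : ℕ) (ω : Env d κ Y) x,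
      0 ≤ prob b (negAfter S K) ω x - prob b (negOften S) ω x :=
    fun K ω x => sub_nonneg.2 (prob_negOften_le S K ω x)
  induction n generalizing K ω x with
  | zero => exact h0 K ω x
  | succ n ih =>
    rcases le_or_gt k (S.ht x) with hx | hx
    · rw [negHitExp_of_le _ _ _ _ hx]; exact h0 K ω x
    · by_cases hK : K = 0 ∧ S.ht x < 0
      · obtain ⟨rfl, hK⟩ := hK
        rw [negHitExp_of_neg hk _ _ _ hK, prob_negAfter_zero_of_neg S ω hK]
        refine (hitExp_mono (fun η y _ => ?_) _ _ _).trans (hitExp_transient_le S k _ _ _)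
        have h1 : prob b (stayAbove S k) η y ≤ prob b (negOften S)ᶜ η y := by
          refine prob_mono (fun X hX h => ?_) _ _
          obtain ⟨n, hn⟩ := h.exists
          have : k ≤ S.ht (X n) := hX n
          omega
        rwa [prob_compl (measurableSet_negOften S)] at h1
      · have h1 : prob b (negAfter S K) ω x = avg b (prob b (negAfter S (K - 1))) ω x := by
          rcases Nat.eq_zero_or_pos K with rfl | hpos
          · exact prob_negAfter_zero_of_nonneg S ω (by
              by_contra h; exact hK ⟨rfl, not_le.1 h⟩)
          · obtain ⟨M, rfl⟩ : ∃ M, K = M + 1 := ⟨K - 1, by omega⟩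
            exact prob_negAfter_succ S M ω x
        rw [negHitExp_of_not _ _ _ hx hK, h1, prob_negOften_eq_avg, ← avg_sub]
        exact avg_mono fun e => ih _ _ _

/-- The paths which are below height `0` at some time between `K` and `N`. -/
def negBetween (K N : ℕ) : Set (ℕ → Y) := {X | ∃ m, K ≤ m ∧ m ≤ N ∧ S.ht (X m) < 0}

lemma measurableSet_negBetween (K N : ℕ) : MeasurableSet (negBetween S K N) := by
  have : negBetween S K N =
      ⋃ n, ⋃ (_ : K ≤ n), ⋃ (_ : n ≤ N), {X | X n ∈ {y | S.ht y < 0}} := by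
    ext X; simp [negBetween, and_left_comm]
  rw [this]
  exact MeasurableSet.iUnion fun i => MeasurableSet.iUnion fun _ =>
    MeasurableSet.iUnion fun _ => measurableSet_coord i _

/-- If the height `k` cannot be reached by time `N`, then a visit to negative heights between `K`
and `N` takes place before the walk reaches the height `k`, which it does almost surely. -/
lemma eventually_le_negHitExp (hκ : 0 < κ) {k : ℤ} (hk : 0 ≤ k) (N K : ℕ) (ω : Env d κ Y) (x : Y)
    (hx : S.ht x + N < k) {ε : ℝ} (hε : 0 < ε) :
    ∀ᶠ n in atTop, prob b (negBetween S K N) ω x - ε ≤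
      negHitExp S k (fun _ _ => 1) n K ω x := by
  induction N generalizing K ω x with
  | zero =>
    rcases Nat.eq_zero_or_pos K with rfl | hpos
    · rcases lt_or_ge (S.ht x) 0 with h | h
      · have h1 := (tendsto_hitExp_below (b := b) S hκ k ω x).eventually (lt_mem_nhds
          (show 1 - ε < 1 by linarith))
        filter_upwards [h1, eventually_ge_atTop 1] with n hn hn1
        obtain ⟨m, rfl⟩ : ∃ m, n = m + 1 := ⟨n - 1, by omega⟩
        rw [negHitExp_of_neg hk _ _ _ h]
        linarith [prob_le_one b (negBetween S 0 0) ω x]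
      · refine Eventually.of_forall fun n => ?_
        rw [prob_eq_zero_of_start]
        · linarith [negHitExp_nonneg S hk (v := fun _ _ => 1) (fun _ _ => zero_le_one) n 0 ω x]
        · rintro X hX ⟨m, -, hm, h'⟩
          obtain rfl : m = 0 := by omega
          rw [hX] at h'; omega
    · refine Eventually.of_forall fun n => ?_
      rw [prob_eq_zero_of_start]
      · linarith [negHitExp_nonneg S hk (v := fun _ _ => 1) (fun _ _ => zero_le_one) n K ω x]
      · rintro X hX ⟨m, hm, hm', h'⟩
        omega
  | succ N ih =>
    have hxk : S.ht x < k := by push_cast at hx; omega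
    by_cases hK : K = 0 ∧ S.ht x < 0
    · obtain ⟨rfl, hK⟩ := hK
      have h1 := (tendsto_hitExp_below (b := b) S hκ k ω x).eventually (lt_mem_nhds
        (show 1 - ε < 1 by linarith))
      filter_upwards [h1, eventually_ge_atTop 1] with n hn hn1
      obtain ⟨m, rfl⟩ : ∃ m, n = m + 1 := ⟨n - 1, by omega⟩
      rw [negHitExp_of_neg hk _ _ _ hK]
      linarith [prob_le_one b (negBetween S 0 (N + 1)) ω x]
    · have h1 : ∀ᶠ n in atTop, ∀ e, prob b (negBetween S (K - 1) N) (eat ω x) (x + move b e) - ε ≤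
          negHitExp S k (fun _ _ => 1) n (K - 1) (eat ω x) (x + move b e) :=
        eventually_all.2 fun e => ih (K - 1) _ _ (by
          have := S.exists_ht x e
          push_cast at hx
          omega)
      have h2 : prob b (negBetween S K (N + 1)) ω x ≤
          avg b (prob b (negBetween S (K - 1) N)) ω x := by
        rw [← prob_shift (measurableSet_negBetween S _ _)]
        refine prob_mono_ae fun X hX h => ?_
        obtain ⟨m, hm, hm', h⟩ := h
        cases m with
        | zero => exact absurd ⟨by omega, hX ▸ h⟩ hK
        | succ m => exact ⟨m, by omega, by omega, h⟩
      have h3 := (tendsto_sub_atTop_nat 1).eventually h1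
      filter_upwards [h3, eventually_ge_atTop 1] with n hn hn1
      obtain ⟨m, rfl⟩ : ∃ m, n = m + 1 := ⟨n - 1, by omega⟩
      rw [negHitExp_of_not _ _ _ hxk hK]
      have h4 := avg_mono (b := b) (u := fun η y => prob b (negBetween S (K - 1) N) η y - ε)
        (v := negHitExp S k (fun _ _ => 1) m (K - 1)) hn
      rw [avg_sub, avg_const] at h4
      linarith

lemma ofReal_prob_negBetween_le_liminf (hκ : 0 < κ) {k : ℤ} (hk : 0 ≤ k) (N K : ℕ)
    (ω : Env d κ Y) (x : Y) (hx : S.ht x + N < k) :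
    ENNReal.ofReal (prob b (negBetween S K N) ω x) ≤
      liminf (fun n => ENNReal.ofReal (negHitExp S k (fun _ _ => 1) n K ω x)) atTop := by
  refine ENNReal.le_of_forall_pos_le_add fun ε hε _ => ?_
  rw [← tsub_le_iff_right]
  refine le_liminf_of_le (by isBoundedDefault) ?_
  filter_upwards [eventually_le_negHitExp S hκ hk N K ω x hx (ε := ε) hε] with n hn
  rw [← ENNReal.ofReal_coe_nnreal, ← ENNReal.ofReal_sub _ (NNReal.coe_nonneg ε)]
  exact ENNReal.ofReal_le_ofReal hn

/-- If the walk has a positive annealed probability never to go below its starting height, then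
it is almost surely not infinitely often below `0`: whenever it reaches a new maximal height, it
has a fresh chance to escape. -/
theorem prob_negOften_eq_zero (hκ : 0 < κ) {P : Measure (Env d κ Y)} [IsProbabilityMeasure P]
    (hP : IIDSites P) (hesc : escapeProb S P ≠ 0) :
    ∀ᵐ ω ∂P, prob b (negOften S) ω 0 = 0 := by
  set p := escapeProb S P with hp
  have hpt : p ≠ ⊤ := ne_top_of_le_ne_top ENNReal.one_ne_top (escapeProb_le_one S)
  have hq : ∀ K, Measurable fun ω : Env d κ Y => ENNReal.ofReal (prob b (negAfter S K) ω 0) :=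
    fun K => (measurable_prob b (measurableSet_negAfter S K) 0).ennreal_ofReal
  have h1 : ∀ K N : ℕ, (∫⁻ ω, ENNReal.ofReal (prob b (negBetween S K N) ω 0) ∂P) * p ≤
      ∫⁻ ω, ENNReal.ofReal (prob b (negAfter S K) ω 0 - prob b (negOften S) ω 0) ∂P := by
    intro K N
    -- the height `N + 1` is reached after time `N`, and there the walk escapes with probability `p`
    have hk : (0 : ℤ) ≤ (N : ℤ) + 1 := by omega
    have h2 : ∀ n, (∫⁻ ω, ENNReal.ofReal
        (negHitExp S ((N : ℤ) + 1) (fun _ _ => 1) n K ω 0) ∂P) * p ≤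
        ∫⁻ ω, ENNReal.ofReal (prob b (negAfter S K) ω 0 - prob b (negOften S) ω 0) ∂P := by
      intro n
      rw [← lintegral_negHitExp S hP hk (v := prob b (stayAbove S ((N : ℤ) + 1)))
        (fun ω y _ => prob_nonneg b _ _ _)
        (fun y => measurable_prob b (measurableSet_stayAbove S _) y)
        (fun y _ ω η h => prob_stayAbove_congr h y)
        (fun y hy => by rw [← hy]; exact lintegral_prob_stayAbove S hP y) n K 0]
      exact lintegral_mono fun ω =>
        ENNReal.ofReal_le_ofReal (negHitExp_stayAbove_le S hk n K ω 0)
    have h3 : ∫⁻ ω, ENNReal.ofReal (prob b (negBetween S K N) ω 0) ∂P ≤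
        liminf (fun n => ∫⁻ ω, ENNReal.ofReal
          (negHitExp S ((N : ℤ) + 1) (fun _ _ => 1) n K ω 0) ∂P) atTop :=
      (lintegral_mono fun ω => ofReal_prob_negBetween_le_liminf S hκ hk N K ω 0
        (by rw [map_zero]; omega)).trans (lintegral_liminf_le fun n =>
          (measurable_negHitExp S hk (fun _ => measurable_const) n K 0).ennreal_ofReal)
    rw [← ENNReal.le_div_iff_mul_le (Or.inl hesc) (Or.inl hpt)]
    refine h3.trans (liminf_le_of_le (by isBoundedDefault) fun a ha => ?_)
    obtain ⟨n, hn⟩ := ha.exists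
    exact hn.trans ((ENNReal.le_div_iff_mul_le (Or.inl hesc) (Or.inl hpt)).2 (h2 n))
  have h2 : ∀ K : ℕ, (∫⁻ ω, ENNReal.ofReal (prob b (negAfter S K) ω 0) ∂P) * p ≤
      ∫⁻ ω, ENNReal.ofReal (prob b (negAfter S K) ω 0 - prob b (negOften S) ω 0) ∂P := by
    intro K
    have hmono : Monotone (negBetween S K) := fun N M hNM X ⟨m, hm, hm', h⟩ =>
      ⟨m, hm, hm'.trans hNM, h⟩
    have hU : ⋃ N, negBetween S K N = negAfter S K := by
      ext X
      simp only [Set.mem_iUnion, negBetween, negAfter, Set.mem_ofPred_eq]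
      exact ⟨fun ⟨N, m, hm, _, h⟩ => ⟨m, hm, h⟩, fun ⟨m, hm, h⟩ => ⟨m, m, hm, le_rfl, h⟩⟩
    have hlim : Tendsto (fun N => ∫⁻ ω, ENNReal.ofReal (prob b (negBetween S K N) ω 0) ∂P) atTop
        (nhds (∫⁻ ω, ENNReal.ofReal (prob b (negAfter S K) ω 0) ∂P)) := by
      refine lintegral_tendsto_of_tendsto_of_monotone
        (fun N => (measurable_prob b
          (measurableSet_negBetween S K N) 0).ennreal_ofReal.aemeasurable)
        (ae_of_all _ fun ω N M h => ENNReal.ofReal_le_ofReal (prob_mono (hmono h) _ _))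
        (ae_of_all _ fun ω => ?_)
      have := tendsto_prob_iUnion (b := b) hmono ω 0
      rw [hU] at this
      exact (ENNReal.continuous_ofReal.tendsto _).comp this
    exact le_of_tendsto' (ENNReal.Tendsto.mul_const hlim (Or.inr hpt)) (h1 K)
  have hlim0 : Tendsto (fun K => ∫⁻ ω, ENNReal.ofReal
      (prob b (negAfter S K) ω 0 - prob b (negOften S) ω 0) ∂P) atTop (nhds 0) := by
    have : (0 : ENNReal) = ∫⁻ _, 0 ∂P := by simp
    rw [this]
    refine tendsto_lintegral_of_dominated_convergence (fun _ => 1)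
      (fun K => ((measurable_prob b (measurableSet_negAfter S K) 0).sub
        (measurable_prob b (measurableSet_negOften S) 0)).ennreal_ofReal)
      (fun K => ae_of_all _ fun ω => ENNReal.ofReal_le_one.2 (by
        linarith [prob_le_one b (negAfter S K) ω 0, prob_nonneg b (negOften S) ω 0]))
      (by simp) (ae_of_all _ fun ω => ?_)
    have h := (tendsto_prob_negAfter (b := b) S ω 0).sub_const (prob b (negOften S) ω 0)
    rw [sub_self] at h
    have h' := (ENNReal.continuous_ofReal.tendsto _).comp h
    rwa [ENNReal.ofReal_zero] at h'
  -- in the limit `K → ∞`, the probability of `negOften` times `p` is at most zero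
  have h3 : (∫⁻ ω, ENNReal.ofReal (prob b (negOften S) ω 0) ∂P) * p = 0 := by
    refine le_antisymm (ge_of_tendsto' hlim0 fun K => le_trans ?_ (h2 K)) zero_le
    gcongr
    exact prob_negOften_le S K _ _
  have h4 := (mul_eq_zero.1 h3).resolve_right hesc
  rw [lintegral_eq_zero_iff
    (measurable_prob b (measurableSet_negOften S) 0).ennreal_ofReal] at h4
  filter_upwards [h4] with ω hω
  exact le_antisymm (ENNReal.ofReal_eq_zero.1 hω) (prob_nonneg b _ _ _)

end Escape

/-! ### Compactness of the space of environments, and the consumption of cookies -/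

section Topology

variable {d : ℕ} {κ : NNReal} {Y : Type}

lemma continuous_env_apply (y : Y) (i : ℕ) (e : Dir d) :
    Continuous fun ω : Env d κ Y => ω.1 y i e :=
  (continuous_apply e).comp <| (continuous_apply i).comp <|
    (continuous_apply y).comp continuous_subtype_val

lemma continuous_eat (x : Y) : Continuous fun ω : Env d κ Y => eat ω x := by
  classical
  refine Continuous.subtype_mk (continuous_pi fun y => continuous_pi fun i =>
    continuous_pi fun e => ?_) _
  by_cases h : y = x
  · simp only [h, if_true]; exact continuous_env_apply _ _ _
  · simp only [h, if_false]; exact continuous_env_apply _ _ _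

lemma continuous_cookieDrift (y : Y) (i : ℕ) :
    Continuous fun ω : Env d κ Y => cookieDrift (ω.1 y i) := by
  unfold cookieDrift
  exact continuous_finsetSum _ fun e _ => (continuous_env_apply y i e).mul continuous_const

/-- The environments form a closed subset of a product of compact intervals. -/
instance : CompactSpace (Env d κ Y) := by
  have hK : IsCompact (Set.pi Set.univ fun _ : Y => Set.pi Set.univ fun _ : ℕ =>
      Set.pi Set.univ fun _ : Dir d => Set.Icc (κ : ℝ) (1 - κ)) :=
    isCompact_univ_pi fun _ => isCompact_univ_pi fun _ => isCompact_univ_pi fun _ => isCompact_Icc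
  have hc : ∀ (x : Y) (i : ℕ) (e : Dir d), Continuous fun ω : Y → ℕ → Dir d → ℝ => ω x i e :=
    fun x i e => (continuous_apply e).comp ((continuous_apply i).comp (continuous_apply x))
  have hcl : IsClosed ({ω : Y → ℕ → Dir d → ℝ | (∀ x i, ∑ e, ω x i e = 1) ∧
      ∀ x i, 0 ≤ cookieDrift (ω x i)}) := by
    rw [Set.ofPred_and]
    simp only [Set.ofPred_forall]
    refine IsClosed.inter (isClosed_iInter fun x => isClosed_iInter fun i => ?_)
      (isClosed_iInter fun x => isClosed_iInter fun i => ?_)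
    · exact isClosed_eq (continuous_finsetSum _ fun e _ => hc x i e) continuous_const
    · refine isClosed_le continuous_const ?_
      unfold cookieDrift
      exact continuous_finsetSum _ fun e _ => (hc x i e).mul continuous_const
  have h := hK.inter_right hcl
  have heq : (Set.range (Subtype.val : Env d κ Y → Y → ℕ → Dir d → ℝ)) =
      (Set.pi Set.univ fun _ : Y => Set.pi Set.univ fun _ : ℕ =>
      Set.pi Set.univ fun _ : Dir d => Set.Icc (κ : ℝ) (1 - κ)) ∩
      {ω : Y → ℕ → Dir d → ℝ | (∀ x i, ∑ e, ω x i e = 1) ∧ ∀ x i, 0 ≤ cookieDrift (ω x i)} := by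
    ext ω
    simp only [Set.mem_range, Subtype.exists, exists_prop, exists_eq_right, Set.mem_inter_iff,
      Set.mem_pi, Set.mem_univ, forall_true_left, Set.mem_ofPred_eq]
  rw [← heq] at h
  rw [← isCompact_univ_iff, Subtype.isCompact_iff, Set.image_univ]
  exact h

variable [AddCommGroup Y] {b : Fin d → Y}

/-- An expected cost within finitely many steps depends on finitely many cookies only. -/
lemma continuous_costExp {A : Set Y} {c : Env d κ Y → Y → ℝ}
    (hc : ∀ x, Continuous fun ω => c ω x) (n : ℕ) (x : Y) :
    Continuous fun ω => costExp b A c n ω x := by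
  induction n generalizing x with
  | zero => exact continuous_const
  | succ n ih =>
    by_cases hx : x ∈ A
    · simp only [costExp_succ_of_mem hx]
      refine (hc x).add (continuous_finsetSum _ fun e _ => (continuous_env_apply _ _ _).mul ?_)
      exact (ih _).comp (continuous_eat x)
    · simp only [costExp_of_notMem hx]; exact continuous_const

end Topology

section Visits

variable {d : ℕ} [NeZero d] {κ : NNReal} {Y : Type} [AddCommGroup Y] {b : Fin d → Y} {L : ℕ}

open Classical in
/-- The number of visits to `y` before time `m`. -/
noncomputable def visits (y : Y) (m : ℕ) (X : ℕ → Y) : ℕ :=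
  ((Finset.range m).filter fun n => X n = y).card

open Classical in
lemma visits_mono (y : Y) (X : ℕ → Y) : Monotone fun m => visits y m X := fun _ _ h =>
  Finset.card_le_card (Finset.filter_subset_filter _ (Finset.range_subset_range.2 h))

open Classical in
lemma visits_succ (y : Y) (m : ℕ) (X : ℕ → Y) :
    visits y (m + 1) X = visits y m (fun n => X (n + 1)) + if X 0 = y then 1 else 0 := by
  simp only [visits, Finset.card_filter]
  rw [Finset.sum_range_succ']

open Classical in
lemma exists_lt_visits {y : Y} {X : ℕ → Y} (h : ∃ᶠ n in atTop, X n = y) (i : ℕ) :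
    ∃ m, i < visits y m X := by
  induction i with
  | zero =>
    obtain ⟨n, hn⟩ := h.exists
    exact ⟨n + 1, Finset.card_pos.2 ⟨n, by simp [hn]⟩⟩
  | succ i ih =>
    obtain ⟨m, hm⟩ := ih
    rw [frequently_atTop] at h
    obtain ⟨n, hn, hX⟩ := h m
    refine ⟨n + 1, ?_⟩
    have h1 : visits y (n + 1) X = visits y n X + 1 := by
      simp only [visits, Finset.card_filter]
      rw [Finset.sum_range_succ, if_pos hX]
    have h2 := visits_mono y X hn
    simp only at h2
    omega

variable [MeasurableSpace Y] [Countable Y] [MeasurableSingletonClass Y]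

lemma measurableSet_lt_visits (y : Y) (i m : ℕ) : MeasurableSet {X : ℕ → Y | i < visits y m X} := by
  classical
  have : Measurable fun X : ℕ → Y => visits y m X := by
    simp only [visits, Finset.card_filter]
    exact Finset.measurable_sum _ fun n _ =>
      Measurable.ite (measurableSet_coord n {y}) measurable_const measurable_const
  exact measurableSet_lt measurable_const this

open Classical in
/-- The `(i+1)`-st cookie at `y` is eaten within `m` steps if there are more than `i` visits to `y`
before time `m`. -/
lemma sum_drift_mul_prob_visits_le (I : ℕ) (y : Y) (m : ℕ) (ω : Env d κ Y) (x : Y) :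
    ∑ i ∈ Finset.range I, cookieDrift (ω.1 y i) * prob b {X | i < visits y m X} ω x ≤
      costExp b Set.univ (fun ω x => if x = y then cookieDrift (ω.1 x 0) else 0) m ω x := by
  induction m generalizing ω x with
  | zero =>
    refine le_of_eq (Finset.sum_eq_zero fun i _ => ?_)
    rw [prob_eq_zero_of_start (fun X _ => by simp [visits]), mul_zero]
  | succ m ih =>
    rw [costExp_succ_of_mem (Set.mem_univ x)]
    have hIH := avg_mono (b := b) (ω := ω) (x := x)
      (u := fun η z => ∑ i ∈ Finset.range I, cookieDrift ((eat ω x).1 y i) *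
        prob b {X | i < visits y m X} η z) fun e => ih (eat ω x) _
    rw [avg_sum (Finset.range I) fun i η z => cookieDrift ((eat ω x).1 y i) *
        prob b {X | i < visits y m X} η z] at hIH
    simp only [mul_comm (cookieDrift _), avg_mul_const] at hIH
    simp only [← mul_comm (cookieDrift _)] at hIH
    by_cases hx : x = y
    · subst hx
      rw [if_pos rfl]
      refine le_trans ?_ (add_le_add le_rfl hIH)
      cases I with
      | zero => simpa using ω.2.2.2 x 0
      | succ I =>
        rw [Finset.sum_range_succ', add_comm]
        refine add_le_add ?_ ?_
        · exact mul_le_of_le_one_right (ω.2.2.2 x 0) (prob_le_one b _ _ _)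
        · rw [Finset.sum_range_succ]
          refine (Finset.sum_le_sum fun i _ => ?_).trans (le_add_of_nonneg_right
            (mul_nonneg ((eat ω x).2.2.2 _ _) (const_le_avg fun e => prob_nonneg b _ _ _)))
          rw [eat_self, ← prob_shift (measurableSet_lt_visits x i m)]
          refine mul_le_mul_of_nonneg_left (prob_mono_ae fun X hX h => ?_) (ω.2.2.2 _ _)
          simp only [Set.mem_ofPred_eq, visits_succ, hX, if_true] at h ⊢
          omega
    · rw [if_neg hx, zero_add]
      refine le_trans (Finset.sum_le_sum fun i _ => ?_) hIH
      rw [eat_of_ne _ (Ne.symm hx), ← prob_shift (measurableSet_lt_visits y i m)]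
      refine mul_le_mul_of_nonneg_left (prob_mono_ae fun X hX h => ?_) (ω.2.2.2 _ _)
      simpa only [Set.mem_ofPred_eq, visits_succ, hX, hx, if_false, add_zero] using h

variable (S : StripData b L)

/-- If all sites are visited infinitely often, then all the cookies at the level `0` are eaten. -/
lemma eventually_lt_costExp {ω : Env d κ Y} {x : Y}
    (h : ∀ᵐ X ∂walkLaw b ω x, ∀ y, ∃ᶠ n in atTop, X n = y) (I : ℕ) {c : ℝ}
    (hc : c < ∑ y ∈ S.level 0, ∑ i ∈ Finset.range I, cookieDrift (ω.1 y i)) :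
    ∃ m, c < costExp b Set.univ (driftOn S {0}) m ω x := by
  classical
  have h1 : ∀ y i, Tendsto (fun m => prob b {X | i < visits y m X} ω x) atTop (nhds 1) := by
    intro y i
    have h2 := tendsto_prob_iUnion (b := b) (B := fun m => {X | i < visits y m X})
      (fun m n hmn X hX => lt_of_lt_of_le hX (visits_mono y X hmn)) ω x
    have h3 : prob b (⋃ m, {X | i < visits y m X}) ω x = 1 := by
      rw [← prob_univ (b := b) ω x]
      refine measureReal_congr ?_
      filter_upwards [h] with X hX
      refine propext ⟨fun _ => trivial, fun _ => ?_⟩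
      obtain ⟨m, hm⟩ := exists_lt_visits (hX y) i
      exact Set.mem_iUnion.2 ⟨m, hm⟩
    rwa [h3] at h2
  have h4 : Tendsto (fun m => ∑ y ∈ S.level 0, ∑ i ∈ Finset.range I,
      cookieDrift (ω.1 y i) * prob b {X | i < visits y m X} ω x) atTop
      (nhds (∑ y ∈ S.level 0, ∑ i ∈ Finset.range I, cookieDrift (ω.1 y i))) := by
    refine tendsto_finsetSum _ fun y _ => tendsto_finsetSum _ fun i _ => ?_
    simpa using (h1 y i).const_mul (cookieDrift (ω.1 y i))
  obtain ⟨m, hm⟩ := (h4.eventually (lt_mem_nhds hc)).exists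
  refine ⟨m, hm.trans_le ?_⟩
  refine (Finset.sum_le_sum fun y _ => sum_drift_mul_prob_visits_le I y m ω x).trans ?_
  rw [← costExp_sum (S.level 0) fun y ω x => if x = y then cookieDrift (ω.1 x 0) else 0]
  refine costExp_mono (fun η z _ => ?_) _ _ _
  rw [Finset.sum_ite_eq]
  simp only [driftOn, S.mem_level, Set.mem_singleton_iff]
  split_ifs <;> exact le_rfl

/-- If the walk cannot stay above its starting height, then it visits all sites infinitely
often. -/
lemma ae_frequently_visit_of_prob_stayAbove (hκ : 0 < κ) {ω : Env d κ Y} {x : Y}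
    (h : prob b (stayAbove S (S.ht x)) ω x = 0) :
    ∀ᵐ X ∂walkLaw b ω x, ∀ y, ∃ᶠ n in atTop, X n = y := by
  filter_upwards [ae_frequently_ht_le S hκ h, ae_frequently_visit S hκ ω x] with X h1 h2
  exact h2 _ h1

end Visits

/-! ### Without escape, the drift per level is at most one -/

section Supercritical

variable {d : ℕ} [NeZero d] {κ : NNReal} {Y : Type} [AddCommGroup Y] {b : Fin d → Y} {L : ℕ}

lemma costExp_univ_le {S : StripData b L} {c : Env d κ Y → Y → ℝ} {k : ℤ} (m : ℕ)
    (ω : Env d κ Y) (x : Y) (hx : S.ht x + m ≤ k) :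
    costExp b Set.univ c m ω x ≤ costExp b {y | S.ht y < k} c m ω x := by
  induction m generalizing ω x with
  | zero => exact le_rfl
  | succ m ih =>
    have hA : x ∈ {y | S.ht y < k} := by
      simp only [Set.mem_ofPred_eq]; push_cast at hx; omega
    rw [costExp_succ_of_mem (Set.mem_univ x), costExp_succ_of_mem hA]
    refine add_le_add le_rfl (avg_mono fun e => ih _ _ ?_)
    have := S.exists_ht x e
    push_cast at hx
    omega

/-- What is consumed within `m` steps after the level `j` has been reached is consumed before the
height `k ≥ j + m` is reached. -/
lemma hitExp_costExp_le {S : StripData b L} {c : Env d κ Y → Y → ℝ} (hc : ∀ ω x, 0 ≤ c ω x)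
    {j k : ℤ} (m n : ℕ) (hjk : j + m ≤ k) (ω : Env d κ Y) (x : Y) (hx : S.ht x ≤ j) :
    hitExp b {y | S.ht y < j} (costExp b Set.univ c m) n ω x ≤
      costExp b {y | S.ht y < k} c (m + n) ω x := by
  have hout : ∀ n (ω : Env d κ Y) x, S.ht x ≤ j → x ∉ {y | S.ht y < j} →
      hitExp b {y | S.ht y < j} (costExp b Set.univ c m) n ω x ≤
      costExp b {y | S.ht y < k} c (m + n) ω x := by
    intro n ω x hx hA
    rw [hitExp_of_notMem hA]
    refine (costExp_univ_le (S := S) (k := k) m ω x (by omega)).trans ?_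
    exact monotone_costExp (fun ω x _ => hc ω x) ω x (Nat.le_add_right m n)
  by_cases hA : x ∈ {y | S.ht y < j}
  · induction n generalizing ω x with
    | zero =>
      rw [hitExp_zero_of_mem hA]
      exact costExp_nonneg (fun ω x _ => hc ω x) _ _ _
    | succ n ih =>
      have hA' : S.ht x < j := hA
      have hAk : x ∈ {y | S.ht y < k} := by simp only [Set.mem_ofPred_eq]; omega
      rw [hitExp_succ_of_mem hA, ← add_assoc, costExp_succ_of_mem hAk]
      refine le_add_of_nonneg_of_le (hc ω x) (avg_mono fun e => ?_)
      have hstep := S.exists_ht x e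
      by_cases hy : x + move b e ∈ {y | S.ht y < j}
      · exact ih _ _ (by omega) hy
      · exact hout n _ _ (by omega) hy
  · exact hout _ _ _ hx hA

/-- The exit from `{y | S.ht y < k}` takes place at height `k`. -/
lemma hitExp_mono_level {S : StripData b L} {k : ℤ} {u v : Env d κ Y → Y → ℝ}
    (h : ∀ ω y, S.ht y = k → u ω y ≤ v ω y) (n : ℕ) (ω : Env d κ Y) (x : Y) (hx : S.ht x ≤ k) :
    hitExp b {y | S.ht y < k} u n ω x ≤ hitExp b {y | S.ht y < k} v n ω x := by
  induction n generalizing ω x with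
  | zero =>
    by_cases hA : x ∈ {y | S.ht y < k}
    · rw [hitExp_zero_of_mem hA, hitExp_zero_of_mem hA]
    · rw [hitExp_of_notMem hA, hitExp_of_notMem hA]
      exact h _ _ (le_antisymm hx (not_lt.1 hA))
  | succ n ih =>
    by_cases hA : x ∈ {y | S.ht y < k}
    · rw [hitExp_succ_of_mem hA, hitExp_succ_of_mem hA]
      refine avg_mono fun e => ih _ _ ?_
      have hA' : S.ht x < k := hA
      have := S.exists_ht x e
      omega
    · rw [hitExp_of_notMem hA, hitExp_of_notMem hA]
      exact h _ _ (le_antisymm hx (not_lt.1 hA))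

lemma driftOn_shiftEnv (S : StripData b L) (j : ℤ) (a : Y) (ω : Env d κ Y) (x : Y) :
    driftOn S {j} (shiftEnv a ω) x = driftOn S {j + S.ht a} ω (x + a) := by
  have : S.ht x = j ↔ S.ht x + S.ht a = j + S.ht a := by omega
  simp only [driftOn, Set.mem_singleton_iff, map_add, this]
  rfl

lemma continuous_driftOn (S : StripData b L) (J : Set ℤ) (x : Y) :
    Continuous fun ω : Env d κ Y => driftOn S J ω x := by
  unfold driftOn
  by_cases h : S.ht x ∈ J
  · simp only [h, if_true]; exact continuous_cookieDrift x 0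
  · simp only [h, if_false]; exact continuous_const

lemma continuous_glue (S : StripData b L) (c : ℤ) :
    Continuous fun p : Env d κ Y × Env d κ Y => glue S c p.2 p.1 := by
  refine Continuous.subtype_mk (continuous_pi fun y => ?_) _
  by_cases h : c ≤ S.ht y
  · simp only [h, if_true]
    exact (continuous_apply y).comp (continuous_subtype_val.comp continuous_fst)
  · simp only [h, if_false]
    exact (continuous_apply y).comp (continuous_subtype_val.comp continuous_snd)

variable (S : StripData b L)

/-- The expected drift consumed at the level `0` within `m` steps by the walk started at `0`, in
the worst case with respect to the environment at negative heights. -/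
noncomputable def worstDrift (m : ℕ) (ω : Env d κ Y) : ℝ :=
  sInf ((fun ζ => costExp b Set.univ (driftOn S {0}) m (glue S 0 ζ ω) 0) '' Set.univ)

instance [Countable Y] : BorelSpace (Env d κ Y) := by
  have : BorelSpace (Dir d → ℝ) := Pi.borelSpace
  have : BorelSpace (ℕ → Dir d → ℝ) := Pi.borelSpace
  have : BorelSpace (Y → ℕ → Dir d → ℝ) := Pi.borelSpace
  exact Subtype.borelSpace _

lemma continuous_worstDrift (m : ℕ) :
    Continuous fun ω : Env d κ Y => worstDrift S m ω := by
  refine IsCompact.continuous_sInf (f := fun ω ζ : Env d κ Y =>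
    costExp b Set.univ (driftOn S {0}) m (glue S 0 ζ ω) 0) isCompact_univ ?_
  exact (continuous_costExp (fun x => continuous_driftOn S {0} x) m 0).comp (continuous_glue S 0)

lemma worstDrift_bddBelow (m : ℕ) (ω : Env d κ Y) : BddBelow
    ((fun ζ => costExp b Set.univ (driftOn S {0}) m (glue S 0 ζ ω) 0) '' Set.univ) := by
  refine ⟨0, ?_⟩
  rintro _ ⟨ζ, -, rfl⟩
  exact costExp_nonneg (fun _ _ _ => driftOn_nonneg S _ _ _) _ _ _

lemma worstDrift_le (m : ℕ) (ζ ω : Env d κ Y) :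
    worstDrift S m ω ≤ costExp b Set.univ (driftOn S {0}) m (glue S 0 ζ ω) 0 :=
  csInf_le (worstDrift_bddBelow S m ω) ⟨ζ, Set.mem_univ _, rfl⟩

lemma le_worstDrift {m : ℕ} {ω : Env d κ Y} {c : ℝ}
    (h : ∀ ζ, c ≤ costExp b Set.univ (driftOn S {0}) m (glue S 0 ζ ω) 0) :
    c ≤ worstDrift S m ω := by
  refine le_csInf (Set.image_nonempty.2 ⟨ω, Set.mem_univ _⟩) ?_
  rintro _ ⟨ζ, -, rfl⟩
  exact h ζ

lemma worstDrift_nonneg (m : ℕ) (ω : Env d κ Y) : 0 ≤ worstDrift S m ω :=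
  le_worstDrift S fun _ => costExp_nonneg (fun _ _ _ => driftOn_nonneg S _ _ _) _ _ _

lemma worstDrift_mono (ω : Env d κ Y) : Monotone fun m => worstDrift S m ω := fun m _ h =>
  le_worstDrift S fun ζ => (worstDrift_le S m ζ ω).trans
    (monotone_costExp (fun _ _ _ => driftOn_nonneg S _ _ _) _ _ h)

lemma glue_self (c : ℤ) (ω : Env d κ Y) : glue S c ω ω = ω :=
  Subtype.ext (funext fun y => by simp [glue])

/-- At a first visit to the level of `y`, the environment ahead is unspoiled, while the one behind
is some environment; the worst case bounds the consumption from below. -/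
lemma worstDrift_shiftEnv_le (m : ℕ) (ω : Env d κ Y) (y : Y) :
    worstDrift S m (shiftEnv y ω) ≤ costExp b Set.univ (driftOn S {S.ht y}) m ω y := by
  have h := worstDrift_le S m (shiftEnv y ω) (shiftEnv y ω)
  rw [glue_self, costExp_shiftEnv (A' := Set.univ) (c' := driftOn S {S.ht y}) y
    (fun _ => by simp) (fun ω x => by rw [driftOn_shiftEnv, zero_add]), zero_add] at h
  exact h

lemma worstDrift_congr (m : ℕ) {ω η : Env d κ Y} (h : AgreeAbove S 0 ω η) :
    worstDrift S m ω = worstDrift S m η := by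
  have : ∀ ζ, glue S 0 ζ ω = glue S 0 ζ η := fun ζ => Subtype.ext (funext fun y => by
    by_cases hy : 0 ≤ S.ht y
    · rw [glue_of_le S _ _ hy, glue_of_le S _ _ hy, h y hy]
    · rw [glue_of_lt S _ _ (not_le.1 hy), glue_of_lt S _ _ (not_le.1 hy)])
  simp only [worstDrift, this]

/-- The total drift of the cookies at the level `j`. -/
noncomputable def levelDrift (j : ℤ) (ω : Env d κ Y) : ENNReal :=
  ∑ y ∈ S.level j, totalDrift y ω

lemma levelDrift_eq_iSup (j : ℤ) (ω : Env d κ Y) : levelDrift S j ω =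
    ⨆ I : ℕ, ENNReal.ofReal (∑ y ∈ S.level j, ∑ i ∈ Finset.range I, cookieDrift (ω.1 y i)) := by
  have h : ∀ I : ℕ, ENNReal.ofReal (∑ y ∈ S.level j, ∑ i ∈ Finset.range I,
      cookieDrift (ω.1 y i)) = ∑ i ∈ Finset.range I, ∑ y ∈ S.level j,
        ENNReal.ofReal (cookieDrift (ω.1 y i)) := by
    intro I
    rw [Finset.sum_comm, ENNReal.ofReal_sum_of_nonneg fun i _ =>
      Finset.sum_nonneg fun y _ => ω.2.2.2 y i]
    exact Finset.sum_congr rfl fun i _ => ENNReal.ofReal_sum_of_nonneg fun y _ => ω.2.2.2 y i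
  simp only [h, levelDrift, totalDrift]
  rw [← ENNReal.tsum_eq_iSup_nat, Summable.tsum_finsetSum fun _ _ => ENNReal.summable]

lemma measurable_totalDrift (y : Y) : Measurable fun ω : Env d κ Y => totalDrift y ω := by
  unfold totalDrift
  refine Measurable.tsum fun i => Measurable.ennreal_ofReal ?_
  unfold cookieDrift
  exact Finset.measurable_sum _ fun e _ => (measurable_env_apply y i e).mul_const _

lemma lintegral_totalDrift {P : Measure (Env d κ Y)} [IsProbabilityMeasure P] (hP : IIDSites P)
    (y : Y) : ∫⁻ ω, totalDrift y ω ∂P = ∫⁻ ω, totalDrift 0 ω ∂P := by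
  rw [← hP.lintegral_shiftEnv y (measurable_totalDrift (0 : Y))]
  have : ∀ ω : Env d κ Y, totalDrift 0 (shiftEnv y ω) = totalDrift y ω := fun ω => by
    simp [totalDrift, shiftEnv]
  simp only [this]

lemma lintegral_levelDrift {P : Measure (Env d κ Y)} [IsProbabilityMeasure P] (hP : IIDSites P)
    (j : ℤ) : ∫⁻ ω, levelDrift S j ω ∂P = L * ∫⁻ ω, totalDrift 0 ω ∂P := by
  unfold levelDrift
  rw [lintegral_finsetSum _ fun y _ => measurable_totalDrift y]
  simp only [lintegral_totalDrift hP, Finset.sum_const, S.card_level, nsmul_eq_mul]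

variable [MeasurableSpace Y] [Countable Y] [MeasurableSingletonClass Y]

/-- If the walk cannot escape, then it consumes all the drift at level `0`, uniformly in the
environment at negative heights. The uniformity is Dini's theorem on the compact space of
environments. -/
lemma levelDrift_le_iSup_worstDrift (hκ : 0 < κ) {ω : Env d κ Y}
    (h : prob b (stayAbove S 0) ω 0 = 0) :
    levelDrift S 0 ω ≤ ⨆ m, ENNReal.ofReal (worstDrift S m ω) := by
  rw [levelDrift_eq_iSup]
  refine iSup_le fun I => le_of_forall_lt fun a ha => ?_
  have hat : a ≠ ⊤ := (ha.trans_le le_top).ne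
  obtain ⟨c, hc1, hc2⟩ : ∃ c : ℝ, a < ENNReal.ofReal c ∧
      c < ∑ y ∈ S.level 0, ∑ i ∈ Finset.range I, cookieDrift (ω.1 y i) := by
    obtain ⟨r, hr1, hr2⟩ := ENNReal.lt_iff_exists_nnreal_btwn.1 ha
    exact ⟨r, by rwa [ENNReal.ofReal_coe_nnreal],
      (ENNReal.lt_ofReal_iff_toReal_lt ENNReal.coe_ne_top).1 hr2⟩
  have hcont : ∀ m, Continuous fun ζ : Env d κ Y =>
      costExp b Set.univ (driftOn S {0}) m (glue S 0 ζ ω) 0 := fun m =>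
    (continuous_costExp (fun x => continuous_driftOn S {0} x) m 0).comp
      ((continuous_glue S 0).comp (Continuous.prodMk continuous_const continuous_id))
  -- for each `ζ` the amount `c` is consumed in some number of steps; by compactness and
  -- monotonicity one number of steps suffices for all `ζ`
  obtain ⟨m, hm⟩ := isCompact_univ.elim_directed_cover
    (fun m => {ζ : Env d κ Y | c < costExp b Set.univ (driftOn S {0}) m (glue S 0 ζ ω) 0})
    (fun m => isOpen_lt continuous_const (hcont m))
    (fun ζ _ => by
      have hag : AgreeAbove S 0 (glue S 0 ζ ω) ω := fun y hy => glue_of_le S ζ ω hy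
      have h1 : prob b (stayAbove S (S.ht 0)) (glue S 0 ζ ω) 0 = 0 := by
        rw [map_zero, prob_stayAbove_congr hag, h]
      obtain ⟨m, hm⟩ := eventually_lt_costExp S
        (ae_frequently_visit_of_prob_stayAbove S hκ h1) I (c := c) (by
          refine hc2.trans_le (le_of_eq (Finset.sum_congr rfl fun y hy => ?_))
          rw [glue_of_le S ζ ω ((S.mem_level 0 y).1 hy).ge])
      exact Set.mem_iUnion.2 ⟨m, hm⟩)
    (directed_of_isDirected_le fun m n hmn ζ hζ => lt_of_lt_of_le hζ
      (monotone_costExp (fun _ _ _ => driftOn_nonneg S _ _ _) _ _ hmn))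
  refine hc1.trans_le (le_trans ?_ (le_iSup _ m))
  exact ENNReal.ofReal_le_ofReal (le_worstDrift S fun ζ => le_of_lt (hm (Set.mem_univ ζ)))

lemma tendsto_lintegral_hitExp (hκ : 0 < κ) (P : Measure (Env d κ Y)) [IsProbabilityMeasure P]
    (k : ℤ) (x : Y) :
    Tendsto (fun n => ∫⁻ ω, ENNReal.ofReal
      (hitExp b {y | S.ht y < k} (fun _ _ => 1) n ω x) ∂P) atTop (nhds 1) := by
  have h1 : (1 : ENNReal) = ∫⁻ _, ENNReal.ofReal 1 ∂P := by simp
  rw [h1]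
  refine lintegral_tendsto_of_tendsto_of_monotone
    (fun n => (measurable_hitExp (v := fun _ _ => 1)
      (fun _ => measurable_const) n x).ennreal_ofReal.aemeasurable)
    (ae_of_all _ fun ω n m h => ENNReal.ofReal_le_ofReal
      (monotone_hitExp (fun _ _ _ => zero_le_one) ω x h))
    (ae_of_all _ fun ω => (ENNReal.continuous_ofReal.tendsto _).comp
      (tendsto_hitExp_below S hκ k ω x))

/-- Before reaching the height `J + m`, the walk consumes at least the drift `worstDrift` on each
of the first `J` levels, but altogether at most `J + m` in expectation. -/
lemma lintegral_worstDrift_le_one (hκ : 0 < κ) {P : Measure (Env d κ Y)} [IsProbabilityMeasure P]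
    (hP : IIDSites P) (m : ℕ) : ∫⁻ ω, ENNReal.ofReal (worstDrift S m ω) ∂P ≤ 1 := by
  set G := ∫⁻ ω, ENNReal.ofReal (worstDrift S m ω) ∂P with hG
  have hmeas : Measurable fun ω : Env d κ Y => worstDrift S m ω :=
    (continuous_worstDrift S m).measurable
  have hv0 : ∀ (ω : Env d κ Y) y, 0 ≤ worstDrift S m (shiftEnv y ω) := fun ω y =>
    worstDrift_nonneg S m _
  -- the consumption at the level `j`, counted from the first visit on, has expectation at least `G`
  have key : ∀ J n : ℕ, ∑ j ∈ Finset.range J, (∫⁻ ω, ENNReal.ofReal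
      (hitExp b {y | S.ht y < (j : ℤ)} (fun _ _ => 1) n ω 0) ∂P) * G ≤ ((J + m : ℕ) : ENNReal) := by
    intro J n
    have h1 : ∀ j ∈ Finset.range J, (∫⁻ ω, ENNReal.ofReal
        (hitExp b {y | S.ht y < (j : ℤ)} (fun _ _ => 1) n ω 0) ∂P) * G =
        ∫⁻ ω, ENNReal.ofReal (hitExp b {y | S.ht y < (j : ℤ)}
          (fun ω y => worstDrift S m (shiftEnv y ω)) n ω 0) ∂P := by
      intro j _
      refine (lintegral_hitExp S hP (fun ω y _ => hv0 ω y)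
        (fun y => hmeas.comp (measurable_shiftEnv y)) (fun y hy ω η h => ?_) (fun y _ => ?_) n 0
        (by rw [map_zero]; omega)).symm
      · refine worstDrift_congr S m fun z hz => h (z + y) ?_
        rw [map_add]; omega
      · rw [hG, ← hP.lintegral_shiftEnv y hmeas.ennreal_ofReal]
    rw [Finset.sum_congr rfl h1, ← lintegral_finsetSum
      (f := fun (j : ℕ) ω => ENNReal.ofReal (hitExp b {y | S.ht y < (j : ℤ)}
          (fun ω y => worstDrift S m (shiftEnv y ω)) n ω 0)) _ fun j _ =>
      (measurable_hitExp (fun y => hmeas.comp (measurable_shiftEnv y)) n 0).ennreal_ofReal]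
    have h2 : ∀ ω : Env d κ Y, ∑ j ∈ Finset.range J, ENNReal.ofReal
        (hitExp b {y | S.ht y < (j : ℤ)} (fun ω y => worstDrift S m (shiftEnv y ω)) n ω 0) ≤
        ((J + m : ℕ) : ENNReal) := by
      intro ω
      rw [← ENNReal.ofReal_sum_of_nonneg fun j _ => hitExp_nonneg (fun ω y _ => hv0 ω y) _ _ _,
        ← ENNReal.ofReal_natCast]
      refine ENNReal.ofReal_le_ofReal ?_
      have h3 : ∀ j ∈ Finset.range J, hitExp b {y | S.ht y < (j : ℤ)}
          (fun ω y => worstDrift S m (shiftEnv y ω)) n ω 0 ≤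
          costExp b {y | S.ht y < ((J + m : ℕ) : ℤ)} (driftOn S {(j : ℤ)}) (m + n) ω 0 := by
        intro j hj
        have hj' := Finset.mem_range.1 hj
        refine (hitExp_mono_level (v := costExp b Set.univ (driftOn S {(j : ℤ)}) m)
          (fun ω y hy => hy ▸ worstDrift_shiftEnv_le S m ω y) n ω 0 (by rw [map_zero]; omega)).trans
          (hitExp_costExp_le (driftOn_nonneg S _) m n (by omega) ω 0 (by rw [map_zero]; omega))
      refine (Finset.sum_le_sum h3).trans ?_
      rw [← costExp_sum (Finset.range J) fun (j : ℕ) ω x => driftOn S {(j : ℤ)} ω x]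
      have h4 := costExp_drift_add_down_le S (k := ((J + m : ℕ) : ℤ)) (by omega) (m + n) ω 0
        (by rw [map_zero]; omega)
      have h5 := costExp_nonneg (b := b) (A := {y | S.ht y < ((J + m : ℕ) : ℤ)})
        (c := downCrossing S) (fun ω x _ => downCrossing_nonneg S ω x) (m + n) ω 0
      rw [map_zero, max_self, Int.cast_zero, Int.cast_natCast] at h4
      refine le_trans (costExp_mono (c' := driftOn S (Set.Ici 0)) (fun η z _ => ?_) _ _ _)
        (by linarith)
      by_cases hz : 0 ≤ S.ht z
      · have : ∀ j : ℕ, S.ht z = j ↔ (S.ht z).toNat = j := fun j => by omega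
        simp only [driftOn, Set.mem_singleton_iff, this, Finset.sum_ite_eq]
        rw [if_pos (show S.ht z ∈ Set.Ici 0 from hz)]
        split_ifs
        exacts [le_rfl, η.2.2.2 z 0]
      · rw [Finset.sum_eq_zero]
        · exact driftOn_nonneg S _ _ _
        · intro j _
          rw [driftOn, if_neg]
          simp only [Set.mem_singleton_iff]
          omega
    refine (lintegral_mono h2).trans ?_
    simp
  have hJ : ∀ J : ℕ, (J : ENNReal) * G ≤ ((J + m : ℕ) : ENNReal) := by
    intro J
    have h1 : Tendsto (fun n => ∑ j ∈ Finset.range J, (∫⁻ ω, ENNReal.ofReal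
        (hitExp b {y | S.ht y < (j : ℤ)} (fun _ _ => 1) n ω 0) ∂P) * G) atTop
        (nhds (∑ j ∈ Finset.range J, 1 * G)) :=
      tendsto_finsetSum _ fun j _ => ENNReal.Tendsto.mul_const
        (tendsto_lintegral_hitExp S hκ P j 0) (Or.inl one_ne_zero)
    simpa using le_of_tendsto' h1 (key J)
  by_contra hlt
  rw [not_le] at hlt
  obtain ⟨r, hr1, hr2⟩ := ENNReal.lt_iff_exists_nnreal_btwn.1 hlt
  have hr1' : (1 : ℝ) < r := by exact_mod_cast hr1
  obtain ⟨J, hJ'⟩ := exists_nat_gt ((m : ℝ) / (r - 1))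
  rw [div_lt_iff₀ (by linarith)] at hJ'
  have h1 : (J : ENNReal) * r ≤ ((J + m : ℕ) : ENNReal) :=
    (mul_le_mul_right hr2.le _).trans (hJ J)
  have h2 : (J : ℝ) * r ≤ ((J + m : ℕ) : ℝ) := by exact_mod_cast h1
  push_cast at h2
  linarith

/-- Without escape, the expected drift per level is at most one. -/
theorem lintegral_levelDrift_le_one (hκ : 0 < κ) {P : Measure (Env d κ Y)} [IsProbabilityMeasure P]
    (hP : IIDSites P) (hesc : escapeProb S P = 0) : ∫⁻ ω, levelDrift S 0 ω ∂P ≤ 1 := by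
  rw [escapeProb, lintegral_eq_zero_iff
    (measurable_prob b (measurableSet_stayAbove S 0) 0).ennreal_ofReal] at hesc
  calc ∫⁻ ω, levelDrift S 0 ω ∂P ≤ ∫⁻ ω, ⨆ m, ENNReal.ofReal (worstDrift S m ω) ∂P := by
        refine lintegral_mono_ae ?_
        filter_upwards [hesc] with ω hω
        exact levelDrift_le_iSup_worstDrift S hκ
          (le_antisymm (ENNReal.ofReal_eq_zero.1 hω) (prob_nonneg b _ _ _))
    _ = ⨆ m, ∫⁻ ω, ENNReal.ofReal (worstDrift S m ω) ∂P :=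
        lintegral_iSup (fun m => (continuous_worstDrift S m).measurable.ennreal_ofReal)
          fun m n h ω => ENNReal.ofReal_le_ofReal (worstDrift_mono S ω h)
    _ ≤ 1 := iSup_le fun m => lintegral_worstDrift_le_one S hκ hP m

end Supercritical

/-! ### A walk which may escape leaves cookies behind -/

section Subcritical

variable {d : ℕ} [NeZero d] {κ : NNReal} {Y : Type} [AddCommGroup Y] {b : Fin d → Y} {L : ℕ}

lemma cookieDrift_le (ω : Env d κ Y) (x : Y) (i : ℕ) : cookieDrift (ω.1 x i) ≤ 1 - 2 * κ := by
  have h1 : cookieDrift (ω.1 x i) ≤ ∑ e, ω.1 x i e * (1 - if e = bwd d then 2 else 0) := by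
    refine Finset.sum_le_sum fun e _ => mul_le_mul_of_nonneg_left ?_ (env_nonneg _ _ _ _)
    split_ifs with he
    · rw [he, dotE₁_bwd]; norm_num
    · rcases dotE₁_cases e with h | h | h <;> rw [h] <;> norm_num
  have h2 : ∑ e, ω.1 x i e * (1 - if e = bwd d then 2 else 0) = 1 - ω.1 x i (bwd d) * 2 := by
    simp only [mul_sub, Finset.sum_sub_distrib, mul_one, ω.2.2.1, mul_ite, mul_zero,
      Finset.sum_ite_eq', Finset.mem_univ, if_true]
  have h3 := (ω.2.1 x i (bwd d)).1
  linarith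

lemma totalDrift_eat_self (ω : Env d κ Y) (x : Y) :
    totalDrift x ω = ENNReal.ofReal (cookieDrift (ω.1 x 0)) + totalDrift x (eat ω x) := by
  have h : totalDrift x (eat ω x) = ∑' i, ENNReal.ofReal (cookieDrift (ω.1 x (i + 1))) :=
    tsum_congr fun i => by rw [eat_self]
  rw [h]
  exact tsum_eq_zero_add' (f := fun i => ENNReal.ofReal (cookieDrift (ω.1 x i)))
    ENNReal.summable

open Classical in
lemma totalDrift_eq_add (ω : Env d κ Y) (x y : Y) : totalDrift y ω =
    (if y = x then ENNReal.ofReal (cookieDrift (ω.1 x 0)) else 0) + totalDrift y (eat ω x) := by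
  by_cases h : y = x
  · subst h
    rw [if_pos rfl]
    exact totalDrift_eat_self ω y
  · rw [if_neg h, zero_add, totalDrift, totalDrift, eat_of_ne _ h]

variable (S : StripData b L)

/-- One step of the walk uses up the next cookie at its position. -/
lemma levelDrift_eq_add (j : ℤ) (ω : Env d κ Y) (x : Y) :
    levelDrift S j ω = ENNReal.ofReal (driftOn S {j} ω x) + levelDrift S j (eat ω x) := by
  classical
  unfold levelDrift
  rw [Finset.sum_congr rfl fun y _ => totalDrift_eq_add ω x y, Finset.sum_add_distrib,
    Finset.sum_ite_eq']
  congr 1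
  simp only [S.mem_level, driftOn, Set.mem_singleton_iff]
  split_ifs <;> simp

lemma levelDrift_eat_ne_top {j : ℤ} {ω : Env d κ Y} (h : levelDrift S j ω ≠ ⊤) (x : Y) :
    levelDrift S j (eat ω x) ≠ ⊤ := by
  rw [levelDrift_eq_add S j ω x] at h
  exact (ENNReal.add_ne_top.1 h).2

lemma toReal_levelDrift_eq_add {j : ℤ} {ω : Env d κ Y} (h : levelDrift S j ω ≠ ⊤) (x : Y) :
    (levelDrift S j ω).toReal = driftOn S {j} ω x + (levelDrift S j (eat ω x)).toReal := by
  rw [levelDrift_eq_add S j ω x, ENNReal.toReal_add ENNReal.ofReal_ne_top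
    (levelDrift_eat_ne_top S h x), ENNReal.toReal_ofReal (driftOn_nonneg S _ _ _)]

lemma driftOn_of_ne {j : ℤ} (ω : Env d κ Y) {x : Y} (h : S.ht x ≠ j) :
    driftOn S {j} ω x = 0 := by
  simp [driftOn, h]

lemma levelDrift_congr {j : ℤ} {ω η : Env d κ Y} (h : ∀ y, S.ht y = j → ω.1 y = η.1 y) :
    levelDrift S j ω = levelDrift S j η :=
  Finset.sum_congr rfl fun y hy => by
    simp only [totalDrift, h y ((S.mem_level j y).1 hy)]

/-- The drift that is consumed at a level does not exceed the drift which is available there. -/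
lemma costExp_le_levelDrift (j k : ℤ) (n : ℕ) (ω : Env d κ Y) (x : Y)
    (h : levelDrift S j ω ≠ ⊤) :
    costExp b {y | S.ht y < k} (driftOn S {j}) n ω x ≤ (levelDrift S j ω).toReal := by
  induction n generalizing ω x with
  | zero => exact ENNReal.toReal_nonneg
  | succ n ih =>
    by_cases hA : x ∈ {y | S.ht y < k}
    · rw [costExp_succ_of_mem hA, toReal_levelDrift_eq_add S h x]
      exact add_le_add le_rfl (avg_le_const fun e => ih _ _ (levelDrift_eat_ne_top S h x))
    · rw [costExp_of_notMem hA]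
      exact ENNReal.toReal_nonneg

/-- A walk above the level `j` consumes drift at this level only if it comes back to it. -/
lemma costExp_le_hitExp_mul_levelDrift (j k : ℤ) (n : ℕ) (ω : Env d κ Y) (x : Y)
    (h : levelDrift S j ω ≠ ⊤) :
    costExp b {y | S.ht y < k} (driftOn S {j}) n ω x ≤
      hitExp b {y | j + 1 ≤ S.ht y} (fun _ _ => 1) n ω x * (levelDrift S j ω).toReal := by
  have hnn : ∀ n (ω : Env d κ Y) x,
      0 ≤ hitExp b {y | j + 1 ≤ S.ht y} (fun _ _ => 1) n ω x * (levelDrift S j ω).toReal :=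
    fun n ω x => mul_nonneg (hitExp_nonneg (fun _ _ _ => zero_le_one) _ _ _)
      ENNReal.toReal_nonneg
  by_cases hx : x ∈ {y | j + 1 ≤ S.ht y}
  · induction n generalizing ω x with
    | zero => exact hnn _ _ _
    | succ n ih =>
      by_cases hA : x ∈ {y | S.ht y < k}
      · have hne : S.ht x ≠ j := by
          have : j + 1 ≤ S.ht x := hx
          omega
        have h1 := toReal_levelDrift_eq_add S h x
        rw [driftOn_of_ne S ω hne, zero_add] at h1
        rw [costExp_succ_of_mem hA, driftOn_of_ne S ω hne, zero_add, hitExp_succ_of_mem hx,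
          ← avg_mul_const]
        refine avg_mono fun e => ?_
        rw [h1]
        by_cases hy : x + move b e ∈ {y | j + 1 ≤ S.ht y}
        · exact ih _ _ (levelDrift_eat_ne_top S h x) hy
        · rw [hitExp_of_notMem hy, one_mul]
          exact costExp_le_levelDrift S j k n _ _ (levelDrift_eat_ne_top S h x)
      · rw [costExp_of_notMem hA]
        exact hnn _ _ _
  · rw [hitExp_of_notMem hx, one_mul]
    exact costExp_le_levelDrift S j k n ω x h

variable [MeasurableSpace Y] [Countable Y] [MeasurableSingletonClass Y]

/-- A lower bound for the drift at level `j` that the walk, at its first visit `y` to that level,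
is expected to leave behind forever: it eats the first cookie at `y`, and with probability at
least `κ` it steps forward, after which it may never return to level `j`. -/
noncomputable def leftBehind (j : ℤ) (ω : Env d κ Y) (y : Y) : ℝ :=
  κ * (prob b (stayAbove S (j + 1)) ω (y + move b (fwd d)) * (levelDrift S j (eat ω y)).toReal)

lemma leftBehind_nonneg (j : ℤ) (ω : Env d κ Y) (y : Y) : 0 ≤ leftBehind S j ω y :=
  mul_nonneg κ.2 (mul_nonneg (prob_nonneg b _ _ _) ENNReal.toReal_nonneg)

lemma costExp_add_leftBehind_le {j : ℤ} (k : ℤ) (n : ℕ) (ω : Env d κ Y) (x : Y)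
    (hx : S.ht x = j) (h : levelDrift S j ω ≠ ⊤) :
    costExp b {y | S.ht y < k} (driftOn S {j}) n ω x + leftBehind S j ω x ≤
      (levelDrift S j ω).toReal := by
  have hag : prob b (stayAbove S (j + 1)) ω (x + move b (fwd d)) =
      prob b (stayAbove S (j + 1)) (eat ω x) (x + move b (fwd d)) :=
    prob_stayAbove_congr (agreeAbove_eat ω (by omega)).symm _
  have h' := levelDrift_eat_ne_top S h x
  have h1 := toReal_levelDrift_eq_add S h x
  have hd := driftOn_nonneg S {j} ω x
  have hsmall : leftBehind S j ω x ≤ (levelDrift S j (eat ω x)).toReal := by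
    unfold leftBehind
    have hp := prob_le_one b (stayAbove S (j + 1)) ω (x + move b (fwd d))
    calc _ ≤ 1 * (1 * (levelDrift S j (eat ω x)).toReal) := by
          refine mul_le_mul (κ_le_one ω) (mul_le_mul_of_nonneg_right hp ENNReal.toReal_nonneg)
            (mul_nonneg (prob_nonneg b _ _ _) ENNReal.toReal_nonneg) zero_le_one
      _ = _ := by ring
  by_cases hA : x ∈ {y | S.ht y < k}
  · cases n with
    | zero =>
      simp only [costExp, zero_add]
      linarith
    | succ n =>
      rw [costExp_succ_of_mem hA]
      have h2 := avg_le_sub (b := b) (ω := ω) (x := x)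
        (u := costExp b {y | S.ht y < k} (driftOn S {j}) n)
        (c := (levelDrift S j (eat ω x)).toReal)
        (ε := prob b (stayAbove S (j + 1)) ω (x + move b (fwd d)) *
          (levelDrift S j (eat ω x)).toReal) (fwd d)
        (fun e => costExp_le_levelDrift S j k n _ _ h') (by
          refine (costExp_le_hitExp_mul_levelDrift S j k n _ _ h').trans ?_
          have h3 := hitExp_one_le_prob (b := b) {y | j + 1 ≤ S.ht y} n (eat ω x)
            (x + move b (fwd d))
          have h4 := mul_le_mul_of_nonneg_right h3
            (ENNReal.toReal_nonneg (a := levelDrift S j (eat ω x)))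
          rw [hag]
          unfold stayAbove
          linarith) (mul_nonneg (prob_nonneg b _ _ _) ENNReal.toReal_nonneg)
      unfold leftBehind
      linarith
  · rw [costExp_of_notMem hA]
    linarith

/-- The drift consumed at the level `j` and the drift left behind there do not exceed the drift
which is available there. -/
lemma costExp_add_hitExp_leftBehind_le {j k : ℤ} (hjk : j < k) (n : ℕ) (ω : Env d κ Y) (x : Y)
    (hx : S.ht x ≤ j) (h : levelDrift S j ω ≠ ⊤) :
    costExp b {y | S.ht y < k} (driftOn S {j}) n ω x +
      hitExp b {y | S.ht y < j} (leftBehind S j) n ω x ≤ (levelDrift S j ω).toReal := by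
  induction n generalizing ω x with
  | zero =>
    by_cases hA : x ∈ {y | S.ht y < j}
    · rw [hitExp_zero_of_mem hA, add_zero]
      exact costExp_le_levelDrift S j k 0 ω x h
    · rw [hitExp_of_notMem hA]
      exact costExp_add_leftBehind_le S k 0 ω x (le_antisymm hx (not_lt.1 hA)) h
  | succ n ih =>
    by_cases hA : x ∈ {y | S.ht y < j}
    · have hA' : S.ht x < j := hA
      have hk : x ∈ {y | S.ht y < k} := hA'.trans hjk
      rw [hitExp_succ_of_mem hA, costExp_succ_of_mem hk, driftOn_of_ne S ω hA'.ne, zero_add,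
        ← avg_add, toReal_levelDrift_eq_add S h x, driftOn_of_ne S ω hA'.ne, zero_add]
      refine avg_le_const fun e => ih _ _ ?_ (levelDrift_eat_ne_top S h x)
      have := S.exists_ht x e
      omega
    · rw [hitExp_of_notMem hA]
      exact costExp_add_leftBehind_le S k _ ω x (le_antisymm hx (not_lt.1 hA)) h

lemma measurable_levelDrift (j : ℤ) : Measurable fun ω : Env d κ Y => levelDrift S j ω :=
  Finset.measurable_sum _ fun y _ => measurable_totalDrift y

lemma measurable_leftBehind (j : ℤ) (y : Y) :
    Measurable fun ω : Env d κ Y => leftBehind S j ω y :=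
  ((measurable_prob b (measurableSet_stayAbove S _) _).mul
    ((measurable_levelDrift S j).comp (measurable_eat y)).ennreal_toReal).const_mul _

lemma levelDrift_shiftEnv (y : Y) (ω : Env d κ Y) :
    levelDrift S 0 (shiftEnv y ω) = levelDrift S (S.ht y) ω := by
  unfold levelDrift
  refine Finset.sum_bij (fun z _ => z + y) (fun z hz => ?_) (fun z _ w _ h => add_right_cancel h)
    (fun w hw => ⟨w - y, ?_, sub_add_cancel w y⟩) (fun z _ => rfl)
  · rw [S.mem_level] at hz ⊢
    rw [map_add, hz, zero_add]
  · rw [S.mem_level] at hw ⊢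
    rw [map_sub, hw, sub_self]

/-- The expected drift left behind does not depend on the site. It factorizes, because the cookies
at the level of `y` are independent of the environment above, on which the escape depends. -/
lemma lintegral_leftBehind {P : Measure (Env d κ Y)} [IsProbabilityMeasure P] (hP : IIDSites P)
    (hfin : ∫⁻ ω, levelDrift S 0 ω ∂P ≠ ⊤) {j : ℤ} {y : Y} (hy : S.ht y = j) :
    ∫⁻ ω, ENNReal.ofReal (leftBehind S j ω y) ∂P =
      κ * (escapeProb S P * ∫⁻ ω, levelDrift S 0 (eat ω 0) ∂P) := by
  subst hy
  have hmeas : Measurable fun ω : Env d κ Y => levelDrift S 0 (eat ω 0) :=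
    (measurable_levelDrift S 0).comp (measurable_eat 0)
  have hshift : ∀ ω : Env d κ Y, levelDrift S 0 (eat (shiftEnv y ω) 0) =
      levelDrift S (S.ht y) (eat ω y) := fun ω => by
    rw [eat_shiftEnv, zero_add, levelDrift_shiftEnv]
  have hR : ∫⁻ ω, levelDrift S (S.ht y) (eat ω y) ∂P = ∫⁻ ω, levelDrift S 0 (eat ω 0) ∂P := by
    rw [← hP.lintegral_shiftEnv y hmeas]
    simp only [hshift]
  have hRfin : ∫⁻ ω, levelDrift S (S.ht y) (eat ω y) ∂P ≠ ⊤ := by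
    rw [hR]
    refine ne_top_of_le_ne_top hfin (lintegral_mono fun ω => ?_)
    rw [levelDrift_eq_add S 0 ω 0]
    exact le_add_self
  have hm' : Measurable fun ω : Env d κ Y => levelDrift S (S.ht y) (eat ω y) :=
    (measurable_levelDrift S _).comp (measurable_eat y)
  have h1 : ∫⁻ ω, ENNReal.ofReal (leftBehind S (S.ht y) ω y) ∂P =
      ∫⁻ ω, (κ : ENNReal) * (levelDrift S (S.ht y) (eat ω y) *
        ENNReal.ofReal (prob b (stayAbove S (S.ht y + 1)) ω (y + move b (fwd d)))) ∂P := by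
    refine lintegral_congr_ae ?_
    filter_upwards [ae_lt_top hm' hRfin] with ω hω
    rw [leftBehind, ENNReal.ofReal_mul (NNReal.coe_nonneg κ),
      ENNReal.ofReal_mul (prob_nonneg b _ _ _), ENNReal.ofReal_toReal hω.ne,
      mul_comm (levelDrift _ _ _), ENNReal.ofReal_coe_nnreal]
  have hp : ∫⁻ ω, ENNReal.ofReal (prob b (stayAbove S (S.ht y + 1)) ω (y + move b (fwd d))) ∂P =
      escapeProb S P := by
    rw [← lintegral_prob_stayAbove S hP (y + move b (fwd d)), S.ht_add_move, dotE₁_fwd]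
  have hpm := (measurable_prob (κ := κ) b (measurableSet_stayAbove S (S.ht y + 1))
    (y + move b (fwd d))).ennreal_ofReal
  rw [h1, lintegral_const_mul' _ _ ENNReal.coe_ne_top,
    lintegral_mul_of_agree S hP (S.ht y + 1) hm' hpm
    (fun ω η h => levelDrift_congr S fun z hz => eat_congr_site y (h z (by omega)))
    (fun ω η h => by rw [prob_stayAbove_congr h]), hp, hR, mul_comm (escapeProb S P)]

/-- The height `k` is provided by the drift consumed at the levels `0, …, k - 1` and by the
down-crossings. -/
lemma mul_hitExp_le_sum_costExp (k K N : ℕ) (ω : Env d κ Y) :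
    k * hitExp b {y | S.ht y < (k : ℤ)} (fun _ _ => 1) N ω 0 ≤
      ∑ j ∈ Finset.range k, costExp b {y | S.ht y < (k : ℤ)} (driftOn S {(j : ℤ)}) N ω 0 +
      (K + (k + 1) * prob b (negAfter S K) ω 0) := by
  have h1 := le_costExp_drift_add_down S (k : ℤ) N ω 0
  have h2 := costExp_down_le S (k := (k : ℤ)) (by omega) K N ω 0 (by rw [map_zero]; omega)
  have h3 : costExp b {y | S.ht y < (k : ℤ)} (driftOn S (Set.Ici 0)) N ω 0 ≤
      ∑ j ∈ Finset.range k, costExp b {y | S.ht y < (k : ℤ)} (driftOn S {(j : ℤ)}) N ω 0 := by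
    rw [← costExp_sum (Finset.range k) fun (j : ℕ) ω x => driftOn S {(j : ℤ)} ω x]
    refine costExp_mono (fun η z hz => ?_) _ _ _
    by_cases hz0 : 0 ≤ S.ht z
    · have hz' : S.ht z < k := hz
      refine le_trans (le_of_eq ?_) (Finset.single_le_sum (fun j _ => driftOn_nonneg S _ η z)
        (Finset.mem_range.2 (show (S.ht z).toNat < k by omega)))
      have : S.ht z = ((S.ht z).toNat : ℤ) := by omega
      rw [driftOn, driftOn, if_pos (Set.mem_Ici.2 hz0), if_pos (Set.mem_singleton_iff.2 this)]
    · rw [driftOn, if_neg (by simpa using hz0)]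
      exact Finset.sum_nonneg fun j _ => driftOn_nonneg S _ η z
  rw [map_zero, max_self, Int.cast_zero, zero_add, Int.cast_natCast] at h1
  rw [Int.cast_natCast] at h2
  linarith

/-- The balance of drift on the way to height `k`: the walk gains the height `k`, up to the
down-crossings, from the drift of the cookies at the levels below `k`, of which a part is left
behind. -/
lemma balance (hκ : 0 < κ) {P : Measure (Env d κ Y)} [IsProbabilityMeasure P] (hP : IIDSites P)
    (hfin : ∫⁻ ω, levelDrift S 0 ω ∂P ≠ ⊤) (k K : ℕ) :
    (k : ENNReal) + k * (κ * (escapeProb S P * ∫⁻ ω, levelDrift S 0 (eat ω 0) ∂P)) ≤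
      k * (∫⁻ ω, levelDrift S 0 ω ∂P) +
        (K + (k + 1) * ∫⁻ ω, ENNReal.ofReal (prob b (negAfter S K) ω 0) ∂P) := by
  set C := (κ : ENNReal) * (escapeProb S P * ∫⁻ ω, levelDrift S 0 (eat ω 0) ∂P) with hC
  set D := ∫⁻ ω, levelDrift S 0 ω ∂P with hD
  have hDj : ∀ j : ℤ, ∫⁻ ω, levelDrift S j ω ∂P = D := fun j => by
    rw [hD, lintegral_levelDrift S hP, lintegral_levelDrift S hP]
  have hae : ∀ᵐ ω ∂P, ∀ j : ℤ, levelDrift S j ω ≠ ⊤ := by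
    rw [ae_all_iff]
    intro j
    filter_upwards [ae_lt_top (measurable_levelDrift S j) (by rw [hDj]; exact hfin)] with ω hω
    exact hω.ne
  have hqm := (measurable_prob (κ := κ) b (measurableSet_negAfter S K) 0).ennreal_ofReal
  have key : ∀ N : ℕ, (k : ENNReal) * (∫⁻ ω, ENNReal.ofReal
      (hitExp b {y | S.ht y < (k : ℤ)} (fun _ _ => 1) N ω 0) ∂P) +
      ∑ j ∈ Finset.range k, (∫⁻ ω, ENNReal.ofReal
        (hitExp b {y | S.ht y < (j : ℤ)} (fun _ _ => 1) N ω 0) ∂P) * C ≤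
      k * D + (K + (k + 1) * ∫⁻ ω, ENNReal.ofReal (prob b (negAfter S K) ω 0) ∂P) := by
    intro N
    have h1 : ∀ j ∈ Finset.range k, (∫⁻ ω, ENNReal.ofReal
        (hitExp b {y | S.ht y < (j : ℤ)} (fun _ _ => 1) N ω 0) ∂P) * C =
        ∫⁻ ω, ENNReal.ofReal (hitExp b {y | S.ht y < (j : ℤ)} (leftBehind S j) N ω 0) ∂P := by
      intro j _
      refine (lintegral_hitExp S hP (fun ω y _ => leftBehind_nonneg S _ ω y)
        (fun y => measurable_leftBehind S _ y) (fun y hy ω η h => ?_)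
        (fun y hy => lintegral_leftBehind S hP hfin hy) N 0 (by rw [map_zero]; omega)).symm
      unfold leftBehind
      rw [prob_stayAbove_congr (fun z hz => h z (by omega) : AgreeAbove S ((j : ℤ) + 1) ω η),
        levelDrift_congr S fun z hz => eat_congr_site y (h z hz.ge)]
    have hhm := (measurable_hitExp (κ := κ) (b := b) (A := {y | S.ht y < (k : ℤ)})
      (v := fun _ _ => 1) (fun _ => measurable_const) N 0).ennreal_ofReal
    have hbm : ∀ j : ℕ, Measurable fun ω : Env d κ Y => ENNReal.ofReal
        (hitExp b {y | S.ht y < (j : ℤ)} (leftBehind S j) N ω 0) := fun j =>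
      (measurable_hitExp (fun y => measurable_leftBehind S _ y) N 0).ennreal_ofReal
    rw [Finset.sum_congr rfl h1, ← lintegral_finsetSum _ fun j _ => hbm j,
      ← lintegral_const_mul _ hhm, ← lintegral_add_left (hhm.const_mul _)]
    have h2 : (k : ENNReal) * D + (K + (k + 1) *
        ∫⁻ ω, ENNReal.ofReal (prob b (negAfter S K) ω 0) ∂P) =
        ∫⁻ ω, (∑ j ∈ Finset.range k, levelDrift S (j : ℤ) ω) +
          (K + (k + 1) * ENNReal.ofReal (prob b (negAfter S K) ω 0)) ∂P := by
      rw [lintegral_add_left (Finset.measurable_sum _ fun j _ => measurable_levelDrift S _),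
        lintegral_finsetSum _ fun j _ => measurable_levelDrift S _,
        lintegral_add_left measurable_const, lintegral_const_mul _ hqm]
      simp [hDj]
    rw [h2]
    refine lintegral_mono_ae ?_
    filter_upwards [hae] with ω hω
    have h3 : ∑ j ∈ Finset.range k, levelDrift S (j : ℤ) ω =
        ENNReal.ofReal (∑ j ∈ Finset.range k, (levelDrift S (j : ℤ) ω).toReal) := by
      rw [ENNReal.ofReal_sum_of_nonneg fun j _ => ENNReal.toReal_nonneg]
      exact Finset.sum_congr rfl fun j _ => (ENNReal.ofReal_toReal (hω j)).symm
    have hh0 : ∀ j : ℕ, 0 ≤ hitExp b {y | S.ht y < (j : ℤ)} (leftBehind S j) N ω 0 := fun j =>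
      hitExp_nonneg (fun ω y _ => leftBehind_nonneg S _ ω y) _ _ _
    have hh1 : 0 ≤ hitExp b {y | S.ht y < (k : ℤ)} (fun _ _ => 1) N ω 0 :=
      hitExp_nonneg (fun _ _ _ => zero_le_one) _ _ _
    have hq0 := prob_nonneg b (negAfter S K) ω 0
    have e1 : (k : ENNReal) = ENNReal.ofReal k := (ENNReal.ofReal_natCast k).symm
    have e2 : (K : ENNReal) = ENNReal.ofReal K := (ENNReal.ofReal_natCast K).symm
    have hk0 : (0 : ℝ) ≤ k := Nat.cast_nonneg k
    have hK0 : (0 : ℝ) ≤ K := Nat.cast_nonneg K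
    rw [h3, ← ENNReal.ofReal_sum_of_nonneg fun j _ => hh0 j, e1, e2, ← ENNReal.ofReal_one,
      ← ENNReal.ofReal_mul hk0, ← ENNReal.ofReal_add hk0 zero_le_one,
      ← ENNReal.ofReal_mul (by linarith), ← ENNReal.ofReal_add hK0 (by positivity),
      ← ENNReal.ofReal_add (mul_nonneg hk0 hh1) (Finset.sum_nonneg fun j _ => hh0 j),
      ← ENNReal.ofReal_add (Finset.sum_nonneg fun j _ => ENNReal.toReal_nonneg) (by positivity)]
    refine ENNReal.ofReal_le_ofReal ?_
    have h4 := mul_hitExp_le_sum_costExp S k K N ω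
    have h5 : ∑ j ∈ Finset.range k, costExp b {y | S.ht y < (k : ℤ)} (driftOn S {(j : ℤ)}) N ω 0 +
        ∑ j ∈ Finset.range k, hitExp b {y | S.ht y < (j : ℤ)} (leftBehind S j) N ω 0 ≤
        ∑ j ∈ Finset.range k, (levelDrift S (j : ℤ) ω).toReal := by
      rw [← Finset.sum_add_distrib]
      refine Finset.sum_le_sum fun j hj => ?_
      have := Finset.mem_range.1 hj
      exact costExp_add_hitExp_leftBehind_le S (by omega) N ω 0 (by rw [map_zero]; omega) (hω j)
    linarith
  have hlim : Tendsto (fun N => (k : ENNReal) * (∫⁻ ω, ENNReal.ofReal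
      (hitExp b {y | S.ht y < (k : ℤ)} (fun _ _ => 1) N ω 0) ∂P) +
      ∑ j ∈ Finset.range k, (∫⁻ ω, ENNReal.ofReal
        (hitExp b {y | S.ht y < (j : ℤ)} (fun _ _ => 1) N ω 0) ∂P) * C) atTop
      (nhds ((k : ENNReal) * 1 + ∑ j ∈ Finset.range k, 1 * C)) :=
    (ENNReal.Tendsto.const_mul (tendsto_lintegral_hitExp S hκ P k 0) (Or.inl one_ne_zero)).add
      (tendsto_finsetSum _ fun j _ => ENNReal.Tendsto.mul_const
        (tendsto_lintegral_hitExp S hκ P j 0) (Or.inl one_ne_zero))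
  simpa using le_of_tendsto' hlim key

/-- If the expected drift per level is at most one, then the walk cannot escape: a walk which may
escape needs a drift of at least one per level, and on top of it leaves some drift behind. -/
theorem escapeProb_eq_zero (hκ : 0 < κ) {P : Measure (Env d κ Y)} [IsProbabilityMeasure P]
    (hP : IIDSites P) (hD1 : ∫⁻ ω, levelDrift S 0 ω ∂P ≤ 1) : escapeProb S P = 0 := by
  by_contra hesc
  have hfin : ∫⁻ ω, levelDrift S 0 ω ∂P ≠ ⊤ := ne_top_of_le_ne_top ENNReal.one_ne_top hD1
  have hR : ∫⁻ ω, levelDrift S 0 ω ∂P ≤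
      ENNReal.ofReal (1 - 2 * κ) + ∫⁻ ω, levelDrift S 0 (eat ω 0) ∂P := by
    have h1 : ∫⁻ ω, levelDrift S 0 ω ∂P ≤
        ∫⁻ ω, ENNReal.ofReal (1 - 2 * κ) + levelDrift S 0 (eat ω 0) ∂P := by
      refine lintegral_mono fun ω => ?_
      rw [levelDrift_eq_add S 0 ω 0]
      refine add_le_add (ENNReal.ofReal_le_ofReal ?_) le_rfl
      rw [driftOn, if_pos (by simp)]
      exact cookieDrift_le ω 0 0
    rw [lintegral_add_left measurable_const] at h1
    simpa using h1
  have hRfin : ∫⁻ ω, levelDrift S 0 (eat ω 0) ∂P ≠ ⊤ := by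
    refine ne_top_of_le_ne_top hfin (lintegral_mono fun ω => ?_)
    rw [levelDrift_eq_add S 0 ω 0]
    exact le_add_self
  have hbal := balance S hκ hP hfin
  have hq : Tendsto (fun K => ∫⁻ ω, ENNReal.ofReal (prob b (negAfter S K) ω 0) ∂P) atTop
      (nhds 0) := by
    have h0 : (0 : ENNReal) = ∫⁻ _, 0 ∂P := by simp
    rw [h0]
    refine tendsto_lintegral_of_dominated_convergence (fun _ => 1)
      (fun K => (measurable_prob b (measurableSet_negAfter S K) 0).ennreal_ofReal)
      (fun K => ae_of_all _ fun ω => ENNReal.ofReal_le_one.2 (prob_le_one b _ _ _)) (by simp) ?_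
    filter_upwards [prob_negOften_eq_zero S hκ hP hesc] with ω hω
    have h := tendsto_prob_negAfter (b := b) S ω 0
    rw [hω] at h
    have h' := (ENNReal.continuous_ofReal.tendsto _).comp h
    rwa [ENNReal.ofReal_zero] at h'
  have hpt : escapeProb S P ≠ ⊤ := ne_top_of_le_ne_top ENNReal.one_ne_top (escapeProb_le_one S)
  have hCfin : (κ : ENNReal) * (escapeProb S P * ∫⁻ ω, levelDrift S 0 (eat ω 0) ∂P) ≠ ⊤ :=
    ENNReal.mul_ne_top ENNReal.coe_ne_top (ENNReal.mul_ne_top hpt hRfin)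
  -- dividing the balance by `k → ∞`
  have hlim : ∀ K, 1 + (κ : ENNReal) * (escapeProb S P * ∫⁻ ω, levelDrift S 0 (eat ω 0) ∂P) ≤
      ∫⁻ ω, levelDrift S 0 ω ∂P + ∫⁻ ω, ENNReal.ofReal (prob b (negAfter S K) ω 0) ∂P := by
    intro K
    have hqfin : ∫⁻ ω, ENNReal.ofReal (prob b (negAfter S K) ω 0) ∂P ≠ ⊤ := by
      refine ne_top_of_le_ne_top ENNReal.one_ne_top ((lintegral_mono (g := fun _ => 1) fun ω =>
        ENNReal.ofReal_le_one.2 (prob_le_one b _ _ _)).trans (by simp))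
    have h := fun k => hbal k K
    generalize (κ : ENNReal) * (escapeProb S P * ∫⁻ ω, levelDrift S 0 (eat ω 0) ∂P) = C at *
    generalize ∫⁻ ω, levelDrift S 0 ω ∂P = D at *
    generalize ∫⁻ ω, ENNReal.ofReal (prob b (negAfter S K) ω 0) ∂P = q at *
    lift C to NNReal using hCfin
    lift D to NNReal using hfin
    lift q to NNReal using hqfin
    have h' : ∀ k : ℕ, (k : ℝ) + k * C ≤ k * D + (K + (k + 1) * q) := fun k => by
      exact_mod_cast h k
    by_contra hlt
    rw [not_le] at hlt
    have hlt' : (D : ℝ) + q < 1 + C := by exact_mod_cast hlt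
    obtain ⟨k, hk⟩ := exists_nat_gt (((K : ℝ) + q) / (1 + C - (D + q)))
    rw [div_lt_iff₀ (by linarith)] at hk
    have := h' k
    linarith
  have hle : 1 + (κ : ENNReal) * (escapeProb S P * ∫⁻ ω, levelDrift S 0 (eat ω 0) ∂P) ≤
      ∫⁻ ω, levelDrift S 0 ω ∂P := by
    have := hq.const_add (∫⁻ ω, levelDrift S 0 ω ∂P)
    rw [add_zero] at this
    exact ge_of_tendsto' this hlim
  -- hence nothing is left behind, so that the first cookie at `0` is the only one at level `0` with
  -- a drift; but a single cookie has drift at most `1 - 2κ < 1`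
  have hC0 : (κ : ENNReal) * (escapeProb S P * ∫⁻ ω, levelDrift S 0 (eat ω 0) ∂P) = 0 := by
    have h1 := hle.trans hD1
    rwa [← add_zero (1 : ENNReal), add_assoc, zero_add,
      ENNReal.add_le_add_iff_left ENNReal.one_ne_top, nonpos_iff_eq_zero] at h1
  have hR0 : ∫⁻ ω, levelDrift S 0 (eat ω 0) ∂P = 0 := by
    rcases mul_eq_zero.1 hC0 with h | h
    · exact absurd (ENNReal.coe_eq_zero.1 h) hκ.ne'
    · exact (mul_eq_zero.1 h).resolve_left hesc
  rw [hR0, add_zero] at hR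
  have h1 : (1 : ENNReal) ≤ ENNReal.ofReal (1 - 2 * κ) := (le_self_add.trans hle).trans hR
  rw [ENNReal.one_le_ofReal] at h1
  have : (0 : ℝ) < κ := hκ
  linarith

end Subcritical

/-! ### The dichotomy between transience and recurrence -/

section Dichotomy

variable {d : ℕ} [NeZero d] {κ : NNReal} {Y : Type} [AddCommGroup Y] {b : Fin d → Y} {L : ℕ}
variable (S : StripData b L) [MeasurableSpace Y] [Countable Y] [MeasurableSingletonClass Y]

/-- An expected drift per level above one excludes that the walk cannot escape, and a walk which
may escape is transient. -/
theorem ae_tendsto_ht (hκ : 0 < κ) {P : Measure (Env d κ Y)} [IsProbabilityMeasure P]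
    (hP : IIDSites P) (h : 1 < L * ∫⁻ ω, totalDrift 0 ω ∂P) :
    ∀ᵐ ω ∂P, ∀ᵐ X ∂walkLaw b ω 0, Tendsto (fun n => S.ht (X n)) atTop atTop := by
  have hesc : escapeProb S P ≠ 0 := fun h0 => by
    have := lintegral_levelDrift_le_one S hκ hP h0
    rw [lintegral_levelDrift S hP] at this
    exact absurd h (not_lt.2 this)
  filter_upwards [prob_negOften_eq_zero S hκ hP hesc] with ω hω
  have h1 : ∀ᵐ X ∂walkLaw b ω 0, X ∉ negOften S := by
    rw [← prob_eq_zero_iff]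
    simpa using hω
  filter_upwards [h1, ae_frequently_visit S hκ ω 0] with X hX h2
  rw [tendsto_atTop]
  intro k
  by_contra hk
  refine hX ((h2 k ((not_eventually.1 hk).mono fun n hn => (not_le.1 hn).le)
    (move b (bwd d))).mono fun n hn => ?_)
  rw [hn, S.ht_move, dotE₁_bwd]
  norm_num

lemma StripData.ht_surjective (S : StripData b L) : Function.Surjective S.ht := fun k =>
  ⟨k • move b (fwd d), by rw [map_zsmul, S.ht_move, dotE₁_fwd]; simp⟩

lemma oscillates_of_frequently {u : ℕ → ℤ} (h : ∀ k, ∃ᶠ n in atTop, u n = k) : Oscillates u := by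
  constructor
  · refine EReal.eq_top_iff_forall_lt _ |>.2 fun r => ?_
    obtain ⟨k, hk⟩ := exists_int_gt r
    refine lt_of_lt_of_le (EReal.coe_lt_coe_iff.2 hk)
      (le_limsup_of_frequently_le ((h k).mono fun n hn => by rw [hn]))
  · refine EReal.eq_bot_iff_forall_lt _ |>.2 fun r => ?_
    obtain ⟨k, hk⟩ := exists_int_lt r
    refine lt_of_le_of_lt (liminf_le_of_frequently_le ((h k).mono fun n hn => by rw [hn]))
      (EReal.coe_lt_coe_iff.2 hk)

/-- With an expected drift per level of at most one the walk cannot escape, whence it visits all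
sites infinitely often. -/
theorem ae_returnsInfinitelyOften_and_oscillates (hκ : 0 < κ) {P : Measure (Env d κ Y)}
    [IsProbabilityMeasure P] (hP : IIDSites P) (h : L * ∫⁻ ω, totalDrift 0 ω ∂P ≤ 1) :
    ∀ᵐ ω ∂P, ∀ᵐ X ∂walkLaw b ω 0,
      ReturnsInfinitelyOften X ∧ Oscillates (fun n => S.ht (X n)) := by
  have hesc : escapeProb S P = 0 :=
    escapeProb_eq_zero S hκ hP (by rwa [lintegral_levelDrift S hP])
  rw [escapeProb, lintegral_eq_zero_iff
    (measurable_prob b (measurableSet_stayAbove S 0) 0).ennreal_ofReal] at hesc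
  filter_upwards [hesc] with ω hω
  have h0 : prob b (stayAbove S (S.ht 0)) ω 0 = 0 := by
    rw [map_zero]
    exact le_antisymm (ENNReal.ofReal_eq_zero.1 hω) (prob_nonneg b _ _ _)
  filter_upwards [ae_frequently_visit_of_prob_stayAbove S hκ h0] with X hX
  refine ⟨hX _, oscillates_of_frequently fun k => ?_⟩
  obtain ⟨y, hy⟩ := S.ht_surjective k
  exact (hX y).mono fun n hn => by rw [hn, hy]

end Dichotomy

/-! ### The line and the strips -/

lemma ht_move_of_basis {d : ℕ} {Y : Type} [AddCommGroup Y] {b : Fin d → Y} (f : Y →+ ℤ)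
    (h : ∀ j, f (b j) = if (j : ℕ) = 0 then 1 else 0) (e : Dir d) : f (move b e) = e.dotE₁ := by
  rw [move, map_zsmul, h, Dir.dotE₁]
  split_ifs <;> simp

/-- The line as a strip of width one. -/
def lineData : StripData lineBasis 1 where
  ht := AddMonoidHom.id ℤ
  ht_move := ht_move_of_basis _ fun j => by fin_cases j; simp [lineBasis]
  level j := {j}
  mem_level j y := Finset.mem_singleton
  card_level j := Finset.card_singleton j
  conn x y h := by
    obtain rfl : x = y := h
    exact .refl

/-- The strip, whose height function is the first coordinate. -/
def stripData (L : ℕ) [NeZero L] : StripData (stripBasis L) L where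
  ht := AddMonoidHom.fst ℤ (ZMod L)
  ht_move := ht_move_of_basis _ fun j => by fin_cases j <;> simp [stripBasis]
  level j := {j} ×ˢ Finset.univ
  mem_level j y := by
    rw [Finset.mem_product, Finset.mem_singleton]
    simp
  card_level j := by simp [ZMod.card]
  conn x y h := by
    -- sites of the same height are joined by steps in direction `e₂`
    have h1 : ∀ n : ℕ, Relation.ReflTransGen
        (fun x y : Strip L => ∃ e : Dir 2, e.dotE₁ = 0 ∧ y = x + move (stripBasis L) e) x
        (x + n • ((0, 1) : Strip L)) := by
      intro n
      induction n with
      | zero => simpa using Relation.ReflTransGen.refl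
      | succ n ih =>
        refine ih.tail ⟨(1, 1), by simp [Dir.dotE₁], ?_⟩
        rw [succ_nsmul, ← add_assoc]
        simp [move, stripBasis]
    have h2 : y = x + (y.2 - x.2).val • ((0, 1) : Strip L) := by
      refine Prod.ext ?_ ?_
      · simpa using (show x.1 = y.1 from h).symm
      · simp
    rw [h2]
    exact h1 _

end ERW

theorem theorem4 :
    -- the line `ℤ` (`d = 1`, `L = 1`)
    (∀ (κ : NNReal), 0 < κ → κ ≤ 1 / 2 →
      ∀ (P : Measure (ERW.Env 1 κ ℤ)) [IsProbabilityMeasure P], ERW.IIDSites P →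
        (1 < ∫⁻ ω, ERW.totalDrift 0 ω ∂P →
          ∀ᵐ ω ∂P, ∀ᵐ X ∂(ERW.walkLaw ERW.lineBasis ω 0), Tendsto X atTop atTop) ∧
        (∫⁻ ω, ERW.totalDrift 0 ω ∂P ≤ 1 →
          ∀ᵐ ω ∂P, ∀ᵐ X ∂(ERW.walkLaw ERW.lineBasis ω 0),
            ERW.ReturnsInfinitelyOften X ∧ ERW.Oscillates X)) ∧
    -- the strips `ℤ × {0, …, L-1}` (`d = 2`, `L ≥ 2`)
    (∀ (L : ℕ) [NeZero L], 2 ≤ L → ∀ (κ : NNReal), 0 < κ → κ ≤ 1 / 4 →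
      ∀ (P : Measure (ERW.Env 2 κ (ERW.Strip L))) [IsProbabilityMeasure P], ERW.IIDSites P →
        (1 / (L : ENNReal) < ∫⁻ ω, ERW.totalDrift 0 ω ∂P →
          ∀ᵐ ω ∂P, ∀ᵐ X ∂(ERW.walkLaw (ERW.stripBasis L) ω 0),
            Tendsto (fun n => (X n).1) atTop atTop) ∧
        (∫⁻ ω, ERW.totalDrift 0 ω ∂P ≤ 1 / (L : ENNReal) →
          ∀ᵐ ω ∂P, ∀ᵐ X ∂(ERW.walkLaw (ERW.stripBasis L) ω 0),
            ERW.ReturnsInfinitelyOften X ∧ ERW.Oscillates (fun n => (X n).1))) := by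
  refine ⟨fun κ hκ _ P _ hP => ⟨fun h => ?_, fun h => ?_⟩,
    fun L _ _ κ hκ _ P _ hP => ⟨fun h => ?_, fun h => ?_⟩⟩
  · exact ERW.ae_tendsto_ht ERW.lineData hκ hP (by simpa using h)
  · exact ERW.ae_returnsInfinitelyOften_and_oscillates ERW.lineData hκ hP (by simpa using h)
  · refine ERW.ae_tendsto_ht (ERW.stripData L) hκ hP ?_
    rwa [ENNReal.div_lt_iff (Or.inl (Nat.cast_ne_zero.2 (NeZero.ne L)))
      (Or.inl (ENNReal.natCast_ne_top L)), mul_comm] at h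
  · refine ERW.ae_returnsInfinitelyOften_and_oscillates (ERW.stripData L) hκ hP ?_
    rwa [ENNReal.le_div_iff_mul_le (Or.inl (Nat.cast_ne_zero.2 (NeZero.ne L)))
      (Or.inl (ENNReal.natCast_ne_top L)), mul_comm] at h
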